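/- **Conventions.** Let $p$ be an odd prime, let $\mathbf R$ be the ring of algebraic integers in $\mathbb C$ and $\mathfrak m$ a maximal ideal of $\mathbf R$ containing $p$; Brauer characters of finite groups are formed from representations over $\mathbf R/\mathfrak m$ by lifting eigenvalues through $\mathbf R\to\mathbf R/\mathfrak m$. For a character $\chi$, $\chi^0$ denotes its restriction to the $p$-regular elements. A character is $p$-rational if all its values lie in $\mathbb Q(\zeta)$ for some root of unity $\zeta$ of order not divisible by $p$. A character triple $(G,N,\theta)$ consists of a finite group $G$, a normal subgroup $N$ and a $G$-invariant $\theta\in\mathrm{Irr}(N)$; it is ordinary-modular if moreover $\theta^0\in\mathrm{IBr}(N)$. For $N\le U\le G$, $\mathrm{Irr}(U\mid\theta)$ (resp. $\mathrm{IBr}(U\mid\theta^0)$) is the set of irreducible (Brauer) characters of $U$ whose restriction to $N$ has $\theta$ (resp. $\theta^0$) as a constituent, and $\mathrm{Ch}(U\mid\theta)$ (resp. $\mathrm{Ch}(U\mid\theta^0)$) is the set of (Brauer) characters of $U$, including $0$, whose restriction to $N$ is a multiple of $\theta$ (resp. $\theta^0$). An isomorphism of ordinary-modular character triples $(G,N,\theta)\to(\Gamma,M,\xi)$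 consists of a group isomorphism $\tau:G/N\to\Gamma/M$ and, for every $N\le U\le G$, with $U^\tau$ the full preimage of $\tau(U/N)$ in $\Gamma$, maps $\mathrm{Ch}(U\mid\theta)\to\mathrm{Ch}(U^\tau\mid\xi)$ and $\mathrm{Ch}(U\mid\theta^0)\to\mathrm{Ch}(U^\tau\mid\xi^0)$, both written $\chi\mapsto\tilde\chi$, such that: 1. both maps are additive and restrict to bijections $\mathrm{Irr}(U\mid\theta)\to\mathrm{Irr}(U^\tau\mid\xi)$ and $\mathrm{IBr}(U\mid\theta^0)\to\mathrm{IBr}(U^\tau\mid\xi^0)$; 2. $[\tilde\chi,\tilde\psi]=[\chi,\psi]$ for $\chi,\psi\in\mathrm{Ch}(U\mid\theta)$; 3. both maps commute with restriction: $\widetilde{\chi_K}=\tilde\chi_{K^\tau}$ for $N\le K\le U$; 4. $\widetilde{\chi\beta}=\tilde\chi\,\beta^\tau$ for every character (resp. Brauer character) $\beta$ of $U/N$, where $\beta^\tau$ is the corresponding (Brauer) character of $U^\tau/M$, and both are inflated; 5. $\widetilde{\chi^0}=(\tilde\chi)^0$ for $\chi\in\mathrm{Ch}(U\mid\theta)$.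 **Theorem.** Let $(G,N,\theta)$ be a character triple such that $\theta$ is $p$-rational and $\theta^0\in\mathrm{IBr}(N)$. Then there exist an ordinary-modular character triple $(\Gamma,M,\xi)$ and an isomorphism of ordinary-modular character triples $(G,N,\theta)\to(\Gamma,M,\xi)$, $\chi\mapsto\tilde\chi$, such that (a) $M$ is a central $p'$-subgroup of $\Gamma$ (that is, $M\le\mathbf Z(\Gamma)$ and $p\nmid|M|$); (b) if $N\le U\le G$ and $\chi\in\mathrm{Irr}(U\mid\theta)$, then $\chi$ is $p$-rational if and only if its correspondent $\tilde\chi$ is $p$-rational. -/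

import Mathlib

universe u

namespace OrdMod

/-! ### Ordinary characters -/

/-- `χ` is the character of a finite-dimensional complex representation of `H`. The zero-dimensional
representation is allowed, so that the zero function counts as a (degenerate) character. -/
def IsChar {H : Type*} [Group H] (χ : H → ℂ) : Prop :=
  ∃ (n : ℕ) (ρ : Representation ℂ H (Fin n → ℂ)), χ = ρ.character

/-- `χ ∈ Irr(H)`. -/
def IsIrr {H : Type*} [Group H] (χ : H → ℂ) : Prop :=
  ∃ (n : ℕ) (ρ : Representation ℂ H (Fin n → ℂ)), ρ.IsIrreducible ∧ χ = ρ.character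

/-- The inner product `[χ, ψ] = |H|⁻¹ ∑ χ(h) conj(ψ(h))` of class functions of a finite group. -/
noncomputable def charInner {H : Type*} [Group H] (χ ψ : H → ℂ) : ℂ :=
  (Nat.card H : ℂ)⁻¹ * ∑ᶠ h : H, χ h * starRingEnd ℂ (ψ h)

/-- All values of `χ` lie in one cyclotomic field `ℚ(ζ)`, where `ζ` is a root of unity whose order
is not divisible by `p`. -/
def IsPRational {H : Type*} (p : ℕ) (χ : H → ℂ) : Prop :=
  ∃ (m : ℕ) (ζ : ℂ), ¬ p ∣ m ∧ IsPrimitiveRoot ζ m ∧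
    ∀ h, χ h ∈ IntermediateField.adjoin ℚ {ζ}

/-! ### Brauer characters with respect to a maximal ideal of the ring of algebraic integers -/

/-- The ring of algebraic integers in `ℂ`. -/
abbrev AlgInt : Type := integralClosure ℤ ℂ

noncomputable instance residueField (𝔪 : Ideal AlgInt) [𝔪.IsMaximal] : Field (AlgInt ⧸ 𝔪) :=
  Ideal.Quotient.field 𝔪

/-- The `p`-regular elements of `H`, those whose order is not divisible by `p` (`H` finite). -/
abbrev PReg (p : ℕ) (H : Type*) [Group H] : Type _ := {h : H // p.Coprime (orderOf h)}

/-- The map on `p`-regular elements induced by a group homomorphism. -/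
def PReg.map {p : ℕ} {H K : Type*} [Group H] [Group K] (f : H →* K) (h : PReg p H) : PReg p K :=
  ⟨f h.1, Nat.Coprime.coprime_dvd_right (orderOf_map_dvd f h.1) h.2⟩

/-- The restriction `χ⁰` of `χ` to the `p`-regular elements. -/
def reg (p : ℕ) {H : Type*} [Group H] (χ : H → ℂ) : PReg p H → ℂ := fun h => χ h.1

open Classical in
/-- For `x` a root of unity of order prime to `p` in the residue field, the unique complex root of
unity of order prime to `p` that reduces to `x` modulo `𝔪` (and `0` for other `x`). -/
noncomputable def rootLift (p : ℕ) (𝔪 : Ideal AlgInt) (x : AlgInt ⧸ 𝔪) : ℂ :=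
  if h : ∃ ζ : AlgInt, (∃ k : ℕ, p.Coprime k ∧ ζ ^ k = 1) ∧ Ideal.Quotient.mk 𝔪 ζ = x then
    (h.choose : ℂ)
  else 0

/-- The Brauer character of a representation over the residue field: at a `p`-regular element,
the sum of the lifts of the eigenvalues, counted with algebraic multiplicity. -/
noncomputable def brauerChar (p : ℕ) (𝔪 : Ideal AlgInt) [𝔪.IsMaximal] {H : Type*} [Group H]
    {n : ℕ} (ρ : Representation (AlgInt ⧸ 𝔪) H (Fin n → AlgInt ⧸ 𝔪)) : PReg p H → ℂ :=
  fun h => (((ρ h.1).charpoly.roots).map (rootLift p 𝔪)).sum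

/-- `φ` is a Brauer character of `H` (the zero function is allowed). -/
def IsBrauerChar (p : ℕ) (𝔪 : Ideal AlgInt) [𝔪.IsMaximal] {H : Type*} [Group H]
    (φ : PReg p H → ℂ) : Prop :=
  ∃ (n : ℕ) (ρ : Representation (AlgInt ⧸ 𝔪) H (Fin n → AlgInt ⧸ 𝔪)), φ = brauerChar p 𝔪 ρ

/-- `φ ∈ IBr(H)`. -/
def IsIBr (p : ℕ) (𝔪 : Ideal AlgInt) [𝔪.IsMaximal] {H : Type*} [Group H]
    (φ : PReg p H → ℂ) : Prop :=
  ∃ (n : ℕ) (ρ : Representation (AlgInt ⧸ 𝔪) H (Fin n → AlgInt ⧸ 𝔪)),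
    ρ.IsIrreducible ∧ φ = brauerChar p 𝔪 ρ

/-! ### Characters over a given character of a normal subgroup -/

section Over

variable {G : Type*} [Group G]

/-- Restriction of a function on the subgroup `H` to a smaller subgroup `K`. -/
def res {K H : Subgroup G} (hKH : K ≤ H) (χ : H → ℂ) : K → ℂ :=
  fun k => χ (Subgroup.inclusion hKH k)

/-- Restriction of a function on the `p`-regular elements of `H` to those of `K`. -/
def resReg {p : ℕ} {K H : Subgroup G} (hKH : K ≤ H) (φ : PReg p H → ℂ) : PReg p K → ℂ :=
  fun k => φ (PReg.map (Subgroup.inclusion hKH) k)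

/-- `Ch(U | θ)`: the characters of `U` whose restriction to `N` is a multiple of `θ`. -/
def ChOver {N U : Subgroup G} (hU : N ≤ U) (θ : N → ℂ) : Set (U → ℂ) :=
  {χ | IsChar χ ∧ ∃ e : ℕ, res hU χ = e • θ}

/-- `Irr(U | θ)`: the irreducible characters of `U` such that `θ` is a constituent of their
restriction to `N`. -/
def IrrOver {N U : Subgroup G} (hU : N ≤ U) (θ : N → ℂ) : Set (U → ℂ) :=
  {χ | IsIrr χ ∧ ∃ ψ : N → ℂ, IsChar ψ ∧ res hU χ = θ + ψ}

/-- The Brauer characters of `U` whose restriction to `N` is a multiple of `φ`. -/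
def BrOver (p : ℕ) (𝔪 : Ideal AlgInt) [𝔪.IsMaximal] {N U : Subgroup G} (hU : N ≤ U)
    (φ : PReg p N → ℂ) : Set (PReg p U → ℂ) :=
  {η | IsBrauerChar p 𝔪 η ∧ ∃ e : ℕ, resReg hU η = e • φ}

/-- `IBr(U | φ)`: the irreducible Brauer characters of `U` such that `φ` is a constituent of their
restriction to `N`. -/
def IBrOver (p : ℕ) (𝔪 : Ideal AlgInt) [𝔪.IsMaximal] {N U : Subgroup G} (hU : N ≤ U)
    (φ : PReg p N → ℂ) : Set (PReg p U → ℂ) :=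
  {η | IsIBr p 𝔪 η ∧ ∃ ψ : PReg p N → ℂ, IsBrauerChar p 𝔪 ψ ∧ resReg hU η = φ + ψ}

/-- `(G, N, θ)` is a character triple: `N` is normal in `G` and `θ ∈ Irr(N)` is `G`-invariant. -/
structure IsCharTriple (N : Subgroup G) [N.Normal] (θ : N → ℂ) : Prop where
  irr : IsIrr θ
  invariant : ∀ (g : G) (n : N), θ (MulAut.conjNormal g n) = θ n

/-- `(G, N, θ)` is an ordinary-modular character triple. -/
structure IsOrdModTriple (p : ℕ) (𝔪 : Ideal AlgInt) [𝔪.IsMaximal] (N : Subgroup G) [N.Normal]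
    (θ : N → ℂ) : Prop extends IsCharTriple N θ where
  ibr : IsIBr p 𝔪 (reg p θ)

end Over

/-! ### Isomorphisms of ordinary-modular character triples -/

section Iso

variable {G Γ : Type*} [Group G] [Group Γ] {N : Subgroup G} [N.Normal] {M : Subgroup Γ} [M.Normal]

/-- For an isomorphism `τ : G/N ≃ Γ/M` and `N ≤ U ≤ G`, the full preimage in `Γ` of `τ(U/N)`. -/
def corr (τ : G ⧸ N ≃* Γ ⧸ M) (U : Subgroup G) : Subgroup Γ :=
  ((U.map (QuotientGroup.mk' N)).map τ.toMonoidHom).comap (QuotientGroup.mk' M)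

theorem le_corr (τ : G ⧸ N ≃* Γ ⧸ M) (U : Subgroup G) : M ≤ corr τ U := by
  intro m hm
  have h : (QuotientGroup.mk' M) m = 1 := by simpa using hm
  simp only [corr, Subgroup.mem_comap, h, one_mem]

theorem corr_mono (τ : G ⧸ N ≃* Γ ⧸ M) {K U : Subgroup G} (h : K ≤ U) : corr τ K ≤ corr τ U :=
  Subgroup.comap_mono (Subgroup.map_mono (Subgroup.map_mono h))

/-- The projection `U → U/N`, where `U/N` is the image of `U` in `G/N`. -/
def toQuot (N : Subgroup G) [N.Normal] (U : Subgroup G) : U →* U.map (QuotientGroup.mk' N) :=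
  (QuotientGroup.mk' N).subgroupMap U

/-- The homomorphism `v ↦ τ⁻¹(vM)` from the subgroup `corr τ U` of `Γ` to `U/N`. -/
def corrToQuot (τ : G ⧸ N ≃* Γ ⧸ M) (U : Subgroup G) :
    corr τ U →* U.map (QuotientGroup.mk' N) :=
  (τ.symm.toMonoidHom.comp ((QuotientGroup.mk' M).comp (corr τ U).subtype)).codRestrict
    (U.map (QuotientGroup.mk' N)) (by
      rintro ⟨v, hv⟩
      obtain ⟨w, hw, hwv⟩ := Subgroup.mem_map.1 (Subgroup.mem_comap.1 hv)
      have h : τ.symm ((QuotientGroup.mk' M) v) = w := by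
        rw [← hwv]; exact τ.symm_apply_apply w
      change τ.symm ((QuotientGroup.mk' M) v) ∈ _
      rw [h]; exact hw)

/-- An isomorphism of the ordinary-modular character triples `(G, N, θ)` and `(Γ, M, ξ)`: an
isomorphism `τ : G/N ≃ Γ/M` and, for each `N ≤ U ≤ G`, a map `ord U` from `Ch(U | θ)` to
`Ch(corr τ U | ξ)` and a map `mod U` between the corresponding sets of Brauer characters over `θ⁰`
and `ξ⁰`. They are additive, restrict to bijections on irreducible characters, are
compatible with restriction to smaller intermediate subgroups and with multiplication by characters
of `U/N ≃ corr τ U / M`, `ord U` preserves inner products, and `mod U (χ⁰) = (ord U χ)⁰`.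
(Only the values of `ord U` and `mod U` on these sets are meaningful.) -/
structure OrdModIso (p : ℕ) (𝔪 : Ideal AlgInt) [𝔪.IsMaximal] (θ : N → ℂ) (ξ : M → ℂ) where
  τ : G ⧸ N ≃* Γ ⧸ M
  ord : ∀ U : Subgroup G, (U → ℂ) → (corr τ U → ℂ)
  mod : ∀ U : Subgroup G, (PReg p U → ℂ) → (PReg p (corr τ U) → ℂ)
  ord_mapsTo : ∀ (U : Subgroup G) (hU : N ≤ U),
    Set.MapsTo (ord U) (ChOver hU θ) (ChOver (le_corr τ U) ξ)
  ord_add : ∀ (U : Subgroup G) (hU : N ≤ U), ∀ χ ∈ ChOver hU θ, ∀ ψ ∈ ChOver hU θ,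
    ord U (χ + ψ) = ord U χ + ord U ψ
  ord_inner : ∀ (U : Subgroup G) (hU : N ≤ U), ∀ χ ∈ ChOver hU θ, ∀ ψ ∈ ChOver hU θ,
    charInner (ord U χ) (ord U ψ) = charInner χ ψ
  ord_bijOn : ∀ (U : Subgroup G) (hU : N ≤ U),
    Set.BijOn (ord U) (IrrOver hU θ) (IrrOver (le_corr τ U) ξ)
  ord_res : ∀ (K U : Subgroup G) (_ : N ≤ K) (hU : N ≤ U) (hKU : K ≤ U), ∀ χ ∈ ChOver hU θ,
    ord K (res hKU χ) = res (corr_mono τ hKU) (ord U χ)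
  ord_mul : ∀ (U : Subgroup G) (hU : N ≤ U), ∀ χ ∈ ChOver hU θ,
    ∀ β : U.map (QuotientGroup.mk' N) → ℂ, IsChar β →
      ord U (χ * (β ∘ toQuot N U)) = ord U χ * (β ∘ corrToQuot τ U)
  mod_mapsTo : ∀ (U : Subgroup G) (hU : N ≤ U),
    Set.MapsTo (mod U) (BrOver p 𝔪 hU (reg p θ)) (BrOver p 𝔪 (le_corr τ U) (reg p ξ))
  mod_add : ∀ (U : Subgroup G) (hU : N ≤ U),
    ∀ φ ∈ BrOver p 𝔪 hU (reg p θ), ∀ η ∈ BrOver p 𝔪 hU (reg p θ),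
      mod U (φ + η) = mod U φ + mod U η
  mod_bijOn : ∀ (U : Subgroup G) (hU : N ≤ U),
    Set.BijOn (mod U) (IBrOver p 𝔪 hU (reg p θ)) (IBrOver p 𝔪 (le_corr τ U) (reg p ξ))
  mod_res : ∀ (K U : Subgroup G) (_ : N ≤ K) (hU : N ≤ U) (hKU : K ≤ U),
    ∀ φ ∈ BrOver p 𝔪 hU (reg p θ),
      mod K (resReg hKU φ) = resReg (corr_mono τ hKU) (mod U φ)
  mod_mul : ∀ (U : Subgroup G) (hU : N ≤ U), ∀ φ ∈ BrOver p 𝔪 hU (reg p θ),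
    ∀ β : PReg p (U.map (QuotientGroup.mk' N)) → ℂ, IsBrauerChar p 𝔪 β →
      mod U (φ * (β ∘ PReg.map (toQuot N U))) = mod U φ * (β ∘ PReg.map (corrToQuot τ U))
  reg_ord : ∀ (U : Subgroup G) (hU : N ≤ U), ∀ χ ∈ ChOver hU θ,
    mod U (reg p χ) = reg p (ord U χ)

end Iso

end OrdMod

/-!
The character `θ` is afforded by a representation `X` of `N`, and invariance means that every `g ∈ G`
is accompanied by invertible matrices `A`, unique up to scalars, with `A X(n) A⁻¹ = X(g n g⁻¹)`. The
pairs `(g, A)` form a group, and those for which `det A` is a root of unity of bounded order form a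
finite group `pairGroup`, which surjects onto `G`, contains a copy `(n, X(n))` of `N`, and acts by
`ρ (g, A) = A`, extending `X`. The point is to replace it by a subgroup on which the traces of `ρ` lie
in a field `ℚ(ζ)` with `ζ` of order `m` prime to `p`.

Let `σ` be an endomorphism of `ℂ` that fixes the `m`-th roots of unity, for a suitable `m`. Since `θ`
is `p`-rational, the twist of `ρ` by `σ` is again an extension of `X`, and so it is `ρ` multiplied by a
linear character `c σ` that is trivial on `N` (`exists_twist_character`). Because `θ⁰` is irreducible,
every coset of `N` contains an element whose `p`-regular part has nonzero trace, and `σ` fixes such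
traces; this forces the values of `c σ` to be roots of unity of `p`-power order
(`twist_character_pow_eq_one`). As `p` is odd, there is an endomorphism `τ` that fixes `m`-th roots of
unity and squares the roots of unity of the relevant `p`-power order (`exists_fixesRoots_square`).
Multiplying an element `y` by the scalar `(c τ y)⁻¹` makes its `c τ` trivial, and since endomorphisms
of `ℂ` commute on sums of roots of unity, all the other `c σ` become trivial at it as well
(`exists_mul_isFixed`). Hence the subgroup `E` on which all `c σ` are trivial (`fixedSubgroup`) still
surjects onto `G` (`exists_covering`). The kernel of `π : E → G` consists of scalars, and no scalar of
order `p` is fixed by an endomorphism that squares it (`not_dvd_card`), so this kernel is a central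
`p'`-group.

Let `q : E → Γ` be the quotient by the copy of `N`, let `M` be the image of the kernel of `π`, and let
`ξ` be the linear character of `M` inverse to the scalars by which the kernel acts (`CommonCover`,
`exists_scalarRep`). A character `χ` of `U` over `θ` corresponds to `χ'` if
`χ (π x) = tr ρ(x) · χ' (q x)` for all `x` over `U` (`Corresponds`). To see that this is a bijection on
irreducible characters, one uses that an irreducible representation of `U` over `θ`, inflated to `E`,
is the tensor product of `ρ` with a representation of the quotient (`exists_tprod_equiv`, where
Clifford's theorem enters through `exists_intertwining_of_gch_eq_add`), and that such tensor products
are irreducible (`isIrreducible_tprod`). The ordinary and the modular case are the same argument: the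
structure `CharLift` covers both `ℂ` and `AlgInt ⧸ 𝔪`. In the modular case the role of `ρ` is played by
its reduction modulo `𝔪` (`exists_reduction`), whose restriction to `N` is irreducible because `θ⁰` is.

Dividing by the trace of `ρ` along one section of `q` that preserves `p`-regularity and on which this
trace does not vanish (`exists_regular_section`, `transfer`) yields both maps of the isomorphism
`ordModIso`, and their compatibility with restriction to `p`-regular elements is then immediate. Inner
products are preserved because `∑ₙ |tr ρ(x n)|² = |N|` on each coset of `N`
(`sum_character_mul_character_inv`). Finally, corresponding characters differ by factors
`tr ρ(x) ∈ ℚ(ζ)`, so one is `p`-rational if and only if the other is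
(`CommonCover.Corresponds.isPRational_iff`).
-/

namespace OrdMod

open Representation

/-! ### Endomorphisms of finite order -/

section LinearAlgebra

variable {k V W : Type*} [Field k] [AddCommGroup V] [Module k V] [FiniteDimensional k V]
  [AddCommGroup W] [Module k W] [FiniteDimensional k W]

theorem charpoly_eq_mul_of_le_comap (U : Submodule k V) (T : V →ₗ[k] V) (hT : U ≤ U.comap T) :
    T.charpoly = (T.restrict hT).charpoly * (U.mapQ U T hT).charpoly := by
  classical
  let bU := Module.Free.chooseBasis k U
  let bQ := Module.Free.chooseBasis k (V ⧸ U)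
  let b := Module.Basis.sumQuot bU bQ
  let A := LinearMap.toMatrix bU bU (T.restrict hT)
  let B : Matrix (Module.Free.ChooseBasisIndex k U) (Module.Free.ChooseBasisIndex k (V ⧸ U)) k :=
    Matrix.of fun i l => (b.repr (T (b (Sum.inr l)))) (Sum.inl i)
  let D := LinearMap.toMatrix bQ bQ (U.mapQ U T hT)
  suffices LinearMap.toMatrix b b T = Matrix.fromBlocks A B 0 D by
    rw [← LinearMap.charpoly_toMatrix T b, this, ← LinearMap.charpoly_toMatrix _ bU,
      ← LinearMap.charpoly_toMatrix _ bQ, Matrix.charpoly_fromBlocks_zero₂₁]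
  ext u v
  cases u with
  | inl i =>
    cases v with
    | inl j =>
      simp only [b, Module.Basis.sumQuot_inl, Matrix.fromBlocks_apply₁₁, A,
        LinearMap.toMatrix_apply]
      apply Module.Basis.sumQuot_repr_inl_of_mem
    | inr l => simp [b, LinearMap.toMatrix_apply, Matrix.fromBlocks_apply₁₂, B]
  | inr j =>
    cases v with
    | inl i =>
      suffices U.mkQ (T (bU i)) = 0 by simp [LinearMap.toMatrix_apply, b, this]
      rw [← LinearMap.mem_ker, Submodule.ker_mkQ]
      exact hT (Submodule.coe_mem (bU i))
    | inr l =>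
      simp only [LinearMap.toMatrix_apply, Module.Basis.sumQuot_repr_inr,
        Matrix.fromBlocks_apply₂₂, D, b]
      rw [← Module.Basis.sumQuot_inr bU bQ l, Submodule.mapQ_apply]
      simp

omit [FiniteDimensional k V] in
theorem roots_charpoly_of_eigenbasis {ι : Type*} [Fintype ι] (b : Module.Basis ι k V)
    [FiniteDimensional k V]
    (T : V →ₗ[k] V) (μ : ι → k) (h : ∀ i, T (b i) = μ i • b i) :
    T.charpoly.roots = Finset.univ.val.map μ := by
  classical
  have hM : LinearMap.toMatrix b b T = Matrix.diagonal μ := by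
    ext i j
    rw [LinearMap.toMatrix_apply, h, Matrix.diagonal_apply]
    simp [Finsupp.single_apply, eq_comm]
    aesop
  rw [← LinearMap.charpoly_toMatrix T b, hM, Matrix.charpoly_diagonal]
  have h := Polynomial.roots_multiset_prod_X_sub_C (Finset.univ.val.map μ)
  rwa [Multiset.map_map] at h

/-- An endomorphism `T` with `T ^ m = 1`, where `m` is invertible in the algebraically closed field
`k`, is diagonalizable. -/
theorem exists_eigenbasis [IsAlgClosed k] (T : V →ₗ[k] V) {m : ℕ} (hm : (m : k) ≠ 0)
    (hT : T ^ m = 1) :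
    ∃ (n : ℕ) (b : Module.Basis (Fin n) k V) (μ : Fin n → k),
      (∀ i, T (b i) = μ i • b i) ∧ ∀ i, μ i ^ m = 1 := by
  classical
  have hsep : (Polynomial.X ^ m - 1 : Polynomial k).Separable :=
    Polynomial.separable_X_pow_sub_C 1 hm one_ne_zero
  have hss : Module.End.IsSemisimple T := by
    refine Module.End.isSemisimple_of_squarefree_aeval_eq_zero hsep.squarefree ?_
    simp [hT]
  have htop := Module.End.IsSemisimple.iSup_eigenspace_eq_top hss
  let s : Set V := {v | ∃ μ : k, T v = μ • v}
  have hs : Submodule.span k s = ⊤ := by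
    rw [eq_top_iff, ← htop, iSup_le_iff]
    intro μ v hv
    exact Submodule.subset_span ⟨μ, Module.End.mem_eigenspace_iff.1 hv⟩
  obtain ⟨t, hts, hspan, hli⟩ := exists_linearIndependent k s
  have hli' : LinearIndependent k (Subtype.val : t → V) := hli
  let b0 := Module.Basis.mk hli' (by rw [Subtype.range_coe, hspan, hs])
  have : Fintype t := FiniteDimensional.fintypeBasisIndex b0
  let e := Fintype.equivFin t
  let b := b0.reindex e
  have hb : ∀ i, ∃ μ : k, T (b i) = μ • b i := by
    intro i
    have : b i = (e.symm i : V) := by simp [b, b0]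
    rw [this]
    exact hts (e.symm i).2
  choose μ hμ using hb
  refine ⟨_, b, μ, hμ, fun i => ?_⟩
  have h1 : ∀ j : ℕ, (T ^ j) (b i) = μ i ^ j • b i := by
    intro j
    induction j with
    | zero => simp
    | succ j ih => rw [pow_succ', Module.End.mul_apply, ih, map_smul, hμ, smul_smul, pow_succ]
  have h2 := h1 m
  rw [hT, Module.End.one_apply] at h2
  have h3 : (μ i ^ m - 1) • b i = 0 := by rw [sub_smul, ← h2, one_smul, sub_self]
  exact sub_eq_zero.1 ((smul_eq_zero.1 h3).resolve_right (b.ne_zero i))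

end LinearAlgebra

/-! ### Lifting of eigenvalues -/

/-- The data needed to attach complex-valued characters to representations over `k`: a ring
homomorphism `red` from the algebraic integers to `k` and a map `lift` back to `ℂ` that is inverse to
`red` on roots of unity of order prime to `r`. The number `r` is `1` in characteristic zero (so
that every element of a finite group is `r`-regular) and the characteristic of `k` otherwise. This
treats ordinary characters (`k = ℂ`, `lift = id`) and Brauer characters (`k = AlgInt ⧸ 𝔪`,
`lift = rootLift p 𝔪`) simultaneously. -/
structure CharLift (r : ℕ) (k : Type*) [Field k] where
  char_cond : (r = 1 ∧ CharZero k) ∨ (r.Prime ∧ CharP k r)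
  red : AlgInt →+* k
  lift : k → ℂ
  lift_red : ∀ (z : AlgInt) (m : ℕ), m ≠ 0 → r.Coprime m → z ^ m = 1 → lift (red z) = z

theorem exists_primitiveRoot_algInt {m : ℕ} (hm : m ≠ 0) : ∃ ζ : AlgInt, IsPrimitiveRoot ζ m := by
  have h := Complex.isPrimitiveRoot_exp m hm
  let z : AlgInt := ⟨_, h.isIntegral (Nat.pos_of_ne_zero hm)⟩
  exact ⟨z, IsPrimitiveRoot.of_map_of_injective (f := algebraMap AlgInt ℂ) h
    Subtype.val_injective⟩

/-- An exponent `s` such that `g ^ s` is the `r`-regular part of any `g` with `g ^ n = 1`. -/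
theorem exists_regularExponent (r n : ℕ) :
    ∃ s : ℕ, s ≡ 1 [MOD ordCompl[r] n] ∧ (r = 1 ∨ r.Prime → n ≠ 0 → ordProj[r] n ∣ s) := by
  by_cases h : (r = 1 ∨ r.Prime) ∧ n ≠ 0
  · have hc : (ordCompl[r] n).Coprime (ordProj[r] n) := by
      rcases h.1 with rfl | hr
      · simp
      · exact ((Nat.coprime_ordCompl hr h.2).pow_left _).symm
    obtain ⟨s, h1, h2⟩ := Nat.chineseRemainder hc 1 0
    exact ⟨s, h1, fun _ _ => (Nat.modEq_zero_iff_dvd).1 h2⟩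
  · refine ⟨1, rfl, fun h1 h2 => absurd ⟨h1, h2⟩ h⟩

/-- The exponent of `exists_regularExponent`. -/
noncomputable def regExp (r n : ℕ) : ℕ := (exists_regularExponent r n).choose

theorem regExp_modEq (r n : ℕ) : regExp r n ≡ 1 [MOD ordCompl[r] n] :=
  (exists_regularExponent r n).choose_spec.1

theorem dvd_regExp {r n : ℕ} (hr : r = 1 ∨ r.Prime) (hn : n ≠ 0) : ordProj[r] n ∣ regExp r n :=
  (exists_regularExponent r n).choose_spec.2 hr hn

theorem coprime_ordCompl' {r n : ℕ} (hr : r = 1 ∨ r.Prime) (hn : n ≠ 0) :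
    r.Coprime (ordCompl[r] n) := by
  rcases hr with rfl | hr
  · simp
  · exact Nat.coprime_ordCompl hr hn

theorem pow_regExp_pow {r n : ℕ} (hr : r = 1 ∨ r.Prime) (hn : n ≠ 0) {H : Type*} [Monoid H] {g : H}
    (hg : g ^ n = 1) : (g ^ regExp r n) ^ (ordCompl[r] n) = 1 := by
  obtain ⟨c, hc⟩ := dvd_regExp hr hn
  rw [← pow_mul, hc, mul_right_comm, Nat.ordProj_mul_ordCompl_eq_self, pow_mul, hg, one_pow]

theorem coprime_orderOf_pow_regExp {r n : ℕ} (hr : r = 1 ∨ r.Prime) (hn : n ≠ 0) {H : Type*}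
    [Monoid H] {g : H} (hg : g ^ n = 1) : r.Coprime (orderOf (g ^ regExp r n)) :=
  Nat.Coprime.coprime_dvd_right (orderOf_dvd_of_pow_eq_one (pow_regExp_pow hr hn hg))
    (coprime_ordCompl' hr hn)

theorem pow_regExp_eq_self {r n : ℕ} {H : Type*} [Monoid H] {g : H}
    (hg : g ^ n = 1) (hreg : r.Coprime (orderOf g)) : g ^ regExp r n = g := by
  have h1 : orderOf g ∣ ordCompl[r] n := by
    have h2 : orderOf g ∣ ordProj[r] n * ordCompl[r] n := by
      rw [Nat.ordProj_mul_ordCompl_eq_self]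
      exact orderOf_dvd_of_pow_eq_one hg
    exact (hreg.symm.pow_right _).dvd_of_dvd_mul_left h2
  have h3 := pow_eq_pow_of_modEq ((regExp_modEq r n).of_dvd h1) (pow_orderOf_eq_one g)
  rwa [pow_one] at h3

namespace CharLift

variable {r : ℕ} {k : Type*} [Field k] (B : CharLift r k)

include B

theorem eq_one_or_prime : r = 1 ∨ r.Prime := B.char_cond.imp And.left And.left

theorem natCast_ne_zero {m : ℕ} (hm : m ≠ 0) (hr : r.Coprime m) : (m : k) ≠ 0 := by
  rcases B.char_cond with ⟨_, h⟩ | ⟨hp, h⟩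
  · exact Nat.cast_ne_zero.2 hm
  · rw [Ne, CharP.cast_eq_zero_iff k r]
    exact (Nat.Prime.coprime_iff_not_dvd hp).1 hr

theorem exists_red_eq {a : k} {m : ℕ} (hm : m ≠ 0) (ha : a ^ m = 1) :
    ∃ z : AlgInt, z ^ m = 1 ∧ B.red z = a := by
  obtain ⟨ζ, hζ⟩ := exists_primitiveRoot_algInt hm
  have h := Polynomial.X_pow_sub_one_eq_prod (Nat.pos_of_ne_zero hm) hζ
  have h1 := congrArg (fun q => Polynomial.eval a (Polynomial.map B.red q)) h
  simp only [Polynomial.map_sub, Polynomial.map_pow, Polynomial.map_X, Polynomial.map_one,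
    Polynomial.eval_sub, Polynomial.eval_pow, Polynomial.eval_X, Polynomial.eval_one, ha, sub_self,
    Polynomial.map_prod, Polynomial.eval_prod, Polynomial.map_C, Polynomial.eval_C] at h1
  obtain ⟨z, hz, h2⟩ := Finset.prod_eq_zero_iff.1 h1.symm
  exact ⟨z, (Polynomial.mem_nthRootsFinset (Nat.pos_of_ne_zero hm) _).1 hz, (sub_eq_zero.1 h2).symm⟩

theorem exists_lift_eq {a : k} {m : ℕ} (hm : m ≠ 0) (hr : r.Coprime m) (ha : a ^ m = 1) :
    ∃ z : AlgInt, z ^ m = 1 ∧ B.red z = a ∧ B.lift a = z := by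
  obtain ⟨z, h1, h2⟩ := B.exists_red_eq hm ha
  exact ⟨z, h1, h2, by rw [← h2, B.lift_red z m hm hr h1]⟩

theorem lift_mul {a b : k} {m : ℕ} (hm : m ≠ 0) (hr : r.Coprime m) (ha : a ^ m = 1)
    (hb : b ^ m = 1) : B.lift (a * b) = B.lift a * B.lift b := by
  obtain ⟨z, hz, rfl, h1⟩ := B.exists_lift_eq hm hr ha
  obtain ⟨w, hw, rfl, h2⟩ := B.exists_lift_eq hm hr hb
  rw [h1, h2, ← map_mul, B.lift_red (z * w) m hm hr (by rw [mul_pow, hz, hw, one_mul])]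
  rfl

theorem lift_one : B.lift 1 = 1 := by
  have h := B.lift_red 1 1 one_ne_zero (Nat.coprime_one_right r) (one_pow 1)
  rw [map_one] at h
  simpa using h

/-- The sum of the lifts of the eigenvalues of an endomorphism. -/
noncomputable def ltr {V : Type*} [AddCommGroup V] [Module k V] [FiniteDimensional k V]
    (T : V →ₗ[k] V) : ℂ := (T.charpoly.roots.map B.lift).sum

section Ltr

variable {V W : Type*} [AddCommGroup V] [Module k V] [FiniteDimensional k V]
  [AddCommGroup W] [Module k W] [FiniteDimensional k W]

theorem ltr_of_eigenbasis {ι : Type*} [Fintype ι] (b : Module.Basis ι k V)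
    (T : V →ₗ[k] V) (μ : ι → k) (h : ∀ i, T (b i) = μ i • b i) :
    B.ltr T = ∑ i, B.lift (μ i) := by
  rw [ltr, roots_charpoly_of_eigenbasis b T μ h, Multiset.map_map]
  rfl

theorem ltr_eq_add (U : Submodule k V) (T : V →ₗ[k] V) (hT : U ≤ U.comap T) :
    B.ltr T = B.ltr (T.restrict hT) + B.ltr (U.mapQ U T hT) := by
  rw [ltr, charpoly_eq_mul_of_le_comap U T hT, Polynomial.roots_mul, Multiset.map_add,
    Multiset.sum_add]
  · rfl
  · exact mul_ne_zero (LinearMap.charpoly_monic _).ne_zero (LinearMap.charpoly_monic _).ne_zero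

theorem ltr_conj (e : V ≃ₗ[k] W) (T : V →ₗ[k] V) : B.ltr (e.conj T) = B.ltr T := by
  rw [ltr, LinearEquiv.charpoly_conj, ltr]

theorem ltr_prodMap (T : V →ₗ[k] V) (S : W →ₗ[k] W) :
    B.ltr (T.prodMap S) = B.ltr T + B.ltr S := by
  rw [ltr, LinearMap.charpoly_prodMap, Polynomial.roots_mul, Multiset.map_add, Multiset.sum_add]
  · rfl
  · exact mul_ne_zero (LinearMap.charpoly_monic _).ne_zero (LinearMap.charpoly_monic _).ne_zero

theorem ltr_smul_one (c : k) :
    B.ltr (c • (1 : V →ₗ[k] V)) = Module.finrank k V * B.lift c := by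
  rw [B.ltr_of_eigenbasis (Module.finBasis k V) _ (fun _ => c) (fun i => by simp)]
  simp

theorem ltr_one : B.ltr (1 : V →ₗ[k] V) = Module.finrank k V := by
  have h := B.ltr_smul_one (V := V) 1
  rwa [one_smul, B.lift_one, mul_one] at h

variable [IsAlgClosed k]

theorem ltr_tensor {T : V →ₗ[k] V} {S : W →ₗ[k] W} {m : ℕ} (hm : m ≠ 0) (hr : r.Coprime m)
    (hT : T ^ m = 1) (hS : S ^ m = 1) :
    B.ltr (TensorProduct.map T S) = B.ltr T * B.ltr S := by
  obtain ⟨n, b, μ, hb, hμ⟩ := exists_eigenbasis T (B.natCast_ne_zero hm hr) hT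
  obtain ⟨n', b', ν, hb', hν⟩ := exists_eigenbasis S (B.natCast_ne_zero hm hr) hS
  rw [B.ltr_of_eigenbasis b T μ hb, B.ltr_of_eigenbasis b' S ν hb',
    B.ltr_of_eigenbasis (b.tensorProduct b') _ (fun x => μ x.1 * ν x.2), Finset.sum_mul_sum,
    Fintype.sum_prod_type]
  · exact Finset.sum_congr rfl fun i _ => Finset.sum_congr rfl fun j _ =>
      B.lift_mul hm hr (hμ i) (hν j)
  · rintro ⟨i, j⟩
    simp [hb, hb', TensorProduct.smul_tmul, smul_smul, mul_comm]

/-- The lifted trace of an endomorphism of `r`-regular order reduces to its trace. -/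
theorem exists_red_eq_trace {T : V →ₗ[k] V} {m : ℕ} (hm : m ≠ 0) (hr : r.Coprime m)
    (hT : T ^ m = 1) : ∃ z : AlgInt, (z : ℂ) = B.ltr T ∧ B.red z = LinearMap.trace k V T := by
  classical
  obtain ⟨n, b, μ, hb, hμ⟩ := exists_eigenbasis T (B.natCast_ne_zero hm hr) hT
  choose z _ hz2 hz3 using fun i => B.exists_lift_eq hm hr (hμ i)
  refine ⟨∑ i, z i, ?_, ?_⟩
  · rw [B.ltr_of_eigenbasis b T μ hb]
    simp [hz3]
  · rw [map_sum, LinearMap.trace_eq_matrix_trace k b]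
    simp [Matrix.trace, LinearMap.toMatrix_apply, hb, hz2]

omit [IsAlgClosed k] [FiniteDimensional k V] in
/-- An endomorphism of finite order and its `r`-regular part differ by a nilpotent endomorphism, so
they have the same trace. -/
theorem trace_pow_regExp {T : V →ₗ[k] V} {n : ℕ} (hT : T ^ n = 1) :
    LinearMap.trace k V (T ^ regExp r n) = LinearMap.trace k V T := by
  have hr := B.eq_one_or_prime
  have hnil : IsNilpotent (T ^ regExp r n - T) := by
    rcases B.char_cond with ⟨rfl, h⟩ | ⟨hp, h⟩
    · have h1 : T ^ regExp 1 n = T := by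
        have h2 := pow_eq_pow_of_modEq (regExp_modEq 1 n) (x := T) (by simpa using hT)
        simpa using h2
      rw [h1, sub_self]
      exact IsNilpotent.zero
    · have : Fact r.Prime := ⟨hp⟩
      rcases subsingleton_or_nontrivial V with hV | hV
      · rw [Subsingleton.elim (T ^ regExp r n - T) 0]
        exact IsNilpotent.zero
      have : CharP (Module.End k V) r := charP_of_injective_algebraMap
        (algebraMap k (Module.End k V)).injective r
      refine ⟨r ^ n.factorization r, ?_⟩
      rw [sub_pow_char_pow_of_commute r _ (Commute.pow_self T _), sub_eq_zero, ← pow_mul]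
      refine pow_eq_pow_of_modEq ?_ hT
      have h1 := (regExp_modEq r n).mul_left' (r ^ n.factorization r)
      rw [Nat.ordProj_mul_ordCompl_eq_self] at h1
      simpa [mul_comm] using h1
  have h := (LinearMap.isNilpotent_trace_of_isNilpotent hnil).eq_zero
  rwa [map_sub, sub_eq_zero] at h

end Ltr

end CharLift

/-! ### Irreducible representations -/

section Irreducible

variable {k H V W : Type*} [Field k] [Group H] [AddCommGroup V] [Module k V]
  [AddCommGroup W] [Module k W]

theorem isIrreducible_iff {ρ : Representation k H V} : ρ.IsIrreducible ↔
    Nontrivial V ∧ ∀ U : Submodule k V, (∀ g, U ≤ U.comap (ρ g)) → U = ⊥ ∨ U = ⊤ := by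
  constructor
  · intro h
    refine ⟨?_, fun U hU => ?_⟩
    · by_contra hV
      rw [not_nontrivial_iff_subsingleton] at hV
      apply bot_ne_top (α := Subrepresentation ρ)
      apply Subrepresentation.toSubmodule_injective
      exact Subsingleton.elim _ _
    · rcases h.eq_bot_or_eq_top ⟨U, fun g v hv => hU g hv⟩ with h | h
      · left; exact congrArg Subrepresentation.toSubmodule h
      · right; exact congrArg Subrepresentation.toSubmodule h
  · rintro ⟨hV, h⟩
    refine { exists_pair_ne := ⟨⊥, ⊤, fun h => ?_⟩, eq_bot_or_eq_top := fun U => ?_ }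
    · exact bot_ne_top (α := Submodule k V) (congrArg Subrepresentation.toSubmodule h)
    · rcases h U.toSubmodule (fun g v hv => U.apply_mem_toSubmodule g hv) with h | h
      · left; exact Subrepresentation.toSubmodule_injective h
      · right; exact Subrepresentation.toSubmodule_injective h

theorem isIrreducible_of_equiv {ρ : Representation k H V} {σ : Representation k H W}
    (e : ρ.Equiv σ) (h : ρ.IsIrreducible) : σ.IsIrreducible := by
  rw [isIrreducible_iff] at h ⊢
  obtain ⟨h1, h2⟩ := h
  have he : ∀ g v, e.toLinearEquiv (ρ g v) = σ g (e.toLinearEquiv v) :=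
    fun g v => LinearMap.congr_fun (e.isIntertwining' g) v
  refine ⟨e.toLinearEquiv.symm.toEquiv.nontrivial, fun U hU => ?_⟩
  have h3 := h2 (U.comap e.toLinearEquiv.toLinearMap) (fun g v hv => by
    change e.toLinearEquiv (ρ g v) ∈ U
    rw [he]
    exact hU g hv)
  have h4 : (U.comap e.toLinearEquiv.toLinearMap).map e.toLinearEquiv.toLinearMap = U :=
    Submodule.map_comap_eq_of_surjective e.toLinearEquiv.surjective U
  rcases h3 with h3 | h3
  · left; rw [← h4, h3, Submodule.map_bot]
  · right; rw [← h4, h3, Submodule.map_top]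
    exact LinearMap.range_eq_top.2 e.toLinearEquiv.surjective

/-- A representation on a finite-dimensional space, transported to a coordinate space. -/
noncomputable def coordRep [FiniteDimensional k V] (ρ : Representation k H V) :
    Representation k H (Fin (Module.finrank k V) → k) :=
  ((Module.finBasis k V).equivFun.conjRingEquiv : _ →* _).comp ρ

/-- The equivalence of a representation with its transport to a coordinate space. -/
noncomputable def coordRepEquiv [FiniteDimensional k V] (ρ : Representation k H V) :
    ρ.Equiv (coordRep ρ) :=
  Representation.Equiv.mk (Module.finBasis k V).equivFun (fun g => by
    ext v : 1
    simp [coordRep])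

variable [IsAlgClosed k]

/-- The density theorem for finitely many simple modules without nonzero maps between them. -/
theorem exists_smul_eq_of_isSimpleModule {A ι : Type*} [Ring A] [Algebra k A] [Finite ι]
    {M : ι → Type*} [∀ i, AddCommGroup (M i)] [∀ i, Module k (M i)] [∀ i, Module A (M i)]
    [∀ i, IsScalarTower k A (M i)] [∀ i, FiniteDimensional k (M i)]
    [hs : ∀ i, IsSimpleModule A (M i)]
    (hzero : ∀ i j, i ≠ j → ∀ φ : M i →ₗ[A] M j, φ = 0) (i : ι) (f : M i →ₗ[k] M i) :
    ∃ a : A, (∀ v, a • v = f v) ∧ ∀ j, j ≠ i → ∀ v : M j, a • v = 0 := by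
  classical
  have := Fintype.ofFinite ι
  have hss : IsSemisimpleModule A (∀ i, M i) := inferInstance
  have hscal : ∀ φ : M i →ₗ[A] M i, ∃ c : k, ∀ v, φ v = c • v := by
    intro φ
    obtain ⟨c, hc⟩ := (IsSimpleModule.algebraMap_end_bijective_of_isAlgClosed (A := A)
      (V := M i) k).2 φ
    exact ⟨c, fun v => by rw [← hc]; rfl⟩
  have key : ∀ φ : (∀ i, M i) →ₗ[A] ∀ i, M i, ∃ c : k, (∀ x, φ x i = c • x i) ∧
      ∀ v : M i, φ (Pi.single i v) = Pi.single i (c • v) := by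
    intro φ
    obtain ⟨c, hc⟩ := hscal ((LinearMap.proj i).comp (φ.comp (LinearMap.single A _ i)))
    have hc' : ∀ v, φ (Pi.single i v) i = c • v := fun v => hc v
    have hoff : ∀ a b, a ≠ b → ∀ v, φ (Pi.single a v) b = 0 := by
      intro a b hab v
      exact LinearMap.congr_fun (hzero a b hab
        ((LinearMap.proj b).comp (φ.comp (LinearMap.single A _ a)))) v
    refine ⟨c, fun x => ?_, fun v => ?_⟩
    · conv_lhs => rw [← Finset.univ_sum_single x]
      rw [map_sum, Finset.sum_apply, Finset.sum_eq_single i]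
      · exact hc' _
      · intro b _ hb
        exact hoff b i hb _
      · simp
    · funext j
      by_cases hj : j = i
      · subst hj
        rw [hc', Pi.single_eq_same]
      · rw [hoff i j (Ne.symm hj), Pi.single_eq_of_ne hj]
  -- `f` on the `i`-th summand and zero on the others commutes with all endomorphisms of the sum
  let F : Module.End (Module.End A (∀ i, M i)) (∀ i, M i) :=
    { toFun := fun x => Pi.single i (f (x i))
      map_add' := fun x y => by rw [Pi.add_apply, map_add, Pi.single_add]
      map_smul' := fun φ x => by
        obtain ⟨c, h1, h2⟩ := key φ
        change Pi.single i (f (φ x i)) = φ (Pi.single i (f (x i)))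
        rw [h1, h2, map_smul] }
  let s : Finset (∀ i, M i) := Finset.univ.biUnion fun j =>
    Finset.univ.image fun l => Pi.single j (Module.finBasis k (M j) l)
  obtain ⟨a, ha⟩ := jacobson_density F s
  have hmem : ∀ j l, (Pi.single j (Module.finBasis k (M j) l) : ∀ i, M i) ∈ s := by
    intro j l
    simp only [s, Finset.mem_biUnion, Finset.mem_image, Finset.mem_univ, true_and]
    exact ⟨j, l, rfl⟩
  have hF : ∀ x, F x = Pi.single i (f (x i)) := fun _ => rfl
  refine ⟨a, fun v => ?_, fun j hj v => ?_⟩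
  · refine LinearMap.congr_fun (f := Algebra.lsmul k k (M i) a) ((Module.finBasis k (M i)).ext ?_) v
    intro l
    have h := congrFun (ha _ (hmem i l)) i
    rw [hF, Pi.single_eq_same, Pi.smul_apply, Pi.single_eq_same] at h
    exact h.symm
  · refine LinearMap.congr_fun (f := Algebra.lsmul k k (M j) a) (g := 0)
      ((Module.finBasis k (M j)).ext ?_) v
    intro l
    have h := congrFun (ha _ (hmem j l)) j
    rw [hF, Pi.single_eq_of_ne hj, Pi.smul_apply, Pi.single_eq_same] at h
    exact h.symm

/-- Finitely many pairwise inequivalent irreducible representations over an algebraically closed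
field: any endomorphism of one of them is induced by an element of the group algebra which
annihilates all others. -/
theorem exists_asAlgebraHom_eq {ι : Type*} [Finite ι] {V : ι → Type*} [∀ i, AddCommGroup (V i)]
    [∀ i, Module k (V i)] [∀ i, FiniteDimensional k (V i)] (ρ : ∀ i, Representation k H (V i))
    (hirr : ∀ i, (ρ i).IsIrreducible) (hne : ∀ i j, Nonempty ((ρ i).Equiv (ρ j)) → i = j)
    (i : ι) (f : V i →ₗ[k] V i) :
    ∃ a : MonoidAlgebra k H, (ρ i).asAlgebraHom a = f ∧ ∀ j, j ≠ i → (ρ j).asAlgebraHom a = 0 := by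
  have hs : ∀ i, IsSimpleModule (MonoidAlgebra k H) (ρ i).asModule := fun i =>
    (irreducible_iff_isSimpleModule_asModule (ρ i)).1 (hirr i)
  obtain ⟨a, h1, h2⟩ := exists_smul_eq_of_isSimpleModule (k := k) (A := MonoidAlgebra k H)
    (M := fun i => (ρ i).asModule) (fun a b hab φ => by
      have : IsEmpty ((ρ a).Equiv (ρ b)) := by
        by_contra h
        exact hab (hne a b (not_isEmpty_iff.1 h))
      apply (IntertwiningMap.equivLinearMapAsModule (ρ a) (ρ b)).symm.injective
      exact Subsingleton.elim _ _) i f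
  exact ⟨a, LinearMap.ext h1, fun j hj => LinearMap.ext (h2 j hj)⟩

/-- **Burnside's theorem**. -/
theorem asAlgebraHom_surjective [FiniteDimensional k V] {ρ : Representation k H V}
    (h : ρ.IsIrreducible) : Function.Surjective ρ.asAlgebraHom := by
  intro f
  obtain ⟨a, ha, -⟩ := exists_asAlgebraHom_eq (ι := Unit) (fun _ => ρ) (fun _ => h)
    (fun _ _ _ => rfl) () f
  exact ⟨a, ha⟩

omit [IsAlgClosed k] in
theorem exists_trace_eq_one [FiniteDimensional k V] [Nontrivial V] :
    ∃ f : V →ₗ[k] V, LinearMap.trace k V f = 1 := by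
  obtain ⟨i⟩ : Nonempty (Fin (Module.finrank k V)) := ⟨⟨0, Module.finrank_pos⟩⟩
  let b := Module.finBasis k V
  refine ⟨(b.coord i).smulRight (b i), ?_⟩
  rw [LinearMap.trace_smulRight]
  simp

/-- Traces of pairwise inequivalent irreducible representations are linearly independent. -/
theorem trace_linearIndependent {ι : Type*} [Fintype ι] {V : ι → Type*} [∀ i, AddCommGroup (V i)]
    [∀ i, Module k (V i)] [∀ i, FiniteDimensional k (V i)] (ρ : ∀ i, Representation k H (V i))
    (hirr : ∀ i, (ρ i).IsIrreducible) (hne : ∀ i j, Nonempty ((ρ i).Equiv (ρ j)) → i = j)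
    (c : ι → k) (hc : ∀ h, ∑ i, c i * LinearMap.trace k (V i) (ρ i h) = 0) : ∀ i, c i = 0 := by
  classical
  intro i
  have h1 : ∀ a : MonoidAlgebra k H,
      ∑ i, c i * LinearMap.trace k (V i) ((ρ i).asAlgebraHom a) = 0 := by
    intro a
    induction a using MonoidAlgebra.induction_linear with
    | zero => simp
    | add x y hx hy => simp only [map_add, mul_add, Finset.sum_add_distrib, hx, hy, add_zero]
    | single g b =>
      simp only [asAlgebraHom_single, map_smul, smul_eq_mul]
      simp_rw [mul_left_comm _ b]
      rw [← Finset.mul_sum, hc, mul_zero]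
  have := (isIrreducible_iff.1 (hirr i)).1
  obtain ⟨f, hf⟩ := exists_trace_eq_one (k := k) (V := V i)
  obtain ⟨a, ha, ha'⟩ := exists_asAlgebraHom_eq ρ hirr hne i f
  have h2 := h1 a
  rw [Finset.sum_eq_single i] at h2
  · rwa [ha, hf, mul_one] at h2
  · intro j _ hj
    rw [ha' j hj, map_zero, mul_zero]
  · simp

end Irreducible

/-! ### Lifted characters and their decomposition into irreducible ones -/

section Eqv

variable {k H V W : Type*} [Field k] [Group H] [AddCommGroup V] [Module k V]
  [AddCommGroup W] [Module k W]

theorem equiv_apply {ρ : Representation k H V} {σ : Representation k H W}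
    (e : ρ.Equiv σ) (h : H) : e.toLinearEquiv.conj (ρ h) = σ h := by
  ext v
  rw [LinearEquiv.conj_apply]
  have h1 := LinearMap.congr_fun (e.isIntertwining' h) (e.toLinearEquiv.symm v)
  refine h1.trans ?_
  exact congrArg (σ h) (e.toLinearEquiv.apply_symm_apply v)

end Eqv

namespace CharLift

variable {r : ℕ} {k : Type*} [Field k] (B : CharLift r k)

/-- The lifted character of a representation: at an `r`-regular element, the sum of the lifts of the
eigenvalues. -/
noncomputable def gch {H V : Type*} [Group H] [AddCommGroup V] [Module k V] [FiniteDimensional k V]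
    (ρ : Representation k H V) : PReg r H → ℂ := fun h => B.ltr (ρ h.1)

/-- `φ` is the lifted character of some representation. -/
def IsGChar {H : Type*} [Group H] (φ : PReg r H → ℂ) : Prop :=
  ∃ (n : ℕ) (ρ : Representation k H (Fin n → k)), φ = B.gch ρ

/-- `φ` is the lifted character of some irreducible representation. -/
def IsGIrr {H : Type*} [Group H] (φ : PReg r H → ℂ) : Prop :=
  ∃ (n : ℕ) (ρ : Representation k H (Fin n → k)), ρ.IsIrreducible ∧ φ = B.gch ρ

section

variable {H K V W : Type*} [Group H] [Group K] [AddCommGroup V] [Module k V]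
  [FiniteDimensional k V] [AddCommGroup W] [Module k W] [FiniteDimensional k W]

theorem gch_equiv {ρ : Representation k H V} {σ : Representation k H W} (e : ρ.Equiv σ) :
    B.gch ρ = B.gch σ := by
  funext h
  rw [gch, gch, ← equiv_apply e, ltr_conj]

theorem isGChar_gch (ρ : Representation k H V) : B.IsGChar (B.gch ρ) :=
  ⟨_, coordRep ρ, B.gch_equiv (coordRepEquiv ρ)⟩

theorem isGIrr_gch {ρ : Representation k H V} (h : ρ.IsIrreducible) : B.IsGIrr (B.gch ρ) :=
  ⟨_, coordRep ρ, isIrreducible_of_equiv (coordRepEquiv ρ) h, B.gch_equiv (coordRepEquiv ρ)⟩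

theorem IsGIrr.isGChar {φ : PReg r H → ℂ} (h : B.IsGIrr φ) : B.IsGChar φ := by
  obtain ⟨n, ρ, -, rfl⟩ := h
  exact ⟨n, ρ, rfl⟩

theorem IsGChar.add {φ ψ : PReg r H → ℂ} (h : B.IsGChar φ) (h' : B.IsGChar ψ) :
    B.IsGChar (φ + ψ) := by
  obtain ⟨n, ρ, rfl⟩ := h
  obtain ⟨m, σ, rfl⟩ := h'
  have h1 : B.gch ρ + B.gch σ = B.gch (ρ.prod σ) := by
    funext h
    exact (B.ltr_prodMap _ _).symm
  rw [h1]
  exact B.isGChar_gch _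

theorem IsGChar.zero : B.IsGChar (0 : PReg r H → ℂ) := by
  refine ⟨0, 1, ?_⟩
  funext h
  have : Subsingleton (Fin 0 → k) := inferInstance
  rw [gch, MonoidHom.one_apply, ltr_one]
  simp

theorem IsGChar.multiset_sum {s : Multiset (PReg r H → ℂ)} (h : ∀ φ ∈ s, B.IsGChar φ) :
    B.IsGChar s.sum := by
  induction s using Multiset.induction with
  | empty => simpa using IsGChar.zero B
  | cons a s ih =>
    rw [Multiset.sum_cons]
    exact IsGChar.add B (h a (Multiset.mem_cons_self a s))
      (ih fun φ hφ => h φ (Multiset.mem_cons_of_mem hφ))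

theorem IsGChar.nsmul {φ : PReg r H → ℂ} (h : B.IsGChar φ) (n : ℕ) : B.IsGChar (n • φ) := by
  induction n with
  | zero => simpa using IsGChar.zero B
  | succ n ih => rw [succ_nsmul]; exact IsGChar.add B ih h

theorem gch_one (ρ : Representation k H V) :
    B.gch ρ ⟨1, by simp⟩ = Module.finrank k V := by
  rw [gch, map_one, ltr_one]

theorem gch_eq_add (ρ : Representation k H V) (U : Submodule k V) (hU : ∀ g, U ≤ U.comap (ρ g)) :
    B.gch ρ = B.gch (ρ.subrepresentation U hU) + B.gch (ρ.quotient U hU) := by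
  funext h
  exact B.ltr_eq_add U (ρ h.1) (hU h.1)

/-- Every lifted character is a sum of irreducible ones. -/
theorem exists_multiset_gch {V : Type*} [AddCommGroup V] [Module k V]
    [FiniteDimensional k V] (ρ : Representation k H V) :
    ∃ s : Multiset (PReg r H → ℂ), (∀ φ ∈ s, B.IsGIrr φ) ∧ B.gch ρ = s.sum := by
  induction hn : Module.finrank k V using Nat.strong_induction_on generalizing V with
  | _ n ih =>
    by_cases hirr : ρ.IsIrreducible
    · exact ⟨{B.gch ρ}, by simpa using B.isGIrr_gch hirr, by simp⟩
    rcases subsingleton_or_nontrivial V with hV | hV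
    · refine ⟨0, by simp, ?_⟩
      funext h
      rw [gch, Subsingleton.elim (ρ h.1) 1, ltr_one, Module.finrank_zero_of_subsingleton]
      simp
    rw [isIrreducible_iff, not_and] at hirr
    have h1 := hirr hV
    push Not at h1
    obtain ⟨U, hU, hbot, htop⟩ := h1
    have hq := Submodule.finrank_quotient_add_finrank U
    have hpos : 0 < Module.finrank k U := by
      rw [Module.finrank_pos_iff]
      exact Submodule.nontrivial_iff_ne_bot.2 hbot
    have hlt := Submodule.finrank_lt htop
    obtain ⟨s, hs, hs'⟩ := ih _ (by omega) (ρ.subrepresentation U hU) rfl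
    obtain ⟨t, ht, ht'⟩ := ih _ (by omega) (ρ.quotient U hU) rfl
    refine ⟨s + t, fun φ hφ => ?_, ?_⟩
    · rcases Multiset.mem_add.1 hφ with h | h
      · exact hs φ h
      · exact ht φ h
    · rw [B.gch_eq_add ρ U hU, hs', ht', Multiset.sum_add]

theorem IsGChar.exists_multiset {φ : PReg r H → ℂ} (h : B.IsGChar φ) :
    ∃ s : Multiset (PReg r H → ℂ), (∀ φ ∈ s, B.IsGIrr φ) ∧ φ = s.sum := by
  obtain ⟨n, ρ, rfl⟩ := h
  exact B.exists_multiset_gch ρ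

variable [IsAlgClosed k] [Finite H]

/-- A lifted character at the regular part of `h` reduces to the trace at `h`. -/
theorem exists_red_eq_trace_gch (ρ : Representation k H V) (h : H) :
    ∃ z : AlgInt, B.gch ρ ⟨h ^ regExp r (Nat.card H), coprime_orderOf_pow_regExp B.eq_one_or_prime
      Nat.card_pos.ne' pow_card_eq_one'⟩ = z ∧ B.red z = LinearMap.trace k V (ρ h) := by
  have hn : Nat.card H ≠ 0 := Nat.card_pos.ne'
  obtain ⟨z, hz, hz'⟩ := B.exists_red_eq_trace (T := ρ (h ^ regExp r (Nat.card H)))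
    (m := ordCompl[r] (Nat.card H)) (Nat.ordCompl_pos r hn).ne'
    (coprime_ordCompl' B.eq_one_or_prime hn)
    (by rw [← map_pow, pow_regExp_pow B.eq_one_or_prime hn pow_card_eq_one', map_one])
  refine ⟨z, hz.symm, ?_⟩
  rw [hz', map_pow]
  exact B.trace_pow_regExp (by rw [← map_pow, pow_card_eq_one', map_one])

/-- Irreducible lifted characters are linearly independent over `ℤ`. After division by the
greatest common divisor of the coefficients, not all of them vanish in `k`, which contradicts the
linear independence of traces. -/
theorem intCoeff_eq_zero (S : Finset (PReg r H → ℂ)) (hS : ∀ φ ∈ S, B.IsGIrr φ)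
    (c : (PReg r H → ℂ) → ℤ) (hc : ∑ φ ∈ S, c φ • φ = 0) : ∀ φ ∈ S, c φ = 0 := by
  classical
  by_contra hcon
  push Not at hcon
  obtain ⟨φ₀, hφ₀, hne⟩ := hcon
  obtain ⟨d, hd, hgcd⟩ := Finset.extract_gcd c ⟨φ₀, hφ₀⟩
  have hg : S.gcd c ≠ 0 := fun h => hne (Finset.gcd_eq_zero_iff.1 h φ₀ hφ₀)
  have hsum : ∑ φ ∈ S, d φ • φ = 0 := by
    have h1 : (S.gcd c) • ∑ φ ∈ S, d φ • φ = 0 := by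
      rw [← hc, Finset.smul_sum]
      refine Finset.sum_congr rfl fun φ hφ => ?_
      rw [hd φ hφ, mul_smul]
    exact (smul_eq_zero.1 h1).resolve_left hg
  have hirr : ∀ φ : S, ∃ (n : ℕ) (ρ : Representation k H (Fin n → k)), ρ.IsIrreducible ∧
      φ.1 = B.gch ρ := fun φ => hS φ.1 φ.2
  choose n ρ hρ hφ using hirr
  have hzero : ∀ φ : S, ((d φ : ℤ) : k) = 0 := by
    refine trace_linearIndependent ρ hρ (fun φ ψ ⟨e⟩ => ?_) (fun φ => ((d φ : ℤ) : k)) fun h => ?_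
    · apply Subtype.ext
      rw [hφ, hφ, B.gch_equiv e]
    · choose z hz hz' using fun φ : S => B.exists_red_eq_trace_gch (ρ φ) h
      have h1 : ∑ φ : S, (d φ : AlgInt) * z φ = 0 := by
        apply Subtype.val_injective
        have h2 := congrFun hsum ⟨h ^ regExp r (Nat.card H),
          coprime_orderOf_pow_regExp B.eq_one_or_prime Nat.card_pos.ne' pow_card_eq_one'⟩
        rw [← Finset.sum_coe_sort S (fun φ => d φ • φ), Finset.sum_apply] at h2
        push_cast
        refine Eq.trans (Finset.sum_congr rfl fun φ _ => ?_) h2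
        rw [Pi.smul_apply, zsmul_eq_mul, ← hz φ, ← hφ φ]
      have h2 := congrArg B.red h1
      rw [map_sum, map_zero] at h2
      refine Eq.trans (Finset.sum_congr rfl fun φ _ => ?_) h2
      rw [map_mul, map_intCast, hz']
  rcases B.char_cond with ⟨_, h⟩ | ⟨hp, h⟩
  · have h1 : S.gcd d = 0 := Finset.gcd_eq_zero_iff.2 fun φ hφ =>
      Int.cast_eq_zero.1 (hzero ⟨φ, hφ⟩)
    rw [hgcd] at h1
    exact one_ne_zero h1
  · have h1 : (r : ℤ) ∣ S.gcd d := Finset.dvd_gcd fun φ hφ =>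
      (CharP.intCast_eq_zero_iff k r _).1 (hzero ⟨φ, hφ⟩)
    rw [hgcd] at h1
    have h2 := Int.natAbs_dvd_natAbs.2 h1
    simp at h2
    exact hp.one_lt.ne' h2

/-- The decomposition of a lifted character into irreducible ones is unique. -/
theorem eq_of_multiset_sum_eq {s t : Multiset (PReg r H → ℂ)} (hs : ∀ φ ∈ s, B.IsGIrr φ)
    (ht : ∀ φ ∈ t, B.IsGIrr φ) (h : s.sum = t.sum) : s = t := by
  classical
  have h1 := B.intCoeff_eq_zero (s.toFinset ∪ t.toFinset) (fun φ hφ => by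
    rcases Finset.mem_union.1 hφ with h | h
    · exact hs φ (Multiset.mem_toFinset.1 h)
    · exact ht φ (Multiset.mem_toFinset.1 h))
    (fun φ => (s.count φ : ℤ) - t.count φ) (by
      simp only [sub_smul, natCast_zsmul, Finset.sum_sub_distrib]
      rw [sub_eq_zero, ← Finset.sum_multiset_count_of_subset s _ Finset.subset_union_left,
        ← Finset.sum_multiset_count_of_subset t _ Finset.subset_union_right, h])
  ext φ
  by_cases hφ : φ ∈ s.toFinset ∪ t.toFinset
  · have h2 := h1 φ hφ
    omega
  · rw [Finset.mem_union, not_or, Multiset.mem_toFinset, Multiset.mem_toFinset] at hφ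
    rw [Multiset.count_eq_zero_of_notMem hφ.1, Multiset.count_eq_zero_of_notMem hφ.2]

/-- An irreducible representation is determined by its lifted character. -/
theorem nonempty_equiv_of_gch_eq {ρ : Representation k H V} {σ : Representation k H W}
    (hρ : ρ.IsIrreducible) (hσ : σ.IsIrreducible) (h : B.gch ρ = B.gch σ) :
    Nonempty (ρ.Equiv σ) := by
  let R : Bool → Σ n : ℕ, Representation k H (Fin n → k) :=
    fun b => cond b ⟨_, coordRep ρ⟩ ⟨_, coordRep σ⟩
  have hR : ∀ b, (R b).2.IsIrreducible := by
    rintro (_ | _)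
    · exact isIrreducible_of_equiv (coordRepEquiv σ) hσ
    · exact isIrreducible_of_equiv (coordRepEquiv ρ) hρ
  by_contra hcon
  have hne : ∀ i j, Nonempty ((R i).2.Equiv (R j).2) → i = j := by
    rintro (_ | _) (_ | _) ⟨e⟩
    · rfl
    · exact absurd ⟨((coordRepEquiv σ).trans (e.trans (coordRepEquiv ρ).symm)).symm⟩ hcon
    · exact absurd ⟨(coordRepEquiv ρ).trans (e.trans (coordRepEquiv σ).symm)⟩ hcon
    · rfl
  have htr : ∀ (b : Bool), B.gch (R b).2 = B.gch ρ := by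
    rintro (_ | _)
    · rw [h]; exact (B.gch_equiv (coordRepEquiv σ)).symm
    · exact (B.gch_equiv (coordRepEquiv ρ)).symm
  have h0 := trace_linearIndependent (fun b => (R b).2) hR hne (fun b => cond b 1 (-1)) (fun g => by
    obtain ⟨z, hz, hz'⟩ := B.exists_red_eq_trace_gch (R true).2 g
    obtain ⟨w, hw, hw'⟩ := B.exists_red_eq_trace_gch (R false).2 g
    have hzw : z = w := Subtype.val_injective (by rw [← hz, ← hw, htr, htr])
    rw [Fintype.sum_bool, ← hz', ← hw', hzw]
    simp) true
  exact one_ne_zero h0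

/-- A representation whose lifted character is irreducible is irreducible. -/
theorem isIrreducible_of_isGIrr {ρ : Representation k H V} (h : B.IsGIrr (B.gch ρ)) :
    ρ.IsIrreducible := by
  rw [isIrreducible_iff]
  obtain ⟨n, σ, hσ, hgch⟩ := h
  have hn : Nontrivial (Fin n → k) := (isIrreducible_iff.1 hσ).1
  have hdim : Module.finrank k V = Module.finrank k (Fin n → k) := by
    have h1 := congrFun hgch ⟨1, by simp⟩
    rw [gch_one, gch_one] at h1
    exact_mod_cast h1
  have hpos : 0 < Module.finrank k V := hdim ▸ Module.finrank_pos
  refine ⟨Module.finrank_pos_iff.1 hpos, fun U hU => ?_⟩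
  obtain ⟨s, hs, hs'⟩ := B.exists_multiset_gch (ρ.subrepresentation U hU)
  obtain ⟨t, ht, ht'⟩ := B.exists_multiset_gch (ρ.quotient U hU)
  have h1 : s + t = {B.gch σ} := by
    refine B.eq_of_multiset_sum_eq (fun φ hφ => ?_) (fun φ hφ => ?_) ?_
    · rcases Multiset.mem_add.1 hφ with h | h
      · exact hs φ h
      · exact ht φ h
    · rw [Multiset.mem_singleton.1 hφ]
      exact B.isGIrr_gch hσ
    · rw [Multiset.sum_add, ← hs', ← ht', ← B.gch_eq_add, hgch, Multiset.sum_singleton]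
  have hcard := congrArg Multiset.card h1
  rw [Multiset.card_add, Multiset.card_singleton] at hcard
  by_cases hs0 : s = 0
  · left
    rw [hs0, Multiset.sum_zero] at hs'
    have h2 := congrFun hs' ⟨1, by simp⟩
    rw [gch_one, Pi.zero_apply] at h2
    exact Submodule.finrank_eq_zero.1 (by exact_mod_cast h2)
  · right
    have ht0 : t = 0 := by
      have := Multiset.card_pos.2 hs0
      exact Multiset.card_eq_zero.1 (by omega)
    rw [ht0, Multiset.sum_zero] at ht'
    have h2 := congrFun ht' ⟨1, by simp⟩
    rw [gch_one, Pi.zero_apply] at h2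
    have h3 : Module.finrank k (V ⧸ U) = 0 := by exact_mod_cast h2
    have h4 := Submodule.finrank_quotient_add_finrank U
    exact Submodule.eq_top_of_finrank_eq (by omega)

end

end CharLift

/-! ### Clifford theory and tensor products -/

section Descent

variable {k H K V : Type*} [Field k] [Group H] [Group K] [AddCommGroup V] [Module k V]

/-- A representation that is trivial on the kernel of `q` descends to the image of `q`. -/
theorem exists_comp_eq_of_ker {q : H →* K} (hq : Function.Surjective q) (R : Representation k H V)
    (hR : ∀ x, q x = 1 → R x = 1) : ∃ σ : Representation k K V, σ.comp q = R := by
  have key : ∀ x y, q x = q y → R x = R y := by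
    intro x y hxy
    have h1 := hR (x * y⁻¹) (by rw [map_mul, map_inv, hxy, mul_inv_cancel])
    calc R x = R (x * y⁻¹ * y) := by rw [inv_mul_cancel_right]
      _ = R y := by rw [map_mul, h1, one_mul]
  have hinv : ∀ g, q (Function.surjInv hq g) = g := Function.surjInv_eq hq
  refine ⟨{ toFun := fun g => R (Function.surjInv hq g), map_one' := ?_, map_mul' := ?_ }, ?_⟩
  · exact hR _ (hinv 1)
  · intro g h
    rw [← map_mul]
    exact key _ _ (by rw [map_mul, hinv, hinv, hinv])
  · ext x : 1
    exact key _ _ (hinv _)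

theorem isIrreducible_comp_iff {q : H →* K} (hq : Function.Surjective q)
    {σ : Representation k K V} : IsIrreducible (k := k) (σ.comp q) ↔
      σ.IsIrreducible := by
  rw [isIrreducible_iff, isIrreducible_iff]
  have : ∀ U : Submodule k V, (∀ g : H, U ≤ U.comap ((σ.comp q : Representation k H V) g)) ↔
      ∀ g, U ≤ U.comap (σ g) := fun U =>
    ⟨fun h g => by obtain ⟨x, rfl⟩ := hq g; exact h x, fun h g => h (q g)⟩
  simp only [this]

/-- Every nonzero finite-dimensional representation has an irreducible subrepresentation. -/
theorem exists_irreducible_intertwining {V : Type*} [AddCommGroup V] [Module k V]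
    [FiniteDimensional k V] [Nontrivial V] (σ : Representation k H V) :
    ∃ (n : ℕ) (τ : Representation k H (Fin n → k)) (i : (Fin n → k) →ₗ[k] V), τ.IsIrreducible ∧
      Function.Injective i ∧ ∀ h v, i (τ h v) = σ h (i v) := by
  induction hn : Module.finrank k V using Nat.strong_induction_on generalizing V with
  | _ n ih =>
    by_cases hirr : σ.IsIrreducible
    · refine ⟨_, coordRep σ, (coordRepEquiv σ).symm.toLinearEquiv.toLinearMap,
        isIrreducible_of_equiv (coordRepEquiv σ) hirr,
        (coordRepEquiv σ).symm.toLinearEquiv.injective, fun h v => ?_⟩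
      exact LinearMap.congr_fun ((coordRepEquiv σ).symm.isIntertwining' h) v
    · rw [isIrreducible_iff, not_and] at hirr
      have h1 := hirr inferInstance
      push Not at h1
      obtain ⟨U, hU, hbot, htop⟩ := h1
      have hlt := Submodule.finrank_lt htop
      have : Nontrivial U := Submodule.nontrivial_iff_ne_bot.2 hbot
      obtain ⟨m, τ, i, hτ, hi, hint⟩ := ih _ (by omega) (σ.subrepresentation U hU) rfl
      refine ⟨m, τ, U.subtype.comp i, hτ, U.injective_subtype.comp hi, fun h v => ?_⟩
      rw [LinearMap.comp_apply, hint]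
      rfl

end Descent

section Tensor

open TensorProduct

variable {k E Q X Y W : Type*} [Field k] [Group E] [Group Q] [AddCommGroup X] [Module k X]
  [FiniteDimensional k X] [AddCommGroup Y] [Module k Y] [AddCommGroup W] [Module k W]

/-- A nonzero subspace of `X ⊗ Y` that is stable under `End X` contains some `X ⊗ y`. -/
theorem exists_tmul_mem {S : Submodule k (X ⊗[k] Y)} (hS : S ≠ ⊥)
    (hstab : ∀ (T : X →ₗ[k] X), ∀ t ∈ S, T.rTensor Y t ∈ S) : ∃ y : Y, y ≠ 0 ∧ ∀ v, v ⊗ₜ y ∈ S := by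
  classical
  obtain ⟨t, ht, ht0⟩ := Submodule.exists_mem_ne_zero_of_ne_bot hS
  let b := Module.finBasis k X
  obtain ⟨j, hj⟩ : ∃ j, TensorProduct.lid k Y ((b.coord j).rTensor _ t) ≠ 0 := by
    by_contra h
    push Not at h
    apply ht0
    apply (TensorProduct.equivFinsuppOfBasisLeft b).injective
    ext j
    rw [TensorProduct.equivFinsuppOfBasisLeft_apply, h, map_zero, Finsupp.zero_apply]
  refine ⟨_, hj, fun v => ?_⟩
  have h := hstab ((b.coord j).smulRight v) t ht
  have h2 : ∀ t : X ⊗[k] Y, ((b.coord j).smulRight v).rTensor Y t =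
      v ⊗ₜ TensorProduct.lid k Y ((b.coord j).rTensor _ t) := by
    intro t
    induction t with
    | zero => simp
    | tmul x y => simp [TensorProduct.smul_tmul]
    | add x y hx hy => rw [map_add, hx, hy, map_add, map_add, tmul_add]
  rwa [h2] at h

/-- By Burnside's theorem, a subspace of `X ⊗ Y` that is stable under an irreducible representation
on `X` is stable under all of `End X`. -/
theorem rTensor_mem_of_irreducible [IsAlgClosed k] {P : Representation k E X}
    (hP : P.IsIrreducible) {S : Submodule k (X ⊗[k] Y)}
    (hstab : ∀ x, ∀ t ∈ S, (P x).rTensor Y t ∈ S) (T : X →ₗ[k] X) :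
    ∀ t ∈ S, T.rTensor Y t ∈ S := by
  obtain ⟨a, rfl⟩ := asAlgebraHom_surjective hP T
  intro t ht
  induction a using MonoidAlgebra.induction_linear with
  | zero => simp
  | add x y hx hy =>
    rw [map_add, LinearMap.rTensor_add, LinearMap.add_apply]
    exact S.add_mem hx hy
  | single g b =>
    rw [asAlgebraHom_single, LinearMap.rTensor_smul, LinearMap.smul_apply]
    exact S.smul_mem b (hstab g t ht)

theorem eq_top_of_finrank_tensor_le [FiniteDimensional k Y] [Nontrivial X] {U : Submodule k Y}
    (h : Module.finrank k (X ⊗[k] Y) ≤ Module.finrank k (X ⊗[k] U)) : U = ⊤ := by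
  rw [Module.finrank_tensorProduct, Module.finrank_tensorProduct] at h
  exact Submodule.eq_top_of_finrank_eq
    (le_antisymm (Submodule.finrank_le U) (Nat.le_of_mul_le_mul_left h Module.finrank_pos))

/-- The tensor product of a representation irreducible on a subgroup and an irreducible
representation trivial on that subgroup is irreducible. -/
theorem isIrreducible_tprod [IsAlgClosed k] {K : Subgroup E} {P : Representation k E X}
    (hP : IsIrreducible (k := k) (P.comp K.subtype)) {σ : Representation k E Y}
    (hσ : σ.IsIrreducible) (hK : ∀ x ∈ K, σ x = 1) : (tprod P σ).IsIrreducible := by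
  rw [isIrreducible_iff]
  have hX := (isIrreducible_iff.1 hP).1
  obtain ⟨hY, hσ'⟩ := isIrreducible_iff.1 hσ
  refine ⟨inferInstance, fun S hS => ?_⟩
  by_cases hbot : S = ⊥
  · exact Or.inl hbot
  right
  obtain ⟨y, hy, hyS⟩ := exists_tmul_mem hbot (rTensor_mem_of_irreducible hP fun x t ht => by
    have h := hS x.1 ht
    rw [Submodule.mem_comap, Representation.tprod_apply, hK x.1 x.2] at h
    exact h)
  let U : Submodule k Y := ⨅ v : X, S.comap (TensorProduct.mk k X Y v)
  have hmem : ∀ u, u ∈ U ↔ ∀ v, v ⊗ₜ u ∈ S := fun u => by simp [U, Submodule.mem_iInf]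
  have hU : U = ⊤ := by
    refine (hσ' U fun g u hu => ?_).resolve_left ?_
    · rw [Submodule.mem_comap, hmem]
      intro v
      have h := hS g ((hmem u).1 hu (P g⁻¹ v))
      rw [Submodule.mem_comap, Representation.tprod_apply, TensorProduct.map_tmul, ← Module.End.mul_apply,
        ← map_mul, mul_inv_cancel, map_one] at h
      exact h
    · intro h
      have h1 := (hmem y).2 hyS
      rw [h] at h1
      exact hy ((Submodule.mem_bot k).1 h1)
  rw [eq_top_iff, ← TensorProduct.span_tmul_eq_top, Submodule.span_le]
  rintro _ ⟨v, u, rfl⟩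
  exact (hmem u).1 (hU ▸ Submodule.mem_top) v

/-- Let `P` be a representation which is irreducible on the kernel of `q`. An irreducible
representation into which the restriction of `P` to this kernel embeds is the tensor product of `P`
and an irreducible representation of the image of `q`. -/
theorem exists_tprod_equiv [IsAlgClosed k] [FiniteDimensional k W] {q : E →* Q}
    (hq : Function.Surjective q)
    {P : Representation k E X} (hP : IsIrreducible (k := k) (P.comp q.ker.subtype))
    {R : Representation k E W} (hR : R.IsIrreducible) {f : X →ₗ[k] W} (hf : f ≠ 0)
    (hint : ∀ x, q x = 1 → ∀ v, f (P x v) = R x (f v)) :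
    ∃ (n : ℕ) (σ : Representation k Q (Fin n → k)), σ.IsIrreducible ∧
      Nonempty ((tprod P (σ.comp q : Representation k E (Fin n → k))).Equiv R) := by
  let L := linHom P R
  -- `Y` is the space of homomorphisms `X → W` over the kernel of `q`, on which `E` acts by conjugation
  let Y := invariants (L.comp q.ker.subtype)
  have hYmem : ∀ g : X →ₗ[k] W, g ∈ Y ↔ ∀ x, q x = 1 → ∀ v, g (P x v) = R x (g v) := by
    intro g
    rw [mem_invariants]
    constructor
    · intro h x hx v
      have h1 := LinearMap.congr_fun (h ⟨x, hx⟩) (P x v)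
      change R x (g (P x⁻¹ (P x v))) = g (P x v) at h1
      rw [← h1, ← Module.End.mul_apply, ← map_mul, inv_mul_cancel, map_one]
      rfl
    · rintro h ⟨x, hx⟩
      ext v
      change R x (g (P x⁻¹ v)) = g v
      rw [← h x hx, ← Module.End.mul_apply, ← map_mul, mul_inv_cancel, map_one]
      rfl
  let τ : Representation k E Y := toInvariants L q.ker
  have hτval : ∀ x (g : Y) v, (τ x g).1 v = R x (g.1 (P x⁻¹ v)) := fun _ _ _ => rfl
  have hτK : ∀ x, q x = 1 → τ x = 1 := by
    intro x hx
    ext g v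
    rw [hτval]
    have h1 := (hYmem g.1).1 g.2 x hx (P x⁻¹ v)
    rw [← h1, ← Module.End.mul_apply, ← map_mul, mul_inv_cancel, map_one]
    rfl
  obtain ⟨σ, hσ⟩ := exists_comp_eq_of_ker hq τ hτK
  -- the evaluation map is an isomorphism of representations: its kernel contains no `X ⊗ g` with
  -- `g ≠ 0`, and its range is a nonzero submodule of `W`
  let ev : X ⊗[k] Y →ₗ[k] W := TensorProduct.lift (Y.subtype.flip)
  have hev : ∀ v (g : Y), ev (v ⊗ₜ g) = g.1 v := fun _ _ => rfl
  have hevint : ∀ x, ev ∘ₗ (tprod P τ x) = R x ∘ₗ ev := by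
    intro x
    apply TensorProduct.ext'
    intro v g
    rw [LinearMap.comp_apply, Representation.tprod_apply, TensorProduct.map_tmul, hev, hτval,
      ← Module.End.mul_apply (P x⁻¹), ← map_mul, inv_mul_cancel, map_one]
    rfl
  have hevinj : Function.Injective ev := by
    rw [← LinearMap.ker_eq_bot]
    by_contra hbot
    obtain ⟨g, hg, hgS⟩ := exists_tmul_mem hbot (rTensor_mem_of_irreducible hP fun x t ht => by
      have h := LinearMap.congr_fun (hevint x.1) t
      rw [LinearMap.comp_apply, LinearMap.comp_apply, LinearMap.mem_ker.1 ht, map_zero,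
        Representation.tprod_apply, hτK x.1 x.2] at h
      exact h)
    apply hg
    ext v
    exact hgS v
  have hevsurj : Function.Surjective ev := by
    rw [← LinearMap.range_eq_top]
    refine ((isIrreducible_iff.1 hR).2 _ fun x w hw => ?_).resolve_left fun h => hf ?_
    · obtain ⟨t, rfl⟩ := hw
      exact ⟨tprod P τ x t, LinearMap.congr_fun (hevint x) t⟩
    · ext v
      have h1 : f v ∈ LinearMap.range ev := ⟨v ⊗ₜ ⟨f, (hYmem f).2 hint⟩, rfl⟩
      rw [h] at h1
      exact (Submodule.mem_bot k).1 h1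
  -- a submodule `U` of `Y` gives the submodule `ev (X ⊗ U)` of the irreducible module `W`
  have hτirr : τ.IsIrreducible := by
    rw [isIrreducible_iff]
    refine ⟨⟨⟨f, (hYmem f).2 hint⟩, 0, fun h => hf (congrArg Subtype.val h)⟩, fun U hU => ?_⟩
    let ev' := ev ∘ₗ (U.subtype.lTensor X)
    have hstab : ∀ x, LinearMap.range ev' ≤ (LinearMap.range ev').comap (R x) := by
      rintro x w ⟨t, rfl⟩
      refine ⟨tprod P (τ.subrepresentation U hU) x t, ?_⟩
      induction t with
      | zero => simp
      | add t t' ht ht' => rw [map_add, map_add, map_add, map_add, ht, ht']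
      | tmul v g => exact LinearMap.congr_fun (hevint x) (v ⊗ₜ g.1)
    rcases (isIrreducible_iff.1 hR).2 (LinearMap.range ev') hstab with h | h
    · left
      rw [eq_bot_iff]
      intro g hg
      rw [Submodule.mem_bot]
      ext v
      have h1 : g.1 v ∈ LinearMap.range ev' := ⟨v ⊗ₜ ⟨g, hg⟩, rfl⟩
      rw [h] at h1
      exact (Submodule.mem_bot k).1 h1
    · right
      have h1 : Module.finrank k W ≤ Module.finrank k (X ⊗[k] U) :=
        LinearMap.finrank_le_finrank_of_surjective (LinearMap.range_eq_top.1 h)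
      have h2 : Module.finrank k (X ⊗[k] Y) = Module.finrank k W :=
        (LinearEquiv.ofBijective ev ⟨hevinj, hevsurj⟩).finrank_eq
      have hX := (isIrreducible_iff.1 hP).1
      exact eq_top_of_finrank_tensor_le (X := X) (h2.le.trans h1)
  have hσirr : σ.IsIrreducible := (isIrreducible_comp_iff hq).1 (hσ ▸ hτirr)
  refine ⟨_, coordRep σ, isIrreducible_of_equiv (coordRepEquiv σ) hσirr, ⟨?_⟩⟩
  let e1 : (X ⊗[k] (Fin (Module.finrank k Y) → k)) ≃ₗ[k] X ⊗[k] Y :=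
    TensorProduct.congr (LinearEquiv.refl k X) (coordRepEquiv σ).symm.toLinearEquiv
  refine Representation.Equiv.mk (e1.trans (LinearEquiv.ofBijective ev ⟨hevinj, hevsurj⟩))
    fun x => ?_
  apply TensorProduct.ext'
  intro v u
  have h1 := LinearMap.congr_fun ((coordRepEquiv σ).symm.isIntertwining' (q x)) u
  have h2 := LinearMap.congr_fun (hevint x) (v ⊗ₜ (coordRepEquiv σ).symm.toLinearEquiv u)
  have h3 : σ (q x) = τ x := by rw [← hσ]; rfl
  rw [h3] at h1
  refine Eq.trans ?_ h2
  change ev (P x v ⊗ₜ (coordRepEquiv σ).symm.toLinearEquiv (coordRep σ (q x) u)) =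
    ev (P x v ⊗ₜ τ x ((coordRepEquiv σ).symm.toLinearEquiv u))
  congr 2

end Tensor

namespace CharLift

variable {r : ℕ} {k : Type*} [Field k] (B : CharLift r k)

section Clifford

variable {H K V W : Type*} [Group H] [Group K] [AddCommGroup V] [Module k V]
  [FiniteDimensional k V] [AddCommGroup W] [Module k W] [FiniteDimensional k W]
  [IsAlgClosed k] [Finite K]

/-- Let `ρ` be an irreducible representation of `H`, and `X` an irreducible representation of a
normal subgroup `K` of `H` whose character is invariant in `H` and is a constituent of the
restriction of the character of `ρ`. Then `X` embeds in the restriction of `ρ`. By Clifford's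
argument, the restriction of `ρ` is a sum of conjugates of any irreducible submodule, so that its
irreducible constituents are conjugate. -/
theorem exists_intertwining_of_gch_eq_add {ρ : Representation k H V} (hρ : ρ.IsIrreducible)
    (j : K →* H) (c : H → K ≃* K) (hc : ∀ h n, j (c h n) = h * j n * h⁻¹)
    {X : Representation k K W} (hX : X.IsIrreducible)
    (hinv : ∀ h n, B.gch X (PReg.map (c h).toMonoidHom n) = B.gch X n)
    {ψ : PReg r K → ℂ} (hψ : B.IsGChar ψ)
    (hres : B.gch (ρ.comp j : Representation k K V) = B.gch X + ψ) :
    ∃ f : W →ₗ[k] V, f ≠ 0 ∧ ∀ n w, f (X n w) = ρ (j n) (f w) := by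
  have hV := (isIrreducible_iff.1 hρ).1
  have hW := (isIrreducible_iff.1 hX).1
  obtain ⟨m, τ, i₀, hτ, hi₀, hint₀⟩ :=
    exists_irreducible_intertwining (ρ.comp j : Representation k K V)
  -- the conjugates of `τ` and their embeddings into `ρ`
  let τc : H → Representation k K (Fin m → k) := fun h => τ.comp (c h).symm.toMonoidHom
  have hτc : ∀ h, (τc h).IsIrreducible := fun h =>
    (isIrreducible_comp_iff (c h).symm.surjective).2 hτ
  let ic : H → (Fin m → k) →ₗ[k] V := fun h => ρ h ∘ₗ i₀
  have hic : ∀ h n v, ic h (τc h n v) = ρ (j n) (ic h v) := by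
    intro h n v
    change ρ h (i₀ (τ ((c h).symm n) v)) = ρ (j n) (ρ h (i₀ v))
    have h1 : j n = h * j ((c h).symm n) * h⁻¹ := by rw [← hc, MulEquiv.apply_symm_apply]
    rw [hint₀, ← Module.End.mul_apply (ρ (j n)), ← map_mul, h1, inv_mul_cancel_right, map_mul]
    rfl
  -- the submodules of dimension `n` whose character is a sum of characters of conjugates of `τ`
  let p : ℕ → Prop := fun n => ∃ (σ : Representation k K (Fin n → k)) (i : (Fin n → k) →ₗ[k] V),
    Function.Injective i ∧ (∀ g v, i (σ g v) = ρ (j g) (i v)) ∧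
    ∃ s : Multiset (PReg r K → ℂ), (∀ φ ∈ s, ∃ h, φ = B.gch (τc h)) ∧ B.gch σ = s.sum
  have hp0 : p 0 := by
    refine ⟨1, 0, fun x y _ => Subsingleton.elim _ _, fun g v => by simp, 0, by simp, ?_⟩
    funext g
    have h1 := B.ltr_one (V := Fin 0 → k)
    rw [Module.finrank_fin_fun] at h1
    simpa [gch] using h1
  have hbound : ∀ n, p n → n ≤ Module.finrank k V := by
    rintro n ⟨σ, i, hi, -⟩
    have := LinearMap.finrank_le_finrank_of_injective hi
    rwa [Module.finrank_fin_fun] at this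
  classical
  have hmax := Nat.findGreatest_spec (P := p) (Nat.zero_le (Module.finrank k V)) hp0
  set n := Nat.findGreatest p (Module.finrank k V) with hn
  obtain ⟨σ, i, hi, hint, s, hs, hsum⟩ := hmax
  -- one of maximal dimension contains all conjugates of `τ`, so by irreducibility it is all of `V`
  have hall : ∀ h, LinearMap.range (ic h) ≤ LinearMap.range i := by
    intro h
    by_contra hcon
    have hU := (isIrreducible_iff.1 (hτc h)).2 ((LinearMap.range i).comap (ic h)) (by
      rintro g v ⟨w, hw⟩
      exact ⟨σ g w, by rw [hic, ← hw, hint]⟩)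
    rcases hU with hU | hU
    · let e : ((Fin n → k) × (Fin m → k)) →ₗ[k] V := i.coprod (ic h)
      have he : Function.Injective e := by
        rw [← LinearMap.ker_eq_bot, LinearMap.ker_eq_bot']
        rintro ⟨v, w⟩ hvw
        have h1 : i v + ic h w = 0 := hvw
        have hw : w ∈ (LinearMap.range i).comap (ic h) :=
          ⟨-v, by rw [map_neg, ← eq_neg_of_add_eq_zero_right h1]⟩
        rw [hU, Submodule.mem_bot] at hw
        subst hw
        rw [map_zero, add_zero] at h1
        rw [(map_eq_zero_iff i hi).1 h1]
        rfl
      let e' := coordRepEquiv (σ.prod (τc h))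
      have hbig : p (Module.finrank k ((Fin n → k) × (Fin m → k))) := by
        refine ⟨coordRep (σ.prod (τc h)), e ∘ₗ e'.symm.toLinearEquiv.toLinearMap,
          he.comp e'.symm.toLinearEquiv.injective, fun g v => ?_, B.gch (τc h) ::ₘ s, ?_, ?_⟩
        · have h1 := LinearMap.congr_fun (e'.symm.isIntertwining' g) v
          have h2 : ∀ u, e (σ.prod (τc h) g u) = ρ (j g) (e u) := by
            rintro ⟨a, b⟩
            change i (σ g a) + ic h (τc h g b) = ρ (j g) (i a + ic h b)
            rw [hint, hic, map_add]
          exact (congrArg e h1).trans (h2 _)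
        · intro φ hφ
          rcases Multiset.mem_cons.1 hφ with rfl | hφ
          · exact ⟨h, rfl⟩
          · exact hs φ hφ
        · rw [← B.gch_equiv e', Multiset.sum_cons, ← hsum, add_comm]
          funext g
          exact B.ltr_prodMap _ _
      have hle := Nat.le_findGreatest (hbound _ hbig) hbig
      rw [← hn, Module.finrank_prod, Module.finrank_fin_fun, Module.finrank_fin_fun] at hle
      have hm0 : m = 0 := by omega
      subst hm0
      exact (not_subsingleton_iff_nontrivial.2 (isIrreducible_iff.1 hτ).1) inferInstance
    · apply hcon
      rintro _ ⟨v, rfl⟩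
      have : v ∈ (LinearMap.range i).comap (ic h) := hU ▸ Submodule.mem_top
      exact this
  have hsurj : LinearMap.range i = ⊤ := by
    have h1 : (⨅ h : H, (LinearMap.range i).comap (ρ h)) = ⊤ := by
      refine ((isIrreducible_iff.1 hρ).2 _ fun g v hv => ?_).resolve_left fun hbot => ?_
      · rw [Submodule.mem_comap, Submodule.mem_iInf]
        intro h
        rw [Submodule.mem_comap, ← Module.End.mul_apply, ← map_mul]
        exact (Submodule.mem_iInf _).1 hv (h * g)
      · have := (isIrreducible_iff.1 hτ).1
        obtain ⟨v, hv⟩ := exists_ne (0 : Fin m → k)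
        have hmem : i₀ v ∈ ⨅ h : H, (LinearMap.range i).comap (ρ h) :=
          (Submodule.mem_iInf _).2 fun h => hall h ⟨v, rfl⟩
        rw [hbot, Submodule.mem_bot] at hmem
        exact hv ((map_eq_zero_iff i₀ hi₀).1 hmem)
    rw [eq_top_iff, ← h1]
    exact (iInf_le _ 1).trans_eq (by rw [map_one]; rfl)
  have hgch : B.gch (ρ.comp j : Representation k K V) = s.sum := by
    rw [← hsum]
    refine (B.gch_equiv (Representation.Equiv.mk (LinearEquiv.ofBijective i
      ⟨hi, LinearMap.range_eq_top.1 hsurj⟩) fun g => ?_)).symm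
    exact LinearMap.ext fun v => hint g v
  obtain ⟨t, ht, rfl⟩ := IsGChar.exists_multiset B hψ
  -- by unique decomposition, the character of `X` is that of a conjugate of `τ`; being invariant, it
  -- is the character of `τ` itself
  have hst : s = B.gch X ::ₘ t := by
    refine B.eq_of_multiset_sum_eq (fun φ hφ => ?_) (fun φ hφ => ?_) ?_
    · obtain ⟨h, rfl⟩ := hs φ hφ
      exact B.isGIrr_gch (hτc h)
    · rcases Multiset.mem_cons.1 hφ with rfl | hφ
      · exact B.isGIrr_gch hX
      · exact ht φ hφ
    · rw [← hgch, hres, Multiset.sum_cons]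
  obtain ⟨h, hh⟩ := hs (B.gch X) (hst ▸ Multiset.mem_cons_self _ _)
  have hXτ : B.gch X = B.gch τ := by
    funext g
    rw [← hinv h g, hh]
    change B.ltr (τ ((c h).symm (c h g.1))) = B.ltr (τ g.1)
    rw [MulEquiv.symm_apply_apply]
  obtain ⟨e⟩ := B.nonempty_equiv_of_gch_eq hX hτ hXτ
  refine ⟨i₀ ∘ₗ e.toLinearEquiv.toLinearMap, fun h0 => ?_, fun g w => ?_⟩
  · obtain ⟨w, hw⟩ := exists_ne (0 : W)
    have h1 : i₀ (e.toLinearEquiv w) = 0 := LinearMap.congr_fun h0 w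
    exact hw (e.toLinearEquiv.map_eq_zero_iff.1 ((map_eq_zero_iff i₀ hi₀).1 h1))
  · have h1 := LinearMap.congr_fun (e.isIntertwining' g) w
    exact (congrArg i₀ h1).trans (hint₀ g _)

end Clifford

section Correspondence

open TensorProduct

variable {E U Q X W : Type*} [Group E] [Group U] [Group Q] [AddCommGroup X] [Module k X]
  [FiniteDimensional k X] [AddCommGroup W] [Module k W] [FiniteDimensional k W] [IsAlgClosed k]
  [Finite E]

theorem gch_mul_of_equiv {P : Representation k E X} {π : E →* U} {q : E →* Q}
    {Y : Type*} [AddCommGroup Y] [Module k Y] [FiniteDimensional k Y]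
    {σ : Representation k Q Y} {ρ : Representation k U W}
    (e : (tprod P (σ.comp q : Representation k E Y)).Equiv (ρ.comp π : Representation k E W))
    (x : PReg r E) :
    B.gch ρ (PReg.map π x) = B.gch P x * B.gch σ (PReg.map q x) := by
  have h1 := congrFun (B.gch_equiv e) x
  refine h1.symm.trans ?_
  refine B.ltr_tensor (orderOf_pos x.1).ne' x.2 ?_ ?_
  · rw [← map_pow, pow_orderOf_eq_one, map_one]
  · change (σ (q x.1)) ^ _ = 1
    rw [← map_pow, ← map_pow, pow_orderOf_eq_one, map_one, map_one]

/-- An irreducible representation `ρ` of `U` into which `P`, restricted to the kernel of `q`, embeds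
comes from an irreducible representation `σ` of `Q` with `ρ ≅ P ⊗ σ` over `E`. On the kernel of `π`,
the scalars of `σ` are inverse to those of `P`. -/
theorem exists_irreducible_gch_mul {P : Representation k E X} {π : E →* U} {q : E →* Q}
    (hπ : Function.Surjective π) (hq : Function.Surjective q)
    (hP : IsIrreducible (k := k) (P.comp q.ker.subtype))
    {ρ : Representation k U W} (hρ : ρ.IsIrreducible) {f : X →ₗ[k] W} (hf : f ≠ 0)
    (hint : ∀ x, q x = 1 → ∀ v, f (P x v) = ρ (π x) (f v)) :
    ∃ (n : ℕ) (σ : Representation k Q (Fin n → k)), σ.IsIrreducible ∧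
      (∀ x : PReg r E, B.gch ρ (PReg.map π x) = B.gch P x * B.gch σ (PReg.map q x)) ∧
      ∀ (z : E) (a : k), π z = 1 → P z = a • 1 → σ (q z) = a⁻¹ • 1 := by
  obtain ⟨n, σ, hσ, ⟨e⟩⟩ := exists_tprod_equiv hq hP (R := (ρ.comp π : Representation k E W))
    ((isIrreducible_comp_iff hπ).2 hρ) hf hint
  refine ⟨n, σ, hσ, B.gch_mul_of_equiv e, fun z a hz ha => ?_⟩
  have hX := (isIrreducible_iff.1 hP).1
  have h1 := equiv_apply e z
  have h2 : (tprod P (σ.comp q : Representation k E (Fin n → k))) z = 1 := by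
    apply e.toLinearEquiv.conj.injective
    rw [h1]
    change ρ (π z) = _
    rw [hz, map_one]
    exact (LinearEquiv.conj_id _).symm
  let b := Module.finBasis k X
  let i : Fin (Module.finrank k X) := ⟨0, Module.finrank_pos⟩
  have h3 : ∀ y, a • σ (q z) y = y := by
    intro y
    have h4 := LinearMap.congr_fun h2 (b i ⊗ₜ y)
    rw [Representation.tprod_apply, TensorProduct.map_tmul, ha, LinearMap.smul_apply,
      Module.End.one_apply, Module.End.one_apply, TensorProduct.smul_tmul] at h4
    have h5 := congrArg (fun t => TensorProduct.equivFinsuppOfBasisLeft b t i) h4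
    simp only [TensorProduct.equivFinsuppOfBasisLeft_apply_tmul_apply, Module.Basis.repr_self,
      Finsupp.single_eq_same, one_smul] at h5
    exact h5
  have ha0 : a ≠ 0 := by
    rintro rfl
    have := (isIrreducible_iff.1 hσ).1
    obtain ⟨y, hy⟩ := exists_ne (0 : Fin n → k)
    exact hy (by rw [← h3 y, zero_smul])
  refine LinearMap.ext fun y => ?_
  rw [LinearMap.smul_apply, Module.End.one_apply, eq_inv_smul_iff₀ ha0, h3]

/-- Conversely, if the scalars of `σ` are inverse to those of `P` on the kernel of `π`, then `P ⊗ σ`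
descends to an irreducible representation of `U`. -/
theorem exists_irreducible_gch_mul' {P : Representation k E X} {π : E →* U} {q : E →* Q}
    (hπ : Function.Surjective π) (hq : Function.Surjective q)
    (hP : IsIrreducible (k := k) (P.comp q.ker.subtype))
    {σ : Representation k Q W} (hσ : σ.IsIrreducible)
    (hz : ∀ z, π z = 1 → ∃ a : k, P z = a • 1 ∧ σ (q z) = a⁻¹ • 1) :
    ∃ (n : ℕ) (ρ : Representation k U (Fin n → k)), ρ.IsIrreducible ∧
      ∀ x : PReg r E, B.gch ρ (PReg.map π x) = B.gch P x * B.gch σ (PReg.map q x) := by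
  have hX := (isIrreducible_iff.1 hP).1
  obtain ⟨ρ, hρ⟩ := exists_comp_eq_of_ker hπ (tprod P (σ.comp q : Representation k E W)) (by
    intro z hz1
    obtain ⟨a, h1, h2⟩ := hz z hz1
    have ha0 : a ≠ 0 := by
      rintro rfl
      obtain ⟨v, hv⟩ := exists_ne (0 : X)
      apply hv
      have h3 : P z⁻¹ (P z v) = v := by
        rw [← Module.End.mul_apply, ← map_mul, inv_mul_cancel, map_one]
        rfl
      rw [← h3, h1, zero_smul, LinearMap.zero_apply, map_zero]
    apply TensorProduct.ext'
    intro v w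
    rw [Representation.tprod_apply, TensorProduct.map_tmul, h1, MonoidHom.comp_apply, h2,
      LinearMap.smul_apply, LinearMap.smul_apply, TensorProduct.smul_tmul_smul,
      mul_inv_cancel₀ ha0, one_smul]
    rfl)
  have hirr : ρ.IsIrreducible := by
    rw [← isIrreducible_comp_iff hπ, hρ]
    refine isIrreducible_tprod hP ((isIrreducible_comp_iff hq).2 hσ) fun x hx => ?_
    rw [MonoidHom.comp_apply, (MonoidHom.mem_ker).1 hx, map_one]
  refine ⟨_, coordRep ρ, isIrreducible_of_equiv (coordRepEquiv ρ) hirr, fun x => ?_⟩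
  rw [← B.gch_equiv (coordRepEquiv ρ)]
  refine B.gch_mul_of_equiv (ρ := ρ) (σ := σ) ?_ x
  rw [hρ]
  exact Representation.Equiv.refl _

end Correspondence

end CharLift

/-! ### The correspondence through a common covering group -/

namespace CharLift

variable {r : ℕ} {k : Type*} [Field k] (B : CharLift r k) {G : Type*} [Group G]

/-- The lifted characters of `U` whose restriction to `N` is a multiple of `φ`. -/
def GChOver {N U : Subgroup G} (hU : N ≤ U) (φ : PReg r N → ℂ) : Set (PReg r U → ℂ) :=
  {η | B.IsGChar η ∧ ∃ e : ℕ, resReg hU η = e • φ}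

/-- The irreducible lifted characters of `U` over `φ`. -/
def GIrrOver {N U : Subgroup G} (hU : N ≤ U) (φ : PReg r N → ℂ) : Set (PReg r U → ℂ) :=
  {η | B.IsGIrr η ∧ ∃ ψ : PReg r N → ℂ, B.IsGChar ψ ∧ resReg hU η = φ + ψ}

theorem resReg_gch {K U : Subgroup G} (hU : K ≤ U) {W : Type*} [AddCommGroup W] [Module k W]
    [FiniteDimensional k W] (ρ : Representation k U W) :
    resReg hU (B.gch ρ) = B.gch (ρ.comp (Subgroup.inclusion hU) : Representation k K W) := rfl

theorem resReg_add {K U : Subgroup G} (hU : K ≤ U) (φ ψ : PReg r U → ℂ) :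
    resReg hU (φ + ψ) = resReg hU φ + resReg hU ψ := rfl

theorem isGChar_resReg {K U : Subgroup G} (hU : K ≤ U) {φ : PReg r U → ℂ} (h : B.IsGChar φ) :
    B.IsGChar (resReg hU φ) := by
  obtain ⟨n, ρ, rfl⟩ := h
  rw [resReg_gch]
  exact B.isGChar_gch _

theorem isGIrr_ne_zero_at_one {φ : PReg r G → ℂ} (h : B.IsGIrr φ) : φ ⟨1, by simp⟩ ≠ 0 := by
  obtain ⟨n, ρ, hρ, rfl⟩ := h
  have := (isIrreducible_iff.1 hρ).1
  rw [gch_one]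
  exact Nat.cast_ne_zero.2 Module.finrank_pos.ne'

variable [IsAlgClosed k] [Finite G]

/-- If a sum of characters is a multiple of an irreducible character `φ`, then so is each summand. -/
theorem exists_nsmul_of_multiset_sum {φ : PReg r G → ℂ} (hφ : B.IsGIrr φ)
    {s : Multiset (PReg r G → ℂ)} (hs : ∀ ψ ∈ s, B.IsGChar ψ) {e : ℕ} (h : s.sum = e • φ) :
    ∀ ψ ∈ s, ∃ a : ℕ, ψ = a • φ := by
  intro ψ hψ
  obtain ⟨t, rfl⟩ := Multiset.exists_cons_of_mem hψ
  obtain ⟨u, hu, rfl⟩ := IsGChar.exists_multiset B (hs ψ hψ)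
  obtain ⟨v, hv, hv'⟩ := IsGChar.exists_multiset B (IsGChar.multiset_sum B
    fun χ hχ => hs χ (Multiset.mem_cons_of_mem hχ) : B.IsGChar t.sum)
  have h1 : u + v = Multiset.replicate e φ := by
    refine B.eq_of_multiset_sum_eq (fun χ hχ => ?_) (fun χ hχ => ?_) ?_
    · rcases Multiset.mem_add.1 hχ with hχ | hχ
      · exact hu χ hχ
      · exact hv χ hχ
    · rw [Multiset.eq_of_mem_replicate hχ]
      exact hφ
    · rw [Multiset.sum_add, ← hv', Multiset.sum_replicate, ← h, Multiset.sum_cons]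
  have h2 : u = Multiset.replicate (Multiset.card u) φ :=
    Multiset.eq_replicate_card.2 fun χ hχ =>
      Multiset.eq_of_mem_replicate (h1 ▸ Multiset.mem_add.2 (Or.inl hχ))
  exact ⟨Multiset.card u, by rw [h2, Multiset.sum_replicate, Multiset.card_replicate]⟩

omit [IsAlgClosed k] [Finite G] in
theorem GIrrOver_subset {N U : Subgroup G} (hU : N ≤ U) {φ : PReg r N → ℂ} (hφ : B.IsGIrr φ)
    {η : PReg r U → ℂ} (hη : B.IsGIrr η) {a : ℕ} (h : resReg hU η = a • φ) :
    η ∈ B.GIrrOver hU φ := by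
  have ha : a ≠ 0 := by
    rintro rfl
    have h1 := congrFun h ⟨1, by simp⟩
    rw [zero_smul, Pi.zero_apply] at h1
    refine B.isGIrr_ne_zero_at_one hη ?_
    rw [← h1]
    change _ = η _
    congr 1
  obtain ⟨b, rfl⟩ := Nat.exists_eq_succ_of_ne_zero ha
  exact ⟨hη, b • φ, IsGChar.nsmul B (IsGIrr.isGChar B hφ) b, by rw [h, succ_nsmul, add_comm]⟩

/-- A character over `φ` is a sum of irreducible characters over `φ`. -/
theorem exists_multiset_of_mem_GChOver {N U : Subgroup G} (hU : N ≤ U) {φ : PReg r N → ℂ}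
    (hφ : B.IsGIrr φ) {η : PReg r U → ℂ} (hη : η ∈ B.GChOver hU φ) :
    ∃ s : Multiset (PReg r U → ℂ), (∀ χ ∈ s, χ ∈ B.GIrrOver hU φ) ∧ η = s.sum := by
  obtain ⟨h1, e, he⟩ := hη
  obtain ⟨s, hs, rfl⟩ := IsGChar.exists_multiset B h1
  have hsum : ∀ t : Multiset (PReg r U → ℂ), resReg hU t.sum = (t.map (resReg hU)).sum := by
    intro t
    induction t using Multiset.induction with
    | empty => rfl
    | cons a t ih => rw [Multiset.sum_cons, resReg_add, ih, Multiset.map_cons, Multiset.sum_cons]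
  refine ⟨s, fun χ hχ => ?_, rfl⟩
  obtain ⟨a, ha⟩ := B.exists_nsmul_of_multiset_sum hφ (s := s.map (resReg hU)) (fun ψ hψ => by
    obtain ⟨χ, hχ, rfl⟩ := Multiset.mem_map.1 hψ
    exact B.isGChar_resReg hU (IsGIrr.isGChar B (hs χ hχ))) (by rw [← hsum, he])
    (resReg hU χ) (Multiset.mem_map_of_mem _ hχ)
  exact B.GIrrOver_subset hU hφ (hs χ hχ) ha

end CharLift

/-- A group `E` covering both `G` (by `π`) and `Γ` (by `q`), in which `N` is lifted by `s` to the
kernel of `q`, and whose projections induce an isomorphism `τ : G ⧸ N ≃* Γ ⧸ M`. The subgroup `M` is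
the image under `q` of the kernel of `π`. -/
structure CommonCover {G Γ : Type*} (E : Type*) [Group G] [Group Γ] [Group E]
    (N : Subgroup G) [N.Normal] (M : Subgroup Γ) [M.Normal] where
  π : E →* G
  q : E →* Γ
  s : N →* E
  τ : G ⧸ N ≃* Γ ⧸ M
  π_surj : Function.Surjective π
  q_surj : Function.Surjective q
  π_s : ∀ n, π (s n) = n
  q_s : ∀ n, q (s n) = 1
  exists_s : ∀ x, q x = 1 → ∃ n, s n = x
  τ_mk : ∀ x, τ (QuotientGroup.mk' N (π x)) = QuotientGroup.mk' M (q x)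
  exists_ker : ∀ m ∈ M, ∃ z, π z = 1 ∧ q z = m

namespace CommonCover

variable {G Γ E : Type*} [Group G] [Group Γ] [Group E] {N : Subgroup G} [N.Normal] {M : Subgroup Γ}
  [M.Normal] (C : CommonCover E N M)

theorem q_mem_corr_iff {U : Subgroup G} (hU : N ≤ U) (x : E) :
    C.q x ∈ corr C.τ U ↔ C.π x ∈ U := by
  rw [corr, Subgroup.mem_comap, ← C.τ_mk]
  constructor
  · intro h
    obtain ⟨w, hw, h1⟩ := Subgroup.mem_map.1 h
    obtain ⟨u, hu, rfl⟩ := Subgroup.mem_map.1 hw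
    have h2 := C.τ.injective h1
    have h3 := QuotientGroup.eq.1 h2
    have h4 := U.mul_mem hu (hU h3)
    rwa [mul_inv_cancel_left] at h4
  · intro h
    exact Subgroup.mem_map_of_mem _ (Subgroup.mem_map_of_mem _ h)

/-- The preimage of `U` in the covering group, mapped to `U`. -/
def πOn (U : Subgroup G) : U.comap C.π →* U :=
  (C.π.comp (U.comap C.π).subtype).codRestrict U fun x => x.2

/-- The preimage of `U` in the covering group, mapped to the subgroup corresponding to `U`. -/
def qOn {U : Subgroup G} (hU : N ≤ U) : U.comap C.π →* corr C.τ U :=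
  (C.q.comp (U.comap C.π).subtype).codRestrict (corr C.τ U)
    fun x => (C.q_mem_corr_iff hU x.1).2 x.2

theorem πOn_surjective (U : Subgroup G) : Function.Surjective (C.πOn U) := by
  rintro ⟨u, hu⟩
  obtain ⟨x, rfl⟩ := C.π_surj u
  exact ⟨⟨x, hu⟩, rfl⟩

theorem qOn_surjective {U : Subgroup G} (hU : N ≤ U) : Function.Surjective (C.qOn hU) := by
  rintro ⟨v, hv⟩
  obtain ⟨x, rfl⟩ := C.q_surj v
  exact ⟨⟨x, (C.q_mem_corr_iff hU x).1 hv⟩, rfl⟩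

theorem s_conj (x : E) (n : N) : C.s (MulAut.conjNormal (C.π x) n) = x * C.s n * x⁻¹ := by
  obtain ⟨n', hn'⟩ := C.exists_s (x * C.s n * x⁻¹) (by
    rw [map_mul, map_mul, C.q_s, mul_one, map_inv, mul_inv_cancel])
  have h : n' = MulAut.conjNormal (C.π x) n := by
    apply Subtype.ext
    rw [← C.π_s n', hn', MulAut.conjNormal_apply, map_mul, map_mul, C.π_s, map_inv]
  rw [← h, hn']

theorem orderOf_s (n : N) : orderOf (C.s n) = orderOf n :=
  orderOf_injective C.s (fun a b h => Subtype.ext (by rw [← C.π_s a, h, C.π_s])) n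

section Transfer

variable {r : ℕ} {k : Type*} [Field k] [IsAlgClosed k] (B : CharLift r k)
  {X : Type*} [AddCommGroup X] [Module k X] [FiniteDimensional k X]
  [Finite G] [Finite Γ] [Finite E] {P : Representation k E X} {Ξ : Representation k M (Fin 1 → k)}

/-- The relation between a character `η` of `U` and the corresponding character `η'` of the
subgroup of `Γ` corresponding to `U`: on the covering group, `η` is the product of the character of
`P` and `η'`. -/
def Corresponds (P : Representation k E X) {U : Subgroup G} (hU : N ≤ U) (η : PReg r U → ℂ)
    (η' : PReg r (corr C.τ U) → ℂ) : Prop :=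
  ∀ x : PReg r (U.comap C.π), η (PReg.map (C.πOn U) x) =
    B.ltr (P x.1.1) * η' (PReg.map (C.qOn hU) x)

theorem isGIrr_rep_fin_one {H : Type*} [Group H] (σ : Representation k H (Fin 1 → k)) :
    σ.IsIrreducible := by
  rw [isIrreducible_iff]
  refine ⟨inferInstance, fun U _ => ?_⟩
  have h1 : Module.finrank k U ≤ 1 := by
    have := Submodule.finrank_le U
    rwa [Module.finrank_fin_fun] at this
  rcases Nat.le_one_iff_eq_zero_or_eq_one.1 h1 with h | h
  · exact Or.inl (Submodule.finrank_eq_zero.1 h)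
  · exact Or.inr (Submodule.eq_top_of_finrank_eq (by rw [h, Module.finrank_fin_fun]))

variable (hP : IsIrreducible (k := k) (P.comp C.s))
  (hz : ∀ z, C.π z = 1 → ∃ a : k, P z = a • 1)
  (hΞ : ∀ (z : E) (a : k) (m : M), C.π z = 1 → P z = a • 1 → C.q z = m → Ξ m = a⁻¹ • 1)

omit [IsAlgClosed k] [FiniteDimensional k X] [Finite G] [Finite Γ] [Finite E] in
include hP in
theorem isIrreducible_on_ker {U : Subgroup G} (hU : N ≤ U) :
    IsIrreducible (k := k)
      (MonoidHom.comp (MonoidHom.comp P (U.comap C.π).subtype) (C.qOn hU).ker.subtype) := by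
  -- `s` maps `N` onto the kernel of `qOn`
  let s' : N →* (C.qOn hU).ker :=
    (C.s.codRestrict (U.comap C.π) fun n => by
      rw [Subgroup.mem_comap, C.π_s]; exact hU n.2).codRestrict (C.qOn hU).ker fun n => by
        rw [MonoidHom.mem_ker]; exact Subtype.ext (C.q_s n)
  have hs' : Function.Surjective s' := by
    rintro ⟨⟨x, hx⟩, hx'⟩
    obtain ⟨n, rfl⟩ := C.exists_s x (congrArg Subtype.val (MonoidHom.mem_ker.1 hx'))
    exact ⟨n, rfl⟩
  exact (isIrreducible_comp_iff hs').1 hP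

omit [Finite Γ] in
include hP hz hΞ in
/-- Every irreducible character of `U` over that of `P` has a corresponding irreducible character. -/
theorem exists_corresponds {U : Subgroup G} (hU : N ≤ U) {η : PReg r U → ℂ}
    (hη : η ∈ B.GIrrOver hU (B.gch (P.comp C.s : Representation k N X))) :
    ∃ η' ∈ B.GIrrOver (le_corr C.τ U) (B.gch Ξ), η' ∈ B.GChOver (le_corr C.τ U) (B.gch Ξ) ∧
      C.Corresponds B P hU η η' := by
  obtain ⟨⟨m, ρ, hρ, rfl⟩, ψ, hψ, hres⟩ := hη
  obtain ⟨f, hf, hint⟩ := B.exists_intertwining_of_gch_eq_add hρ (Subgroup.inclusion hU)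
    (fun u => MulAut.conjNormal u.1) (fun u n => Subtype.ext (by simp)) hP (fun u n => by
      obtain ⟨x, hx⟩ := C.π_surj u.1
      change B.ltr (P (C.s (MulAut.conjNormal u.1 n.1))) = B.ltr (P (C.s n.1))
      rw [← hx, s_conj]
      let e : X ≃ₗ[k] X := LinearEquiv.ofLinearMap (P x) (P x⁻¹)
        (by rw [← Module.End.mul_eq_comp, ← map_mul, mul_inv_cancel, map_one]; rfl)
        (by rw [← Module.End.mul_eq_comp, ← map_mul, inv_mul_cancel, map_one]; rfl)
      rw [← B.ltr_conj e (P (C.s n.1)), map_mul, map_mul]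
      rfl) hψ hres
  obtain ⟨l, σ, hσ, hmul, hker⟩ := B.exists_irreducible_gch_mul
    (P := (P.comp (U.comap C.π).subtype : Representation k _ X)) (C.πOn_surjective U)
    (C.qOn_surjective hU) (C.isIrreducible_on_ker hP hU) hρ hf (fun x hx v => by
      obtain ⟨n, hn⟩ := C.exists_s x.1 (congrArg Subtype.val hx)
      have h1 := hint n v
      have h2 : Subgroup.inclusion hU n = C.πOn U x :=
        Subtype.ext (by change (n : G) = C.π x.1; rw [← hn, C.π_s])
      rw [← h2, ← h1]
      change f (P x.1 v) = f (P (C.s n) v)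
      rw [hn])
  suffices h : resReg (le_corr C.τ U) (B.gch σ) = l • B.gch Ξ from
    ⟨B.gch σ, B.GIrrOver_subset _ (B.isGIrr_gch (isGIrr_rep_fin_one Ξ)) (B.isGIrr_gch hσ) h,
      ⟨B.isGChar_gch σ, l, h⟩, hmul⟩
  funext m
  obtain ⟨z, hz1, hz2⟩ := C.exists_ker m.1.1 m.1.2
  obtain ⟨a, ha⟩ := hz z hz1
  have h1 := hker ⟨z, by rw [Subgroup.mem_comap, hz1]; exact U.one_mem⟩ a (Subtype.ext hz1) ha
  have h2 : C.qOn hU ⟨z, by rw [Subgroup.mem_comap, hz1]; exact U.one_mem⟩ =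
    Subgroup.inclusion (le_corr C.τ U) m.1 := Subtype.ext hz2
  rw [h2] at h1
  change B.ltr (σ (Subgroup.inclusion (le_corr C.τ U) m.1)) = l • B.ltr (Ξ m.1)
  rw [h1, hΞ z a m.1 hz1 ha hz2, B.ltr_smul_one, B.ltr_smul_one, Module.finrank_fin_fun,
    Module.finrank_fin_fun, nsmul_eq_mul, Nat.cast_one, one_mul]

omit [Finite G] in
include hP hz hΞ in
/-- Every irreducible character over that of `Ξ` corresponds to some irreducible character of `U`. -/
theorem exists_corresponds' (hM : M ≤ Subgroup.center Γ) {U : Subgroup G} (hU : N ≤ U)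
    {η' : PReg r (corr C.τ U) → ℂ}
    (hη : η' ∈ B.GIrrOver (le_corr C.τ U) (B.gch Ξ)) :
    ∃ η ∈ B.GIrrOver hU (B.gch (P.comp C.s : Representation k N X)),
      C.Corresponds B P hU η η' := by
  obtain ⟨⟨m, σ, hσ, rfl⟩, ψ, hψ, hres⟩ := hη
  have hcomm : ∀ (m : M) (v : corr C.τ U),
      v * Subgroup.inclusion (le_corr C.τ U) m = Subgroup.inclusion (le_corr C.τ U) m * v :=
    fun m v => Subtype.ext (Subgroup.mem_center_iff.1 (hM m.2) v.1)
  obtain ⟨f, hf, hint⟩ := B.exists_intertwining_of_gch_eq_add hσ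
    (Subgroup.inclusion (le_corr C.τ U)) (fun _ => MulEquiv.refl M)
    (fun v m => by rw [hcomm, mul_inv_cancel_right]; rfl) (isGIrr_rep_fin_one Ξ)
    (fun _ _ => rfl) hψ hres
  -- `M` is central, so the eigenspace of `σ` on which it acts through `Ξ` is a submodule
  have hscal : ∀ (z : E) (a : k), C.π z = 1 → P z = a • 1 → ∀ m : M, C.q z = m →
      σ (Subgroup.inclusion (le_corr C.τ U) m) = a⁻¹ • 1 := by
    intro z a hz1 ha m hm
    let S := LinearMap.ker (σ (Subgroup.inclusion (le_corr C.τ U) m) - a⁻¹ • 1)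
    have hS : S = ⊤ := by
      refine ((isIrreducible_iff.1 hσ).2 S fun v w hw => ?_).resolve_left fun hbot => hf ?_
      · rw [LinearMap.mem_ker, LinearMap.sub_apply, sub_eq_zero, LinearMap.smul_apply,
          Module.End.one_apply] at hw
        rw [Submodule.mem_comap, LinearMap.mem_ker, LinearMap.sub_apply, sub_eq_zero,
          ← Module.End.mul_apply, ← map_mul, ← hcomm, map_mul, Module.End.mul_apply, hw, map_smul]
        rfl
      · refine LinearMap.ext fun w => ?_
        have h1 : f w ∈ S := by
          rw [LinearMap.mem_ker, LinearMap.sub_apply, sub_eq_zero, ← hint, hΞ z a m hz1 ha hm,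
            LinearMap.smul_apply, LinearMap.smul_apply, map_smul]
          rfl
        rw [hbot] at h1
        exact (Submodule.mem_bot k).1 h1
    have h1 := LinearMap.ker_eq_top.1 hS
    exact sub_eq_zero.1 h1
  obtain ⟨l, ρ, hρ, hmul⟩ := B.exists_irreducible_gch_mul'
    (P := (P.comp (U.comap C.π).subtype : Representation k _ X)) (C.πOn_surjective U)
    (C.qOn_surjective hU) (C.isIrreducible_on_ker hP hU) hσ (fun z hz1 => by
      have hz2 : C.π z.1 = 1 := congrArg Subtype.val hz1
      obtain ⟨a, ha⟩ := hz z.1 hz2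
      have hqM : C.q z.1 ∈ M := by
        have h1 := C.τ_mk z.1
        rw [hz2, map_one, map_one] at h1
        exact (QuotientGroup.eq_one_iff _).1 h1.symm
      exact ⟨a, ha, hscal z.1 a hz2 ha ⟨_, hqM⟩ rfl⟩)
  refine ⟨B.gch ρ, B.GIrrOver_subset hU (B.isGIrr_gch hP) (B.isGIrr_gch hρ) (a := m) ?_, hmul⟩
  funext n
  have hn : C.s n.1 ∈ U.comap C.π := by rw [Subgroup.mem_comap, C.π_s]; exact hU n.1.2
  have h1 := hmul ⟨⟨C.s n.1, hn⟩, by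
    rw [← Subgroup.orderOf_coe]
    change r.Coprime (orderOf (C.s n.1))
    rw [orderOf_s]
    exact n.2⟩
  have h2 : PReg.map (C.πOn U) ⟨⟨C.s n.1, hn⟩, by
    rw [← Subgroup.orderOf_coe]
    change r.Coprime (orderOf (C.s n.1))
    rw [orderOf_s]
    exact n.2⟩ = PReg.map (Subgroup.inclusion hU) n :=
    Subtype.ext (Subtype.ext (C.π_s n.1))
  rw [h2] at h1
  refine h1.trans ?_
  have h3 : C.qOn hU ⟨C.s n.1, hn⟩ = 1 := Subtype.ext (C.q_s n.1)
  change B.ltr (P (C.s n.1)) * B.ltr (σ (C.qOn hU ⟨C.s n.1, hn⟩)) = m • B.ltr (P (C.s n.1))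
  rw [h3, map_one, B.ltr_one, Module.finrank_fin_fun, nsmul_eq_mul, mul_comm]

end Transfer

end CommonCover

/-! ### Transfer of characters along a section of the covering group -/

namespace CommonCover

variable {G Γ E : Type*} [Group G] [Group Γ] [Group E] {N : Subgroup G} [N.Normal] {M : Subgroup Γ}
  [M.Normal] (C : CommonCover E N M) {r : ℕ} {k : Type*} [Field k] (B : CharLift r k)
  {X : Type*} [AddCommGroup X] [Module k X] [FiniteDimensional k X]

open Classical in
/-- The function on the subgroup of `Γ` corresponding to `U` obtained from `η` by lifting an element
to the covering group along `c`, evaluating `η` at the image in `U`, and dividing by `t`. The value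
is `0` if that image is not an `r`-regular element of `U`, which does not happen if `N ≤ U` and `c` is
a section as in `IsTransferSection`. -/
noncomputable def transfer (r : ℕ) (c : Γ → E) (t : E → ℂ) (U : Subgroup G) (η : PReg r U → ℂ) :
    PReg r (corr C.τ U) → ℂ := fun v =>
  if h : C.π (c v.1.1) ∈ U ∧ r.Coprime (orderOf (C.π (c v.1.1))) then
    η ⟨⟨C.π (c v.1.1), h.1⟩, by rw [Subgroup.orderOf_mk]; exact h.2⟩ / t (c v.1.1)
  else 0

/-- `c` is a section of `E → Γ` that preserves `r`-regularity, and `t` is the lifted character of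
`P` on `r`-regular elements and does not vanish on the image of `c`. -/
structure IsTransferSection (P : Representation k E X) (c : Γ → E) (t : E → ℂ) : Prop where
  q_section : ∀ v, C.q (c v) = v
  ne_zero : ∀ v, t (c v) ≠ 0
  coprime : ∀ v, r.Coprime (orderOf v) → r.Coprime (orderOf (c v))
  ltr_eq : ∀ x, r.Coprime (orderOf x) → B.ltr (P x) = t x

variable {C B} {P : Representation k E X} {c : Γ → E} {t : E → ℂ}

namespace IsTransferSection

variable (hS : C.IsTransferSection B P c t) {U : Subgroup G} (hU : N ≤ U)

include hS

include hU in
theorem π_mem (v : corr C.τ U) : C.π (c v.1) ∈ U := by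
  rw [← C.q_mem_corr_iff hU, hS.q_section]
  exact v.2

theorem coprime_π (v : PReg r (corr C.τ U)) : r.Coprime (orderOf (C.π (c v.1.1))) :=
  Nat.Coprime.coprime_dvd_right (orderOf_map_dvd C.π _)
    (hS.coprime _ (by rw [Subgroup.orderOf_coe]; exact v.2))

theorem transfer_apply (η : PReg r U → ℂ) (v : PReg r (corr C.τ U)) :
    C.transfer r c t U η v = η ⟨⟨C.π (c v.1.1), hS.π_mem hU v.1⟩, by
      rw [Subgroup.orderOf_mk]; exact hS.coprime_π v⟩ / t (c v.1.1) :=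
  dif_pos ⟨hS.π_mem hU v.1, hS.coprime_π v⟩

theorem transfer_eq {η : PReg r U → ℂ} {η' : PReg r (corr C.τ U) → ℂ}
    (h : C.Corresponds B P hU η η') : C.transfer r c t U η = η' := by
  funext v
  have hc : r.Coprime (orderOf (c v.1.1)) := hS.coprime _ (by rw [Subgroup.orderOf_coe]; exact v.2)
  have hm : c v.1.1 ∈ U.comap C.π := hS.π_mem hU v.1
  have hc' : r.Coprime (orderOf (⟨c v.1.1, hm⟩ : U.comap C.π)) := by
    rw [Subgroup.orderOf_mk]
    exact hc
  have h1 := h ⟨⟨c v.1.1, hm⟩, hc'⟩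
  have h2 : PReg.map (C.qOn hU) ⟨⟨c v.1.1, hm⟩, hc'⟩ = v :=
    Subtype.ext (Subtype.ext (hS.q_section v.1.1))
  rw [h2, hS.ltr_eq _ hc] at h1
  rw [hS.transfer_apply hU, div_eq_iff (hS.ne_zero _), mul_comm, ← h1]
  rfl

end IsTransferSection

theorem Corresponds.add {U : Subgroup G} {hU : N ≤ U} {η₁ η₂ : PReg r U → ℂ}
    {η₁' η₂' : PReg r (corr C.τ U) → ℂ} (h₁ : C.Corresponds B P hU η₁ η₁')
    (h₂ : C.Corresponds B P hU η₂ η₂') : C.Corresponds B P hU (η₁ + η₂) (η₁' + η₂') := fun x => by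
  rw [Pi.add_apply, Pi.add_apply, h₁, h₂, mul_add]

theorem Corresponds.res {K U : Subgroup G} {hU : N ≤ U} {η : PReg r U → ℂ}
    {η' : PReg r (corr C.τ U) → ℂ} (h : C.Corresponds B P hU η η') (hK : N ≤ K) (hKU : K ≤ U) :
    C.Corresponds B P hK (resReg hKU η) (resReg (corr_mono C.τ hKU) η') := fun x =>
  h (PReg.map (Subgroup.inclusion (Subgroup.comap_mono (f := C.π) hKU)) x)

theorem toQuot_πOn {U : Subgroup G} (hU : N ≤ U) (x : U.comap C.π) :
    toQuot N U (C.πOn U x) = corrToQuot C.τ U (C.qOn hU x) := by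
  apply Subtype.ext
  change QuotientGroup.mk' N (C.π x.1) = C.τ.symm (QuotientGroup.mk' M (C.q x.1))
  rw [← C.τ_mk, MulEquiv.symm_apply_apply]

theorem Corresponds.mul {U : Subgroup G} {hU : N ≤ U} {η : PReg r U → ℂ}
    {η' : PReg r (corr C.τ U) → ℂ} (h : C.Corresponds B P hU η η')
    (β : PReg r (U.map (QuotientGroup.mk' N)) → ℂ) :
    C.Corresponds B P hU (η * (β ∘ PReg.map (toQuot N U)))
      (η' * (β ∘ PReg.map (corrToQuot C.τ U))) := fun x => by
  rw [Pi.mul_apply, Pi.mul_apply, h, mul_assoc]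
  have h1 : PReg.map (toQuot N U) (PReg.map (C.πOn U) x) =
      PReg.map (corrToQuot C.τ U) (PReg.map (C.qOn hU) x) := Subtype.ext (toQuot_πOn hU x.1)
  rw [Function.comp_apply, Function.comp_apply, h1]

/-- A character of `U` is determined by a corresponding character, since every `r`-regular element of
`U` lifts to an `r`-regular element of the covering group. -/
theorem Corresponds.left_unique [Finite E] (hr : r = 1 ∨ r.Prime) {U : Subgroup G}
    {hU : N ≤ U} {η₁ η₂ : PReg r U → ℂ}
    {η' : PReg r (corr C.τ U) → ℂ} (h₁ : C.Corresponds B P hU η₁ η')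
    (h₂ : C.Corresponds B P hU η₂ η') : η₁ = η₂ := by
  funext u
  obtain ⟨x, hx⟩ := C.πOn_surjective U u.1
  -- the `r`-regular part of a preimage of `u` is again a preimage of `u`
  have hx1 : x ^ Nat.card (U.comap C.π) = 1 := pow_card_eq_one'
  have hu : u = PReg.map (C.πOn U) ⟨x ^ regExp r (Nat.card (U.comap C.π)),
      coprime_orderOf_pow_regExp hr Nat.card_pos.ne' hx1⟩ := by
    refine Subtype.ext ?_
    change u.1 = C.πOn U (x ^ regExp r (Nat.card (U.comap C.π)))
    rw [map_pow, hx, pow_regExp_eq_self _ u.2]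
    rw [← hx, ← map_pow, hx1, map_one]
  rw [hu, h₁, h₂]

variable [IsAlgClosed k] [Finite G] [Finite E]
  {Ξ : Representation k M (Fin 1 → k)}

/-- The representation `P` of the common cover restricts irreducibly to `N`, it is scalar on the
kernel of `E → G`, and these scalars are inverse to the linear character of `M` afforded by `Ξ`. -/
structure IsCompatible (C : CommonCover E N M) (P : Representation k E X)
    (Ξ : Representation k M (Fin 1 → k)) : Prop where
  irr : IsIrreducible (k := k) (P.comp C.s)
  scalar : ∀ z, C.π z = 1 → ∃ a : k, P z = a • 1
  eq_inv : ∀ (z : E) (a : k) (m : M), C.π z = 1 → P z = a • 1 → C.q z = m → Ξ m = a⁻¹ • 1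
  le_center : M ≤ Subgroup.center Γ

namespace IsTransferSection

variable (hS : C.IsTransferSection B P c t) (hC : C.IsCompatible P Ξ) {U : Subgroup G} (hU : N ≤ U)

include hS hC

theorem transfer_bijOn [Finite Γ] : Set.BijOn (C.transfer r c t U)
    (B.GIrrOver hU (B.gch (P.comp C.s : Representation k N X)))
    (B.GIrrOver (le_corr C.τ U) (B.gch Ξ)) := by
  refine ⟨fun η hη => ?_, fun η₁ h₁ η₂ h₂ h => ?_, fun η' hη' => ?_⟩
  · obtain ⟨η', hη', -, h⟩ := C.exists_corresponds B hC.irr hC.scalar hC.eq_inv hU hη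
    rwa [hS.transfer_eq hU h]
  · obtain ⟨η₁', -, -, h₁'⟩ := C.exists_corresponds B hC.irr hC.scalar hC.eq_inv hU h₁
    obtain ⟨η₂', -, -, h₂'⟩ := C.exists_corresponds B hC.irr hC.scalar hC.eq_inv hU h₂
    rw [hS.transfer_eq hU h₁', hS.transfer_eq hU h₂'] at h
    subst h
    exact h₁'.left_unique B.eq_one_or_prime h₂'
  · obtain ⟨η, hη, h⟩ := C.exists_corresponds' B hC.irr hC.scalar hC.eq_inv hC.le_center hU hη'
    exact ⟨η, hη, hS.transfer_eq hU h⟩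

theorem corresponds_transfer {η : PReg r U → ℂ}
    (hη : η ∈ B.GChOver hU (B.gch (P.comp C.s : Representation k N X))) :
    C.Corresponds B P hU η (C.transfer r c t U η) ∧
      C.transfer r c t U η ∈ B.GChOver (le_corr C.τ U) (B.gch Ξ) := by
  suffices h : ∃ η' ∈ B.GChOver (le_corr C.τ U) (B.gch Ξ), C.Corresponds B P hU η η' by
    obtain ⟨η', h1, h2⟩ := h
    rw [hS.transfer_eq hU h2]
    exact ⟨h2, h1⟩
  obtain ⟨s, hs, rfl⟩ := B.exists_multiset_of_mem_GChOver hU (B.isGIrr_gch hC.irr) hη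
  clear hη
  induction s using Multiset.induction with
  | empty =>
    refine ⟨0, ⟨CharLift.IsGChar.zero B, 0, ?_⟩, fun x => ?_⟩
    · rw [zero_smul]
      rfl
    · rw [Multiset.sum_zero, Pi.zero_apply, Pi.zero_apply, mul_zero]
  | cons η s ih =>
    obtain ⟨η₁, h₁, h₁'⟩ := ih fun χ hχ => hs χ (Multiset.mem_cons_of_mem hχ)
    obtain ⟨η₂, -, h₂, h₂'⟩ := C.exists_corresponds B hC.irr hC.scalar hC.eq_inv hU
      (hs η (Multiset.mem_cons_self η s))
    rw [Multiset.sum_cons]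
    refine ⟨η₂ + η₁, ⟨CharLift.IsGChar.add B h₂.1 h₁.1, ?_⟩, h₂'.add h₁'⟩
    obtain ⟨a, ha⟩ := h₁.2
    obtain ⟨b, hb⟩ := h₂.2
    exact ⟨b + a, by rw [CharLift.resReg_add, ha, hb, add_smul]⟩

theorem transfer_add {η₁ η₂ : PReg r U → ℂ}
    (h₁ : η₁ ∈ B.GChOver hU (B.gch (P.comp C.s : Representation k N X)))
    (h₂ : η₂ ∈ B.GChOver hU (B.gch (P.comp C.s : Representation k N X))) :
    C.transfer r c t U (η₁ + η₂) = C.transfer r c t U η₁ + C.transfer r c t U η₂ :=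
  hS.transfer_eq hU ((hS.corresponds_transfer hC hU h₁).1.add (hS.corresponds_transfer hC hU h₂).1)

theorem transfer_res {K : Subgroup G} (hK : N ≤ K) (hKU : K ≤ U) {η : PReg r U → ℂ}
    (h : η ∈ B.GChOver hU (B.gch (P.comp C.s : Representation k N X))) :
    C.transfer r c t K (resReg hKU η) = resReg (corr_mono C.τ hKU) (C.transfer r c t U η) :=
  hS.transfer_eq hK ((hS.corresponds_transfer hC hU h).1.res hK hKU)

theorem transfer_mul {η : PReg r U → ℂ}
    (h : η ∈ B.GChOver hU (B.gch (P.comp C.s : Representation k N X)))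
    (β : PReg r (U.map (QuotientGroup.mk' N)) → ℂ) :
    C.transfer r c t U (η * (β ∘ PReg.map (toQuot N U))) =
      C.transfer r c t U η * (β ∘ PReg.map (corrToQuot C.τ U)) :=
  hS.transfer_eq hU ((hS.corresponds_transfer hC hU h).1.mul β)

end IsTransferSection

end CommonCover

/-! ### Ordinary characters and Brauer characters as lifted characters -/

/-- The lifting data for ordinary characters. -/
noncomputable def complexLift : CharLift 1 ℂ where
  char_cond := Or.inl ⟨rfl, inferInstance⟩
  red := algebraMap AlgInt ℂ
  lift := id
  lift_red _ _ _ _ _ := rfl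

theorem complexLift_ltr {V : Type*} [AddCommGroup V] [Module ℂ V] [FiniteDimensional ℂ V]
    (T : V →ₗ[ℂ] V) : complexLift.ltr T = LinearMap.trace ℂ V T := by
  rw [Module.End.trace_eq_sum_roots_charpoly_of_splits (IsAlgClosed.splits _), CharLift.ltr]
  exact congrArg Multiset.sum (Multiset.map_id _)

/-- Restricting to `1`-regular elements loses nothing, because every element is `1`-regular. -/
theorem reg_one_injective {H : Type*} [Group H] :
    Function.Injective (reg 1 : (H → ℂ) → PReg 1 H → ℂ) := fun _ _ h =>
  funext fun x => congrFun h ⟨x, Nat.coprime_one_left _⟩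

theorem reg_one_surjective {H : Type*} [Group H] :
    Function.Surjective (reg 1 : (H → ℂ) → PReg 1 H → ℂ) := fun η =>
  ⟨fun x => η ⟨x, Nat.coprime_one_left _⟩, rfl⟩

theorem reg_one_character {H : Type*} [Group H] {V : Type*} [AddCommGroup V] [Module ℂ V]
    [FiniteDimensional ℂ V] (ρ : Representation ℂ H V) :
    reg 1 ρ.character = complexLift.gch ρ :=
  funext fun _ => (complexLift_ltr _).symm

theorem isGChar_reg_one {H : Type*} [Group H] {χ : H → ℂ} :
    complexLift.IsGChar (reg 1 χ) ↔ IsChar χ := by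
  refine exists₂_congr fun n ρ => ?_
  rw [← reg_one_character, reg_one_injective.eq_iff]

theorem isGIrr_reg_one {H : Type*} [Group H] {χ : H → ℂ} :
    complexLift.IsGIrr (reg 1 χ) ↔ IsIrr χ := by
  refine exists₂_congr fun n ρ => ?_
  rw [← reg_one_character, reg_one_injective.eq_iff]

theorem reg_one_mem_GChOver {G : Type*} [Group G] {N U : Subgroup G} {hU : N ≤ U} {θ : N → ℂ}
    {χ : U → ℂ} : reg 1 χ ∈ complexLift.GChOver hU (reg 1 θ) ↔ χ ∈ ChOver hU θ := by
  refine and_congr isGChar_reg_one (exists_congr fun e => ?_)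
  change reg 1 (res hU χ) = reg 1 (e • θ) ↔ _
  rw [reg_one_injective.eq_iff]

theorem reg_one_mem_GIrrOver {G : Type*} [Group G] {N U : Subgroup G} {hU : N ≤ U} {θ : N → ℂ}
    {χ : U → ℂ} : reg 1 χ ∈ complexLift.GIrrOver hU (reg 1 θ) ↔ χ ∈ IrrOver hU θ := by
  refine and_congr isGIrr_reg_one ?_
  rw [reg_one_surjective.exists]
  refine exists_congr fun ψ => and_congr isGChar_reg_one ?_
  change reg 1 (res hU χ) = reg 1 (θ + ψ) ↔ _
  rw [reg_one_injective.eq_iff]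

section Modular

variable {p : ℕ} {𝔪 : Ideal AlgInt} [𝔪.IsMaximal]

theorem charP_residueField (hp : p.Prime) (h𝔪 : (p : AlgInt) ∈ 𝔪) : CharP (AlgInt ⧸ 𝔪) p := by
  refine (CharP.charP_iff_prime_eq_zero hp).2 ?_
  rw [← map_natCast (Ideal.Quotient.mk 𝔪)]
  exact Ideal.Quotient.eq_zero_iff_mem.2 h𝔪

instance isAlgClosed_residueField : IsAlgClosed (AlgInt ⧸ 𝔪) := by
  refine IsAlgClosed.of_exists_root _ fun f hf hirr => ?_
  obtain ⟨g, hg, hdeg, hmon⟩ := Polynomial.lifts_and_natDegree_eq_and_monic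
    ((Polynomial.mem_lifts _).2 (Polynomial.map_surjective _ Ideal.Quotient.mk_surjective f) :
      f ∈ Polynomial.lifts (Ideal.Quotient.mk 𝔪)) hf
  obtain ⟨z, hz⟩ := IsAlgClosed.exists_aeval_eq_zero_of_injective ℂ
    (FaithfulSMul.algebraMap_injective AlgInt ℂ) g (by
      rw [Polynomial.degree_eq_natDegree hmon.ne_zero, hdeg]
      exact_mod_cast hirr.natDegree_pos.ne')
  have hint : IsIntegral ℤ z := isIntegral_trans (R := ℤ) (A := AlgInt) z ⟨g, hmon, hz⟩
  refine ⟨Ideal.Quotient.mk 𝔪 ⟨z, hint⟩, ?_⟩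
  rw [← hg, Polynomial.eval_map, Polynomial.eval₂_hom]
  have h : g.eval (⟨z, hint⟩ : AlgInt) = 0 := by
    apply Subtype.val_injective
    have h1 := Polynomial.aeval_algebraMap_apply ℂ (⟨z, hint⟩ : AlgInt) g
    rw [Polynomial.coe_aeval_eq_eval] at h1
    exact h1.symm.trans hz
  rw [h, map_zero]

/-- Reduction modulo `𝔪` is injective on roots of unity of order prime to `p`. -/
theorem eq_of_mk_eq (hp : p.Prime) (h𝔪 : (p : AlgInt) ∈ 𝔪) {z w : AlgInt} {n : ℕ}
    (hn : p.Coprime n) (hz : z ^ n = 1) (hw : w ^ n = 1)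
    (h : Ideal.Quotient.mk 𝔪 z = Ideal.Quotient.mk 𝔪 w) : z = w := by
  have hn0 : n ≠ 0 := by
    rintro rfl
    exact hp.ne_one (Nat.coprime_zero_right p |>.1 hn)
  obtain ⟨j, rfl⟩ := Nat.exists_eq_succ_of_ne_zero hn0
  by_contra hne
  -- `u = z / w` is a root of unity different from `1` that reduces to `1`
  have hu1 : z * w ^ j ≠ 1 := fun hu => hne (by
    calc z = z * w ^ (j + 1) := by rw [hw, mul_one]
      _ = w := by rw [pow_succ, ← mul_assoc, hu, one_mul])
  have hu2 : (z * w ^ j) ^ (j + 1) = 1 := by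
    rw [mul_pow, hz, ← pow_mul, mul_comm j, pow_mul, hw, one_pow, mul_one]
  have hgeom := mul_geom_sum (z * w ^ j) (j + 1)
  rw [hu2, sub_self] at hgeom
  have hsum := (mul_eq_zero.1 hgeom).resolve_left (sub_ne_zero.2 hu1)
  have hred := congrArg (Ideal.Quotient.mk 𝔪) hsum
  have hu3 : Ideal.Quotient.mk 𝔪 (z * w ^ j) = 1 := by
    rw [map_mul, h, ← map_mul, ← pow_succ', hw, map_one]
  rw [map_sum, map_zero] at hred
  simp only [map_pow, hu3, one_pow, Finset.sum_const, Finset.card_range, nsmul_one] at hred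
  have := charP_residueField hp h𝔪
  exact hp.ne_one (Nat.Coprime.eq_one_of_dvd hn ((CharP.cast_eq_zero_iff (AlgInt ⧸ 𝔪) p _).1 hred))

variable (p 𝔪) in
/-- The lifting data for Brauer characters. -/
noncomputable def modularLift (hp : p.Prime) (h𝔪 : (p : AlgInt) ∈ 𝔪) :
    CharLift p (AlgInt ⧸ 𝔪) where
  char_cond := Or.inr ⟨hp, charP_residueField hp h𝔪⟩
  red := Ideal.Quotient.mk 𝔪
  lift := rootLift p 𝔪
  lift_red z m _ hr hz := by
    have h : ∃ ζ : AlgInt, (∃ k : ℕ, p.Coprime k ∧ ζ ^ k = 1) ∧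
      Ideal.Quotient.mk 𝔪 ζ = Ideal.Quotient.mk 𝔪 z := ⟨z, ⟨m, hr, hz⟩, rfl⟩
    rw [rootLift, dif_pos h]
    obtain ⟨⟨n, hn, hn'⟩, h'⟩ := h.choose_spec
    exact congrArg _ (eq_of_mk_eq hp h𝔪 (hr.mul_right hn) (by
      rw [mul_comm, pow_mul, hn', one_pow]) (by rw [pow_mul, hz, one_pow]) h')

end Modular

/-! ### Reduction modulo `𝔪` -/

/-- A finite group of linear maps stabilizes a lattice over a valuation ring: in a suitable basis, all
matrix entries lie in the valuation ring. -/
theorem exists_basis_toMatrix_mem {K H V : Type*} [Field K] [Group H] [Finite H] [AddCommGroup V]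
    [Module K V] [FiniteDimensional K V] (O : ValuationSubring K) (ρ : Representation K H V)
    {d : ℕ} (hd : Module.finrank K V = d) :
    ∃ b : Module.Basis (Fin d) K V, ∀ h i j, LinearMap.toMatrix b b (ρ h) i j ∈ O := by
  classical
  let e := Module.finBasis K V
  let S : Set V := Set.range fun x : H × Fin (Module.finrank K V) => ρ x.1 (e x.2)
  let Λ : Submodule O V := Submodule.span O S
  have hstab : ∀ h, ∀ v ∈ Λ, ρ h v ∈ Λ := by
    intro h v hv
    induction hv using Submodule.span_induction with
    | mem v hv =>
      obtain ⟨⟨g, i⟩, rfl⟩ := hv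
      refine Submodule.subset_span ⟨(h * g, i), ?_⟩
      change ρ (h * g) (e i) = ρ h (ρ g (e i))
      rw [map_mul, Module.End.mul_apply]
    | zero => rw [map_zero]; exact Λ.zero_mem
    | add v w _ _ hv hw => rw [map_add]; exact Λ.add_mem hv hw
    | smul a v _ hv =>
      have : ρ h (a • v) = a • ρ h v := (ρ h).map_smul (a : K) v
      rw [this]
      exact Λ.smul_mem a hv
  have hfin : Module.Finite O Λ := Module.Finite.span_of_finite O (Set.finite_range _)
  have htor : Submodule.torsion O Λ = ⊥ := by
    refine (Submodule.eq_bot_iff _).2 fun v hv => ?_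
    obtain ⟨a, ha⟩ := (Submodule.mem_torsion_iff v).1 hv
    have h1 : (a.1 : K) • (v : V) = 0 := congrArg Subtype.val ha
    refine Subtype.ext ((smul_eq_zero.1 h1).resolve_left fun h2 => ?_)
    exact nonZeroDivisors.coe_ne_zero a (Subtype.ext h2)
  have hflat : Module.Flat O Λ := Module.Flat.flat_iff_torsion_eq_bot_of_isBezout.2 htor
  have hfree : Module.Free O Λ := Module.free_of_flat_of_isLocalRing
  let b₀ := Module.Free.chooseBasis O Λ
  have hli : LinearIndependent K fun i => (b₀ i : V) :=
    (LinearIndependent.iff_fractionRing O K).1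
      (b₀.linearIndependent.map' Λ.subtype (Submodule.ker_subtype Λ))
  have hΛ : ∀ (v : V) (hv : v ∈ Λ), v = ∑ i, b₀.repr ⟨v, hv⟩ i • (b₀ i : V) := by
    intro v hv
    have h1 := congrArg Subtype.val (b₀.sum_repr ⟨v, hv⟩)
    refine h1.symm.trans ?_
    rw [AddSubmonoidClass.coe_finsetSum]
    rfl
  have hsp : ⊤ ≤ Submodule.span K (Set.range fun i => (b₀ i : V)) := by
    rw [← e.span_eq, Submodule.span_le]
    rintro _ ⟨i, rfl⟩
    have h1 : e i ∈ Λ := Submodule.subset_span ⟨(1, i), by simp⟩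
    rw [SetLike.mem_coe, hΛ _ h1]
    exact Submodule.sum_mem _ fun j _ =>
      Submodule.smul_mem _ (_ : K) (Submodule.subset_span ⟨j, rfl⟩)
  let b := Module.Basis.mk hli hsp
  let eq : Module.Free.ChooseBasisIndex O Λ ≃ Fin d :=
    Fintype.equivFinOfCardEq (by rw [← Module.finrank_eq_card_basis b, hd])
  refine ⟨b.reindex eq, fun h i j => ?_⟩
  rw [LinearMap.toMatrix_apply, Module.Basis.reindex_apply, Module.Basis.repr_reindex_apply]
  have h1 : b (eq.symm j) = (b₀ (eq.symm j) : V) := Module.Basis.mk_apply hli hsp _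
  have h2 := hstab h _ (b₀ (eq.symm j)).2
  rw [h1, hΛ _ h2]
  have h3 : ∀ l, (b₀ l : V) = b l := fun l => (Module.Basis.mk_apply hli hsp _).symm
  have h4 : (∑ l, b₀.repr ⟨_, h2⟩ l • (b₀ l : V)) = ∑ l, ((b₀.repr ⟨_, h2⟩ l : O) : K) • b l :=
    Finset.sum_congr rfl fun l _ => by rw [← h3]; rfl
  rw [h4, b.repr_sum_self]
  exact SetLike.coe_mem _

variable {𝔪 : Ideal AlgInt} [𝔪.IsMaximal]

/-- There is a valuation ring of `ℂ` whose maximal ideal lies over `𝔪`. -/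
theorem exists_valuationSubring (𝔪 : Ideal AlgInt) [h𝔪 : 𝔪.IsMaximal] :
    ∃ O : ValuationSubring ℂ, (∀ z : AlgInt, (z : ℂ) ∈ O) ∧ ∀ z ∈ 𝔪, (z : ℂ) ∈ O.nonunits := by
  let I : Ideal (integralClosure ℤ ℂ).toSubring := 𝔪
  obtain ⟨O, h1, h2⟩ := Ideal.image_subset_nonunits_valuationSubring I h𝔪.ne_top
  exact ⟨O, fun z => h1 z.2, fun z hz => h2 ⟨z, hz, rfl⟩⟩

/-- A homomorphism onto an algebraically closed field extends to a finitely generated algebra, if its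
kernel does not generate the unit ideal there: by the Nullstellensatz, a residue field of the algebra
over that kernel is no larger than the given field. -/
theorem exists_ringHom_of_finiteType {R F A : Type*} [CommRing R] [Field F] [IsAlgClosed F]
    [CommRing A] [Algebra R A] [Algebra.FiniteType R A] {f : R →+* F}
    (hf : Function.Surjective f) (h : (RingHom.ker f).map (algebraMap R A) ≠ ⊤) :
    ∃ φ : A →+* F, ∀ z, φ (algebraMap R A z) = f z := by
  obtain ⟨n, hn, hle⟩ := Ideal.exists_le_maximal _ h
  obtain ⟨K, _, g, hg, hgn⟩ : ∃ (K : Type _) (_ : Field K) (g : A →+* K),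
      Function.Surjective g ∧ RingHom.ker g = n :=
    ⟨A ⧸ n, Ideal.Quotient.field n, Ideal.Quotient.mk n, Ideal.Quotient.mk_surjective,
      Ideal.mk_ker⟩
  let := f.toAlgebra
  let := (g.comp (algebraMap R A)).toAlgebra
  have hker : RingHom.ker f ≤ RingHom.ker (g.comp (algebraMap R A)) := fun z hz => by
    rw [RingHom.mem_ker, RingHom.comp_apply, ← RingHom.mem_ker, hgn]
    exact hle (Ideal.mem_map_of_mem _ hz)
  let j : F →+* K := f.liftOfSurjective hf ⟨g.comp (algebraMap R A), hker⟩
  have hj : ∀ z, j (f z) = g (algebraMap R A z) := fun z =>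
    f.liftOfRightInverse_comp_apply _ (Function.rightInverse_surjInv hf) ⟨_, hker⟩ z
  let := j.toAlgebra
  have : IsScalarTower R F K := IsScalarTower.of_algebraMap_eq fun z => (hj z).symm
  let g' : A →ₐ[R] K := { g with commutes' := fun _ => rfl }
  have : Algebra.FiniteType R K := Algebra.FiniteType.of_surjective g' hg
  have : Algebra.FiniteType F K := Algebra.FiniteType.of_restrictScalars_finiteType R _ _
  have : Module.Finite F K := finite_of_finite_type_of_isJacobsonRing _ _
  let e := RingEquiv.ofBijective j (IsAlgClosed.algebraMap_bijective_of_isIntegral (k := F) (K := K))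
  refine ⟨e.symm.toRingHom.comp g, fun z => ?_⟩
  exact (e.symm_apply_eq).2 (hj z).symm

/-- Reduction modulo `𝔪` extends to a finitely generated algebra over the algebraic integers that is
contained in a valuation ring lying over `𝔪`. -/
theorem exists_algHom_residueField {O : ValuationSubring ℂ}
    (hO : ∀ z ∈ 𝔪, (z : ℂ) ∈ O.nonunits) {A : Subalgebra AlgInt ℂ} (hA : A.FG)
    (hAO : ∀ x ∈ A, x ∈ O) :
    ∃ φ : A →+* AlgInt ⧸ 𝔪, ∀ z, φ (algebraMap AlgInt A z) = Ideal.Quotient.mk 𝔪 z := by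
  have h1 : 𝔪.map (algebraMap AlgInt A) ≠ ⊤ := by
    intro htop
    let ι : A →+* O := A.toSubring.subtype.codRestrict O.toSubring fun x => hAO x.1 x.2
    have h2 : 𝔪.map (algebraMap AlgInt A) ≤ (IsLocalRing.maximalIdeal O).comap ι := by
      refine Ideal.map_le_iff_le_comap.2 fun z hz => ?_
      rw [Ideal.mem_comap, Ideal.mem_comap]
      exact (ValuationSubring.mem_nonunits_iff_exists_mem_maximalIdeal.1 (hO z hz)).choose_spec
    rw [htop] at h2
    exact (Ideal.comap_ne_top ι (IsLocalRing.maximalIdeal.isMaximal O).ne_top) (top_le_iff.1 h2)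
  have : Algebra.FiniteType AlgInt A := A.fg_iff_finiteType.1 hA
  exact exists_ringHom_of_finiteType Ideal.Quotient.mk_surjective (by rwa [Ideal.mk_ker])

/-- A complex representation of a finite group is realized over a ring to which reduction modulo `𝔪`
extends. -/
theorem exists_integral_form (𝔪 : Ideal AlgInt) [𝔪.IsMaximal] {H : Type*} [Group H] [Finite H]
    {d : ℕ} (ρ : Representation ℂ H (Fin d → ℂ)) :
    ∃ (A : Subalgebra AlgInt ℂ) (φ : A →+* AlgInt ⧸ 𝔪) (R : H →* Matrix (Fin d) (Fin d) A)
      (b : Module.Basis (Fin d) ℂ (Fin d → ℂ)),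
      (∀ z, φ (algebraMap AlgInt A z) = Ideal.Quotient.mk 𝔪 z) ∧
      ∀ h, LinearMap.toMatrix b b (ρ h) = (R h).map (algebraMap A ℂ) := by
  obtain ⟨O, hO1, hO2⟩ := exists_valuationSubring 𝔪
  obtain ⟨b, hb⟩ := exists_basis_toMatrix_mem O ρ (Module.finrank_fin_fun ℂ)
  let S : Set ℂ := Set.range fun x : H × Fin d × Fin d => LinearMap.toMatrix b b (ρ x.1) x.2.1 x.2.2
  have hS : S.Finite := Set.finite_range _
  let A : Subalgebra AlgInt ℂ := Algebra.adjoin AlgInt S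
  have hAO : ∀ x ∈ A, x ∈ O := fun x hx => by
    induction hx using Algebra.adjoin_induction with
    | mem x hx =>
      obtain ⟨y, rfl⟩ := hx
      exact hb _ _ _
    | algebraMap z => exact hO1 z
    | add x y _ _ hx hy => exact add_mem hx hy
    | mul x y _ _ hx hy => exact mul_mem hx hy
  obtain ⟨φ, hφ⟩ := exists_algHom_residueField hO2 (A := A)
    (Subalgebra.fg_def.2 ⟨S, hS, rfl⟩) hAO
  have hinj : Function.Injective
      (fun T : Matrix (Fin d) (Fin d) A => T.map (algebraMap A ℂ)) :=
    Matrix.map_injective Subtype.val_injective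
  let R₀ : H → Matrix (Fin d) (Fin d) A := fun h => Matrix.of fun i j =>
    ⟨LinearMap.toMatrix b b (ρ h) i j, Algebra.subset_adjoin ⟨(h, i, j), rfl⟩⟩
  have hR₀ : ∀ h, (R₀ h).map (algebraMap A ℂ) = LinearMap.toMatrix b b (ρ h) := fun h => rfl
  refine ⟨A, φ, { toFun := R₀, map_one' := hinj ?_, map_mul' := fun g h => hinj ?_ }, b, hφ,
    fun h => rfl⟩
  · beta_reduce
    rw [hR₀, map_one, LinearMap.toMatrix_one, Matrix.map_one _ (map_zero _) (map_one _)]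
  · beta_reduce
    rw [Matrix.map_mul, hR₀, hR₀, hR₀, map_mul, LinearMap.toMatrix_mul]

/-- Reduction modulo `𝔪` of a complex representation `ρ`: the Brauer character of the reduction is the
restriction of the character of `ρ` to `p`-regular elements, and scalars are reduced modulo `𝔪`. -/
theorem exists_reduction {p : ℕ} (hp : p.Prime) (h𝔪 : (p : AlgInt) ∈ 𝔪) {H : Type*} [Group H]
    [Finite H] {d : ℕ} (ρ : Representation ℂ H (Fin d → ℂ)) :
    ∃ ρ' : Representation (AlgInt ⧸ 𝔪) H (Fin d → AlgInt ⧸ 𝔪),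
      (modularLift p 𝔪 hp h𝔪).gch ρ' = reg p ρ.character ∧
      ∀ h (a : AlgInt), ρ h = (a : ℂ) • 1 → ρ' h = Ideal.Quotient.mk 𝔪 a • 1 := by
  obtain ⟨A, φ, R, b, hφ, hR⟩ := exists_integral_form 𝔪 ρ
  let ρ' : Representation (AlgInt ⧸ 𝔪) H (Fin d → AlgInt ⧸ 𝔪) :=
    (Matrix.toLinAlgEquiv' : Matrix (Fin d) (Fin d) (AlgInt ⧸ 𝔪) ≃ₐ[_] _).toMonoidHom.comp
      (φ.mapMatrix.toMonoidHom.comp R)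
  have hρ' : ∀ h, ρ' h = Matrix.toLin' ((R h).map φ) := fun h => rfl
  refine ⟨ρ', ?_, fun h a ha => ?_⟩
  · funext h
    set m := orderOf h.1
    have hm : m ≠ 0 := (orderOf_pos h.1).ne'
    have hT : ρ h.1 ^ m = 1 := by rw [← map_pow, pow_orderOf_eq_one, map_one]
    obtain ⟨n, c, μ, hc, hμ⟩ := exists_eigenbasis (ρ h.1) (Nat.cast_ne_zero.2 hm) hT
    choose z hz1 hz2 using fun i => complexLift.exists_red_eq hm (hμ i)
    have h0 : (ρ h.1).charpoly = ∏ i, (Polynomial.X - Polynomial.C (z i : ℂ)) := by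
      rw [(IsAlgClosed.splits (ρ h.1).charpoly).eq_prod_roots_of_monic
        (LinearMap.charpoly_monic _), roots_charpoly_of_eigenbasis c _ μ hc, Multiset.map_map]
      exact Finset.prod_congr rfl fun i _ => by
        rw [Function.comp_apply, ← hz2 i]
        rfl
    have h1 : (R h.1).charpoly = ∏ i, (Polynomial.X - Polynomial.C (algebraMap AlgInt A (z i))) := by
      refine Polynomial.map_injective (algebraMap A ℂ) Subtype.val_injective ?_
      rw [← Matrix.charpoly_map, ← RingHom.mapMatrix_apply, RingHom.mapMatrix_apply, ← hR,
        LinearMap.charpoly_toMatrix, h0, Polynomial.map_prod]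
      refine Finset.prod_congr rfl fun i _ => ?_
      rw [Polynomial.map_sub, Polynomial.map_X, Polynomial.map_C]
      rfl
    have h2 : (ρ' h.1).charpoly =
        ∏ i, (Polynomial.X - Polynomial.C (Ideal.Quotient.mk 𝔪 (z i))) := by
      rw [hρ', ← Matrix.toLin_eq_toLin', Matrix.charpoly_toLin, Matrix.charpoly_map, h1,
        Polynomial.map_prod]
      refine Finset.prod_congr rfl fun i _ => ?_
      rw [Polynomial.map_sub, Polynomial.map_X, Polynomial.map_C, hφ]
    have h3 : (modularLift p 𝔪 hp h𝔪).ltr (ρ' h.1) = ∑ i, (z i : ℂ) := by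
      have h4 : (ρ' h.1).charpoly.roots =
          Finset.univ.val.map fun i => Ideal.Quotient.mk 𝔪 (z i) := by
        rw [h2, ← Polynomial.roots_multiset_prod_X_sub_C
          (Finset.univ.val.map fun i => Ideal.Quotient.mk 𝔪 (z i)), Multiset.map_map]
        rfl
      rw [CharLift.ltr, h4, Multiset.map_map]
      exact Finset.sum_congr rfl fun i _ =>
        (modularLift p 𝔪 hp h𝔪).lift_red (z i) m hm h.2 (hz1 i)
    refine h3.trans ?_
    rw [reg, Representation.character, ← complexLift_ltr, complexLift.ltr_of_eigenbasis c _ μ hc]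
    exact Finset.sum_congr rfl fun i _ => hz2 i
  · have h1 : R h = Matrix.diagonal fun _ => algebraMap AlgInt A a := by
      refine Matrix.map_injective (f := algebraMap A ℂ) Subtype.val_injective ?_
      beta_reduce
      rw [← hR, ha, map_smul, LinearMap.toMatrix_one, Matrix.diagonal_map (map_zero _),
        ← Matrix.diagonal_one, ← Matrix.diagonal_smul]
      exact congrArg Matrix.diagonal (funext fun _ => mul_one (a : ℂ))
    have h2 : (R h).map φ = Ideal.Quotient.mk 𝔪 a • (1 : Matrix (Fin d) (Fin d) (AlgInt ⧸ 𝔪)) := by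
      rw [h1, Matrix.diagonal_map (map_zero _), Matrix.smul_one_eq_diagonal]
      exact congrArg Matrix.diagonal (funext fun _ => hφ a)
    rw [hρ', h2, map_smul, Matrix.toLin'_one]
    rfl

/-! ### Galois theory of the complex numbers over cyclotomic fields -/

section Extension

/-- An injective homomorphism to an algebraically closed field extends along algebraic extensions. -/
theorem exists_ringHom_comp_eq {R S M : Type*} [CommRing R] [IsDomain R] [Field S] [Algebra R S]
    [Field M] [IsAlgClosed M] [Module.IsTorsionFree R S] [Algebra.IsAlgebraic R S] (ψ : R →+* M)
    (hψ : Function.Injective ψ) : ∃ g : S →+* M, ∀ x, g (algebraMap R S x) = ψ x := by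
  let := ψ.toAlgebra
  have : FaithfulSMul R M := (faithfulSMul_iff_algebraMap_injective R M).2 hψ
  exact ⟨(IsAlgClosed.lift : S →ₐ[R] M).toRingHom, fun x => AlgHom.commutes _ x⟩

/-- An endomorphism of a subfield of an algebraically closed field extends to the whole field: it
extends to a transcendence basis by fixing the basis elements. -/
theorem exists_ringHom_extending {K Ω : Type*} [Field K] [Field Ω] [IsAlgClosed Ω] [Algebra K Ω]
    (f : K →+* K) : ∃ g : Ω →+* Ω, ∀ x, g (algebraMap K Ω x) = algebraMap K Ω (f x) := by
  obtain ⟨s, hs⟩ := exists_isTranscendenceBasis K Ω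
  have halg := hs.isAlgebraic
  have hind := hs.1
  let ψ : Algebra.adjoin K (Set.range (Subtype.val : s → Ω)) →+* Ω :=
    ((MvPolynomial.aeval (R := K) (Subtype.val : s → Ω)).toRingHom.comp (MvPolynomial.map f)).comp
      hind.aevalEquiv.symm.toRingHom
  obtain ⟨g, hg⟩ := exists_ringHom_comp_eq (S := Ω) ψ
    ((Function.Injective.comp hind (MvPolynomial.map_injective f f.injective)).comp
      hind.aevalEquiv.symm.injective)
  refine ⟨g, fun x => ?_⟩
  have h1 := hg (algebraMap K _ x)
  have h2 : hind.aevalEquiv.symm (algebraMap K _ x) = MvPolynomial.C x :=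
    hind.aevalEquiv.symm.commutes x
  refine h1.trans ?_
  change MvPolynomial.aeval _ (MvPolynomial.map f (hind.aevalEquiv.symm (algebraMap K _ x))) = _
  rw [h2, MvPolynomial.map_C, MvPolynomial.aeval_C]

end Extension

/-- Instance search finds on `AlgebraicClosure ℚ` the `ℚ`-algebra structure of a field of characteristic
zero, which is only propositionally equal to the one of the general construction. -/
instance isAlgClosure_rat : IsAlgClosure ℚ (AlgebraicClosure ℚ) where
  isAlgClosed := inferInstance
  isAlgebraic := by
    have h : (DivisionRing.toRatAlgebra : Algebra ℚ (AlgebraicClosure ℚ)) =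
        AlgebraicClosure.instAlgebra ℚ := Subsingleton.elim _ _
    rw [h]
    exact AlgebraicClosure.isAlgebraic ℚ

instance isAlgebraic_rat : Algebra.IsAlgebraic ℚ (AlgebraicClosure ℚ) :=
  isAlgClosure_rat.isAlgebraic

instance normal_rat : Normal ℚ (AlgebraicClosure ℚ) := IsAlgClosure.normal ℚ _

instance isGalois_rat : IsGalois ℚ (AlgebraicClosure ℚ) where

/-- An embedding of an algebraic closure of `ℚ` into `ℂ`. -/
noncomputable def ratClosure : AlgebraicClosure ℚ →ₐ[ℚ] ℂ := IsAlgClosed.lift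

theorem exists_ratClosure_eq {t : ℂ} (ht : IsIntegral ℚ t) : ∃ x, ratClosure x = t := by
  let := ratClosure.toRingHom.toAlgebra
  have : IsScalarTower ℚ (AlgebraicClosure ℚ) ℂ := IsScalarTower.of_algebraMap_eq fun x =>
    (ratClosure.commutes x).symm
  have h1 : IsIntegral (AlgebraicClosure ℚ) t := ht.tower_top
  exact minpoly.mem_range_of_degree_eq_one _ t
    (IsAlgClosed.degree_eq_one_of_irreducible _ (minpoly.irreducible h1))

theorem exists_ringHom_ratClosure (f : AlgebraicClosure ℚ →+* AlgebraicClosure ℚ) :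
    ∃ g : ℂ →+* ℂ, ∀ x, g (ratClosure x) = ratClosure (f x) := by
  let := ratClosure.toRingHom.toAlgebra
  exact exists_ringHom_extending f

/-- The endomorphisms of `ℂ` that fix the `m`-th roots of unity. -/
def FixesRoots (m : ℕ) (σ : ℂ →+* ℂ) : Prop := ∀ z : ℂ, z ^ m = 1 → σ z = z

/-- An algebraic number fixed by all endomorphisms of `ℂ` over `ℚ(ζ)` lies in `ℚ(ζ)`. -/
theorem mem_adjoin_of_fixed {m : ℕ} {ζ : ℂ} (hm : m ≠ 0) (hζ : IsPrimitiveRoot ζ m) {t : ℂ}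
    (ht : IsIntegral ℚ t) (h : ∀ σ, FixesRoots m σ → σ t = t) :
    t ∈ IntermediateField.adjoin ℚ {ζ} := by
  obtain ⟨x, rfl⟩ := exists_ratClosure_eq ht
  obtain ⟨y, rfl⟩ := exists_ratClosure_eq (t := ζ)
    (hζ.isIntegral (Nat.pos_of_ne_zero hm)).tower_top
  have hy : IsPrimitiveRoot y m := hζ.of_map_of_injective (f := ratClosure) ratClosure.injective
  let K := IntermediateField.adjoin ℚ {y}
  have hx : x ∈ K := by
    rw [← InfiniteGalois.fixedField_fixingSubgroup K, IntermediateField.mem_fixedField_iff]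
    intro f hf
    obtain ⟨g, hg⟩ := exists_ringHom_ratClosure (f : AlgebraicClosure ℚ →+* AlgebraicClosure ℚ)
    have hfy : f y = y := (IntermediateField.mem_fixingSubgroup_iff K f).1 hf y
      (IntermediateField.mem_adjoin_simple_self ℚ y)
    have h1 := h g fun z hz => by
      have : NeZero m := ⟨hm⟩
      obtain ⟨i, -, rfl⟩ := hζ.eq_pow_of_pow_eq_one hz
      rw [map_pow, hg]
      exact congrArg (fun u => ratClosure u ^ i) hfy
    rw [hg] at h1
    exact ratClosure.injective h1
  have h2 : ratClosure x ∈ IntermediateField.map ratClosure K := ⟨x, hx, rfl⟩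
  rwa [IntermediateField.adjoin_map, Set.image_singleton] at h2

/-- Elements of `ℚ(ζ)` are fixed by endomorphisms of `ℂ` that fix `ζ`. -/
theorem map_eq_of_mem_adjoin {ζ : ℂ} {σ : ℂ →+* ℂ} (hσ : σ ζ = ζ) {t : ℂ}
    (ht : t ∈ IntermediateField.adjoin ℚ {ζ}) : σ t = t := by
  induction ht using IntermediateField.adjoin_induction with
  | mem x hx => rw [Set.mem_singleton_iff.1 hx, hσ]
  | algebraMap x => exact map_ratCast σ x
  | add x y _ _ hx hy => rw [map_add, hx, hy]
  | inv x _ hx => rw [map_inv₀, hx]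
  | mul x y _ _ hx hy => rw [map_mul, hx, hy]

/-- For `q` odd and prime to `m`, some endomorphism of `ℂ` fixes the `m`-th roots of unity and
squares the `q`-th roots of unity. -/
theorem exists_fixesRoots_square {m q : ℕ} (hm : m ≠ 0) (hq : Odd q) (hmq : m.Coprime q) :
    ∃ σ, FixesRoots m σ ∧ ∀ z : ℂ, z ^ q = 1 → σ z = z ^ 2 := by
  obtain ⟨k, hk1, hk2⟩ := Nat.chineseRemainder hmq 1 2
  have hq0 : q ≠ 0 := hq.pos.ne'
  have hkc : k.Coprime (m * q) := by
    refine Nat.Coprime.mul_right ?_ ?_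
    · rw [Nat.Coprime, hk1.gcd_eq, Nat.gcd_one_left]
    · rw [Nat.Coprime, hk2.gcd_eq]
      exact Nat.coprime_two_left.2 hq
  have hω := Complex.isPrimitiveRoot_exp (m * q) (mul_ne_zero hm hq0)
  obtain ⟨y, hy⟩ := exists_ratClosure_eq (hω.isIntegral (Nat.pos_of_ne_zero
    (mul_ne_zero hm hq0))).tower_top
  rw [← hy] at hω
  have hyp : IsPrimitiveRoot y (m * q) :=
    hω.of_map_of_injective (f := ratClosure) ratClosure.injective
  have hconj : IsConjRoot ℚ (y ^ k) y := by
    rw [IsConjRoot, ← Polynomial.cyclotomic_eq_minpoly_rat (hyp.pow_of_coprime k hkc)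
      (Nat.pos_of_ne_zero (mul_ne_zero hm hq0)), ← Polynomial.cyclotomic_eq_minpoly_rat hyp
      (Nat.pos_of_ne_zero (mul_ne_zero hm hq0))]
  obtain ⟨f, hf⟩ := isConjRoot_iff_exists_algEquiv.1 hconj
  obtain ⟨g, hg⟩ := exists_ringHom_ratClosure (f : AlgebraicClosure ℚ →+* AlgebraicClosure ℚ)
  have hpow : ∀ z : ℂ, z ^ (m * q) = 1 → g z = z ^ k := by
    intro z hz
    have : NeZero (m * q) := ⟨mul_ne_zero hm hq0⟩
    obtain ⟨i, -, rfl⟩ := hω.eq_pow_of_pow_eq_one hz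
    rw [map_pow, hg, ← pow_mul, mul_comm, pow_mul, ← map_pow ratClosure y]
    exact congrArg (fun u => ratClosure u ^ i) hf
  refine ⟨g, fun z hz => ?_, fun z hz => ?_⟩
  · rw [hpow z (by rw [pow_mul, hz, one_pow])]
    have := pow_eq_pow_of_modEq hk1 hz
    rwa [pow_one] at this
  · rw [hpow z (by rw [mul_comm, pow_mul, hz, one_pow])]
    exact pow_eq_pow_of_modEq hk2 hz

/-! ### Linear characters comparing two extensions of a representation -/

section Compare

variable {k E N V : Type*} [Field k] [IsAlgClosed k] [Group E] [Group N] [AddCommGroup V]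
  [Module k V] [FiniteDimensional k V]

theorem exists_eq_smul_one_of_commute {ρ : Representation k N V} (hρ : ρ.IsIrreducible)
    {f : V →ₗ[k] V} (hf : ∀ n, ρ n * f = f * ρ n) : ∃ a : k, f = a • 1 := by
  have := (isIrreducible_iff.1 hρ).1
  obtain ⟨a, ha⟩ := Module.End.exists_eigenvalue f
  refine ⟨a, ?_⟩
  have h1 := ((isIrreducible_iff.1 hρ).2 (Module.End.eigenspace f a) fun n v hv => by
    rw [Module.End.mem_eigenspace_iff] at hv
    rw [Submodule.mem_comap, Module.End.mem_eigenspace_iff, ← Module.End.mul_apply, ← hf,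
      Module.End.mul_apply, hv, map_smul]).resolve_left ha
  refine LinearMap.ext fun v => ?_
  exact Module.End.mem_eigenspace_iff.1 (h1 ▸ Submodule.mem_top : v ∈ Module.End.eigenspace f a)

/-- The trace does not vanish identically on the coset `f ρ(N)`, because `ρ(N)` spans the
endomorphism algebra. -/
theorem exists_trace_mul_ne_zero {ρ : Representation k N V} (hρ : ρ.IsIrreducible)
    {f : V →ₗ[k] V} (hf : IsUnit f) : ∃ n, LinearMap.trace k V (f * ρ n) ≠ 0 := by
  have := (isIrreducible_iff.1 hρ).1
  by_contra! h
  obtain ⟨g, hg⟩ := exists_trace_eq_one (k := k) (V := V)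
  obtain ⟨u, rfl⟩ := hf
  obtain ⟨a, ha⟩ := asAlgebraHom_surjective hρ ((↑u⁻¹ : V →ₗ[k] V) * g)
  have h0 : ∀ a, LinearMap.trace k V (u * ρ.asAlgebraHom a) = 0 := by
    intro a
    induction a using MonoidAlgebra.induction_on with
    | of n => rw [asAlgebraHom_of]; exact h n
    | add a b ha hb => rw [map_add, mul_add, map_add, ha, hb, add_zero]
    | smul c a ha => rw [map_smul, mul_smul_comm, map_smul, ha, smul_zero]
  have h1 := h0 a
  rw [ha, ← mul_assoc, Units.mul_inv, one_mul, hg] at h1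
  exact one_ne_zero h1

omit [IsAlgClosed k] [FiniteDimensional k V] in
theorem isUnit_apply (ρ : Representation k E V) (y : E) : IsUnit (ρ y) :=
  (Group.isUnit y).map ρ

omit [IsAlgClosed k] [FiniteDimensional k V] in
theorem smul_apply_injective [Nontrivial V] (ρ : Representation k E V) (y : E) {a b : k}
    (h : a • ρ y = b • ρ y) : a = b :=
  smul_left_injective k (isUnit_apply ρ y).ne_zero h

omit [IsAlgClosed k] [FiniteDimensional k V] in
theorem eq_of_smul_one_eq [Nontrivial V] {a b : k} (h : a • (1 : Module.End k V) = b • 1) : a = b :=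
  smul_left_injective k one_ne_zero h

/-- Two representations that agree and are irreducible on a normal subgroup differ by a linear
character. -/
theorem exists_linearCharacter {s : N →* E} {ρ D : Representation k E V}
    (hρ : IsIrreducible (k := k) (ρ.comp s)) (hs : ∀ x n, ∃ n', x * s n * x⁻¹ = s n')
    (hD : ∀ n, D (s n) = ρ (s n)) : ∃ c : E →* k, ∀ y, D y = c y • ρ y := by
  have := (isIrreducible_iff.1 hρ).1
  have h1 : ∀ y, ∃ a : k, D y * ρ y⁻¹ = a • 1 := fun y =>
    exists_eq_smul_one_of_commute hρ fun n => by
      obtain ⟨n', hn'⟩ := hs y⁻¹ n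
      rw [inv_inv] at hn'
      change ρ (s n) * (D y * ρ y⁻¹) = D y * ρ y⁻¹ * ρ (s n)
      have h2 : y⁻¹ * s n = s n' * y⁻¹ := by rw [← hn', mul_inv_cancel_right]
      have h3 : s n * y = y * s n' := by rw [← hn', ← mul_assoc, mul_inv_cancel_left]
      rw [mul_assoc, ← map_mul, h2, map_mul, ← hD, ← mul_assoc, ← map_mul, h3, map_mul, hD,
        mul_assoc]
  choose c hc using h1
  have h2 : ∀ y, D y = c y • ρ y := fun y => by
    rw [← one_mul (ρ y), ← smul_mul_assoc, ← hc, mul_assoc, ← map_mul, inv_mul_cancel, map_one,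
      mul_one]
  refine ⟨{ toFun := c, map_one' := ?_, map_mul' := fun x y => ?_ }, h2⟩
  · refine smul_apply_injective ρ 1 ?_
    rw [← h2, map_one, map_one, one_smul]
  · refine smul_apply_injective ρ (x * y) ?_
    rw [← h2, map_mul, map_mul, h2, h2, smul_mul_smul_comm]

end Compare

/-! ### Galois twists of complex representations -/

section Twist

variable {E N : Type*} [Group E] [Group N] {d : ℕ}

/-- The representation obtained by applying an endomorphism of `ℂ` to matrix entries. -/
noncomputable def twist (σ : ℂ →+* ℂ) (ρ : Representation ℂ E (Fin d → ℂ)) :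
    Representation ℂ E (Fin d → ℂ) :=
  (Matrix.toLinAlgEquiv' : Matrix (Fin d) (Fin d) ℂ ≃ₐ[ℂ] _).toMonoidHom.comp
    (σ.mapMatrix.toMonoidHom.comp
      ((LinearMap.toMatrixAlgEquiv' : _ ≃ₐ[ℂ] Matrix (Fin d) (Fin d) ℂ).toMonoidHom.comp ρ))

theorem twist_apply (σ : ℂ →+* ℂ) (ρ : Representation ℂ E (Fin d → ℂ)) (y : E) :
    twist σ ρ y = Matrix.toLin' ((LinearMap.toMatrix' (ρ y)).map σ) := rfl

theorem trace_twist (σ : ℂ →+* ℂ) (ρ : Representation ℂ E (Fin d → ℂ)) (y : E) :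
    LinearMap.trace ℂ _ (twist σ ρ y) = σ (LinearMap.trace ℂ _ (ρ y)) := by
  rw [twist_apply, Matrix.trace_toLin'_eq, LinearMap.trace_eq_matrix_trace ℂ (Pi.basisFun ℂ _) (ρ y)]
  exact (AddMonoidHom.map_trace σ.toAddMonoidHom _).symm

theorem det_twist (σ : ℂ →+* ℂ) (ρ : Representation ℂ E (Fin d → ℂ)) (y : E) :
    LinearMap.det (twist σ ρ y) = σ (LinearMap.det (ρ y)) := by
  rw [twist_apply, LinearMap.det_toLin', ← LinearMap.det_toMatrix' (ρ y), RingHom.map_det]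
  rfl

theorem twist_smul_one (σ : ℂ →+* ℂ) (ρ : Representation ℂ E (Fin d → ℂ)) {y : E} {a : ℂ}
    (h : ρ y = a • 1) : twist σ ρ y = σ a • 1 := by
  have h1 : (LinearMap.toMatrix' (ρ y)).map σ = σ a • (1 : Matrix (Fin d) (Fin d) ℂ) := by
    rw [h, map_smul]
    change (a • LinearMap.toMatrix' LinearMap.id).map σ = _
    rw [LinearMap.toMatrix'_id, Matrix.smul_one_eq_diagonal, Matrix.diagonal_map (map_zero _),
      Matrix.smul_one_eq_diagonal]
  rw [twist_apply, h1, map_smul, Matrix.toLin'_one]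
  rfl

/-- A Galois twist that fixes the character of an irreducible restriction to a normal subgroup is
described by a linear character. -/
theorem exists_twist_character [Finite N] {s : N →* E} {ρ : Representation ℂ E (Fin d → ℂ)}
    (hρ : IsIrreducible (k := ℂ) (ρ.comp s)) (hs : ∀ x n, ∃ n', x * s n * x⁻¹ = s n')
    {σ : ℂ →+* ℂ} (hσ : ∀ n, σ (ρ.character (s n)) = ρ.character (s n)) :
    ∃ c : E →* ℂ, (∀ n, c (s n) = 1) ∧ (∀ y, σ (ρ.character y) = c y * ρ.character y) ∧
      (∀ y, σ (LinearMap.det (ρ y)) = c y ^ d * LinearMap.det (ρ y)) ∧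
      ∀ y a, ρ y = a • 1 → σ a = c y * a := by
  have := (isIrreducible_iff.1 hρ).1
  let ρ₁ : Representation ℂ N (Fin d → ℂ) := ρ.comp s
  let ρ₂ : Representation ℂ N (Fin d → ℂ) := (twist σ ρ).comp s
  have hch : complexLift.gch ρ₁ = complexLift.gch ρ₂ := by
    rw [← reg_one_character, ← reg_one_character]
    congr 1
    funext n
    exact (hσ n).symm.trans (trace_twist σ ρ (s n)).symm
  have hρ₂ : ρ₂.IsIrreducible := complexLift.isIrreducible_of_isGIrr
    (hch ▸ complexLift.isGIrr_gch (ρ := ρ₁) hρ)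
  obtain ⟨e⟩ := complexLift.nonempty_equiv_of_gch_eq (ρ := ρ₁) hρ hρ₂ hch
  let D : Representation ℂ E (Fin d → ℂ) :=
    e.toLinearEquiv.symm.conjRingEquiv.toRingHom.toMonoidHom.comp (twist σ ρ)
  have hDy : ∀ y, D y = e.toLinearEquiv.symm.conj (twist σ ρ y) := fun _ => rfl
  have hDs : ∀ n, D (s n) = ρ (s n) := fun n => by
    have h1 := equiv_apply e n
    change e.toLinearEquiv.conj (ρ (s n)) = twist σ ρ (s n) at h1
    rw [hDy, ← h1]
    exact e.toLinearEquiv.conj.symm_apply_apply _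
  obtain ⟨c, hc⟩ := exists_linearCharacter (D := D) hρ hs hDs
  refine ⟨c, fun n => ?_, fun y => ?_, fun y => ?_, fun y a ha => ?_⟩
  · refine smul_apply_injective ρ (s n) ?_
    rw [← hc, one_smul, hDs]
  · have h1 := congrArg (LinearMap.trace ℂ _) (hc y)
    rw [hDy, LinearMap.trace_conj', trace_twist, map_smul] at h1
    exact h1
  · have h1 := congrArg LinearMap.det (hc y)
    rw [hDy, LinearEquiv.conj_apply, LinearMap.comp_assoc, LinearMap.det_conj, det_twist,
      LinearMap.det_smul,
      Module.finrank_fin_fun] at h1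
    exact h1
  · have h1 := hc y
    rw [hDy, twist_smul_one σ ρ ha, ha, map_smul, smul_smul] at h1
    refine smul_apply_injective ρ 1 ?_
    rw [map_one, ← h1]
    congr 1
    exact e.toLinearEquiv.symm.conj_id.symm

end Twist

/-! ### The subgroup of elements with Galois invariant traces -/

/-- Characters of elements of finite order are sums of roots of unity. -/
theorem exists_character_eq_sum {E : Type*} [Group E] {d e : ℕ} (he : e ≠ 0)
    (ρ : Representation ℂ E (Fin d → ℂ)) {y : E} (hy : y ^ e = 1) :
    ∃ (n : ℕ) (μ : Fin n → ℂ), (∀ i, μ i ^ e = 1) ∧ ρ.character y = ∑ i, μ i ∧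
      ρ.character y⁻¹ = ∑ i, (μ i)⁻¹ := by
  obtain ⟨n, b, μ, hb, hμ⟩ := exists_eigenbasis (ρ y) (m := e) (Nat.cast_ne_zero.2 he)
    (by rw [← map_pow, hy, map_one])
  have hμ0 : ∀ i, μ i ≠ 0 := fun i h => by
    have := hμ i
    rw [h, zero_pow he] at this
    exact zero_ne_one this
  refine ⟨n, μ, hμ, ?_, ?_⟩
  · rw [Representation.character, ← complexLift_ltr, complexLift.ltr_of_eigenbasis b _ μ hb]
    rfl
  · rw [Representation.character, ← complexLift_ltr,
      complexLift.ltr_of_eigenbasis b _ (fun i => (μ i)⁻¹) fun i => ?_]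
    · rfl
    · rw [eq_inv_smul_iff₀ (hμ0 i), ← map_smul, ← hb, ← Module.End.mul_apply, ← map_mul,
        inv_mul_cancel, map_one, Module.End.one_apply]

theorem isIntegral_character {E : Type*} [Group E] {d e : ℕ} (he : e ≠ 0)
    (ρ : Representation ℂ E (Fin d → ℂ)) {y : E} (hy : y ^ e = 1) :
    IsIntegral ℚ (ρ.character y) := by
  obtain ⟨n, μ, hμ, h, -⟩ := exists_character_eq_sum he ρ hy
  rw [h]
  exact IsIntegral.sum _ fun i _ => IsIntegral.of_pow (Nat.pos_of_ne_zero he)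
    (by rw [hμ]; exact isIntegral_one)

/-- Complex conjugation inverts the argument of a character. -/
theorem conj_character {E : Type*} [Group E] {d e : ℕ} (he : e ≠ 0)
    (ρ : Representation ℂ E (Fin d → ℂ)) {y : E} (hy : y ^ e = 1) :
    starRingEnd ℂ (ρ.character y) = ρ.character y⁻¹ := by
  obtain ⟨n, μ, hμ, h, h'⟩ := exists_character_eq_sum he ρ hy
  rw [h, h', map_sum]
  refine Finset.sum_congr rfl fun i _ => ?_
  rw [Complex.inv_def, Complex.normSq_eq_norm_sq, Complex.norm_eq_one_of_pow_eq_one (hμ i) he]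
  simp

/-- Endomorphisms of `ℂ` commute on sums of roots of unity. -/
theorem map_map_character_comm {E : Type*} [Group E] {d e : ℕ} (he : e ≠ 0)
    (ρ : Representation ℂ E (Fin d → ℂ)) {y : E} (hy : y ^ e = 1) (σ τ : ℂ →+* ℂ) :
    σ (τ (ρ.character y)) = τ (σ (ρ.character y)) := by
  obtain ⟨n, μ, hμ, h, -⟩ := exists_character_eq_sum he ρ hy
  have : NeZero e := ⟨he⟩
  have hω := Complex.isPrimitiveRoot_exp e he
  set ω := Complex.exp (2 * Real.pi * Complex.I / e)
  obtain ⟨i, -, hi⟩ := hω.eq_pow_of_pow_eq_one (ξ := σ ω) (by rw [← map_pow, hω.pow_eq_one, map_one])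
  obtain ⟨j, -, hj⟩ := hω.eq_pow_of_pow_eq_one (ξ := τ ω) (by rw [← map_pow, hω.pow_eq_one, map_one])
  simp only [h, map_sum]
  refine Finset.sum_congr rfl fun l _ => ?_
  obtain ⟨a, -, ha⟩ := hω.eq_pow_of_pow_eq_one (hμ l)
  rw [← ha, map_pow, map_pow, map_pow, map_pow, ← hi, ← hj, map_pow, map_pow, ← hi, ← hj]
  ring

theorem map_character_of_fixesRoots {E : Type*} [Group E] {d e m : ℕ} (he : e ≠ 0) (hem : e ∣ m)
    (ρ : Representation ℂ E (Fin d → ℂ)) {y : E} (hy : y ^ e = 1) {σ : ℂ →+* ℂ}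
    (hσ : FixesRoots m σ) : σ (ρ.character y) = ρ.character y := by
  obtain ⟨n, μ, hμ, h, -⟩ := exists_character_eq_sum he ρ hy
  rw [h, map_sum]
  refine Finset.sum_congr rfl fun i _ => hσ _ ?_
  obtain ⟨a, rfl⟩ := hem
  rw [pow_mul, hμ, one_pow]

section Fixed

variable {E N : Type*} [Group E] [Finite E] [Group N] [Finite N] {d : ℕ} {s : N →* E}
  {ρ : Representation ℂ E (Fin d → ℂ)}

/-- For some `n`, the `p`-regular part of `y * s n` has nonzero trace, because the reduction of `ρ`
modulo `𝔪` is irreducible on `N` and hence has nonzero trace somewhere on the coset of `y`. -/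
theorem exists_character_regular_ne_zero {p : ℕ} {𝔪 : Ideal AlgInt} [𝔪.IsMaximal] (hp : p.Prime)
    (h𝔪 : (p : AlgInt) ∈ 𝔪) (hibr : IsIBr p 𝔪 (reg p fun n => ρ.character (s n))) (y : E) :
    ∃ n, ρ.character ((y * s n) ^ regExp p (Nat.card E)) ≠ 0 := by
  obtain ⟨ρ', hρ', -⟩ := exists_reduction hp h𝔪 ρ
  have hirr : IsIrreducible (k := AlgInt ⧸ 𝔪) (ρ'.comp s) := by
    refine (modularLift p 𝔪 hp h𝔪).isIrreducible_of_isGIrr ?_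
    have h1 : (modularLift p 𝔪 hp h𝔪).gch (ρ'.comp s : Representation (AlgInt ⧸ 𝔪) N _) =
        reg p fun n => ρ.character (s n) := funext fun n => congrFun hρ' (PReg.map s n)
    rw [h1]
    exact hibr
  obtain ⟨n, hn⟩ := exists_trace_mul_ne_zero hirr (isUnit_apply ρ' y)
  refine ⟨n, fun h0 => hn ?_⟩
  obtain ⟨z, hz, hz'⟩ := (modularLift p 𝔪 hp h𝔪).exists_red_eq_trace_gch ρ' (y * s n)
  rw [hρ', reg] at hz
  have hz0 : z = 0 := Subtype.val_injective (hz.symm.trans h0)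
  rw [hz0, map_zero, map_mul] at hz'
  exact hz'.symm

/-- The elements of `E` whose coset modulo the image of `s` has traces in `ℚ(ζ)`, `ζ` a primitive
`m`-th root of unity, expressed through invariance under endomorphisms of `ℂ`. -/
def IsFixed (m : ℕ) (s : N →* E) (ρ : Representation ℂ E (Fin d → ℂ)) (y : E) : Prop :=
  ∀ σ, FixesRoots m σ → ∀ n, σ (ρ.character (y * s n)) = ρ.character (y * s n)

omit [Finite E] [Finite N] in
theorem isFixed_iff {m : ℕ} (hρ : IsIrreducible (k := ℂ) (ρ.comp s)) {c : (ℂ →+* ℂ) → E →* ℂ}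
    (hc : ∀ σ, FixesRoots m σ → ∀ n, c σ (s n) = 1)
    (hc' : ∀ σ, FixesRoots m σ → ∀ y, σ (ρ.character y) = c σ y * ρ.character y) {y : E} :
    IsFixed m s ρ y ↔ ∀ σ, FixesRoots m σ → c σ y = 1 := by
  refine forall₂_congr fun σ hσ => ⟨fun h => ?_, fun h n => ?_⟩
  · obtain ⟨n, hn⟩ := exists_trace_mul_ne_zero hρ (isUnit_apply ρ y)
    have hn' : ρ.character (y * s n) ≠ 0 := by rwa [character, map_mul]
    have h1 := h n
    rw [hc' σ hσ, map_mul, hc σ hσ, mul_one] at h1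
    exact mul_right_cancel₀ hn' (h1.trans (one_mul _).symm)
  · rw [hc' σ hσ, map_mul, hc σ hσ, mul_one, h, one_mul]

/-- The subgroup of elements whose coset modulo the image of `s` has Galois invariant traces. -/
def fixedSubgroup (m : ℕ) (hρ : IsIrreducible (k := ℂ) (ρ.comp s))
    (hs : ∀ x n, ∃ n', x * s n * x⁻¹ = s n')
    (hfix : ∀ σ, FixesRoots m σ → ∀ n, σ (ρ.character (s n)) = ρ.character (s n)) :
    Subgroup E where
  carrier := {y | IsFixed m s ρ y}
  one_mem' σ hσ n := by rw [one_mul]; exact hfix σ hσ n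
  mul_mem' {x y} hx hy := by
    choose! c hc1 hc2 _ using fun σ hσ => exists_twist_character hρ hs (hfix σ hσ)
    rw [Set.mem_ofPred_eq, isFixed_iff hρ hc1 hc2] at *
    intro σ hσ
    rw [map_mul, hx σ hσ, hy σ hσ, mul_one]
  inv_mem' {x} hx := by
    choose! c hc1 hc2 _ using fun σ hσ => exists_twist_character hρ hs (hfix σ hσ)
    rw [Set.mem_ofPred_eq, isFixed_iff hρ hc1 hc2] at *
    intro σ hσ
    have h1 : c σ x⁻¹ * c σ x = 1 := by rw [← map_mul, inv_mul_cancel, map_one]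
    rwa [hx σ hσ, mul_one] at h1

/-- The linear character describing the twist by `σ` takes values of `p`-power order, because
some element of each coset has a `p`-regular part of nonzero trace. -/
theorem twist_character_pow_eq_one {p : ℕ} {𝔪 : Ideal AlgInt} [𝔪.IsMaximal] (hp : p.Prime)
    (h𝔪 : (p : AlgInt) ∈ 𝔪) (hibr : IsIBr p 𝔪 (reg p fun n => ρ.character (s n)))
    {m : ℕ} (hm : ordCompl[p] (Nat.card E) ∣ m) {σ : ℂ →+* ℂ} (hσ : FixesRoots m σ) {c : E →* ℂ}
    (hc : ∀ n, c (s n) = 1) (hc' : ∀ y, σ (ρ.character y) = c y * ρ.character y) (y : E) :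
    c y ^ ordProj[p] (Nat.card E) = 1 := by
  have hE : Nat.card E ≠ 0 := Nat.card_pos.ne'
  obtain ⟨n, hn⟩ := exists_character_regular_ne_zero hp h𝔪 hibr y
  have h1 : c y ^ regExp p (Nat.card E) = 1 := by
    have h2 := hc' ((y * s n) ^ regExp p (Nat.card E))
    rw [map_character_of_fixesRoots (Nat.ordCompl_pos p hE).ne' hm ρ
      (pow_regExp_pow (Or.inr hp) hE pow_card_eq_one') hσ, map_pow, map_mul, hc, mul_one] at h2
    exact mul_right_cancel₀ hn (h2.symm.trans (one_mul _).symm)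
  have h2 : c y ^ Nat.card E = 1 := by rw [← map_pow, pow_card_eq_one', map_one]
  -- `regExp` is `1` modulo the `p'`-part of `|E|`, so `h1` leaves only the `p`-part of the order
  have h3 : (orderOf (c y)).Coprime (ordCompl[p] (Nat.card E)) := by
    have h4 := (regExp_modEq p (Nat.card E)).of_dvd
      (Nat.gcd_dvd_right (orderOf (c y)) (ordCompl[p] (Nat.card E)))
    have h5 := (Nat.gcd_dvd_left (orderOf (c y)) (ordCompl[p] (Nat.card E))).trans
      (orderOf_dvd_of_pow_eq_one h1)
    have h6 := ((Nat.modEq_zero_iff_dvd.2 h5).symm.trans h4).symm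
    exact Nat.dvd_one.1 ((Nat.modEq_zero_iff_dvd).1 h6)
  refine orderOf_dvd_iff_pow_eq_one.1 (h3.dvd_of_dvd_mul_right ?_)
  rw [Nat.ordProj_mul_ordCompl_eq_self]
  exact orderOf_dvd_of_pow_eq_one h2

/-- Every element becomes fixed after multiplication by a suitable scalar. The scalar `w` is chosen
so that one endomorphism `τ`, squaring roots of unity of `p`-power order, has trivial linear
character at `w y`. Since every endomorphism `σ` commutes with `τ` on traces, the value of its
linear character at `w y` is equal to its square. -/
theorem exists_mul_isFixed {p : ℕ} {𝔪 : Ideal AlgInt} [𝔪.IsMaximal] (hp : p.Prime) (hodd : Odd p)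
    (h𝔪 : (p : AlgInt) ∈ 𝔪) (hibr : IsIBr p 𝔪 (reg p fun n => ρ.character (s n)))
    (hρ : IsIrreducible (k := ℂ) (ρ.comp s)) (hs : ∀ x n, ∃ n', x * s n * x⁻¹ = s n')
    {m L : ℕ} (hL : ∀ y, LinearMap.det (ρ y) ^ L = 1) (hm : ordCompl[p] (Nat.card E) ∣ m)
    (hpm : p.Coprime m)
    (hfix : ∀ σ, FixesRoots m σ → ∀ n, σ (ρ.character (s n)) = ρ.character (s n)) (y : E) :
    ∃ w : ℂ, w ^ (d * L) = 1 ∧ ∀ z, ρ z = w • 1 → IsFixed m s ρ (z * y) := by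
  have hE : Nat.card E ≠ 0 := Nat.card_pos.ne'
  have := (isIrreducible_iff.1 hρ).1
  choose! c hc1 hc2 hc3 hc4 using fun σ hσ => exists_twist_character hρ hs (hfix σ hσ)
  have hcq : ∀ σ, FixesRoots m σ → ∀ y, c σ y ^ ordProj[p] (Nat.card E) = 1 := fun σ hσ =>
    twist_character_pow_eq_one hp h𝔪 hibr hm hσ (hc1 σ hσ) (hc2 σ hσ)
  have hm0 : m ≠ 0 := by
    rintro rfl
    exact hp.ne_one ((Nat.coprime_zero_right p).1 hpm)
  obtain ⟨τ, hτ, hτ2⟩ := exists_fixesRoots_square (q := ordProj[p] (Nat.card E)) hm0 hodd.pow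
    (hpm.symm.pow_right _)
  have hcd : (c τ y)⁻¹ ^ (d * L) = 1 := by
    have h1 := congrArg (· ^ L) (hc3 τ hτ y)
    beta_reduce at h1
    rw [← map_pow, hL, map_one, mul_pow, hL, mul_one, ← pow_mul] at h1
    rw [inv_pow, ← h1, inv_one]
  refine ⟨(c τ y)⁻¹, hcd, fun z hz => (isFixed_iff hρ hc1 hc2).2 ?_⟩
  have hw0 : c τ y ≠ 0 := fun h => by
    have h1 := hcq τ hτ y
    rw [h, zero_pow (Nat.ordProj_pos _ _).ne'] at h1
    exact zero_ne_one h1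
  have hτz : c τ (z * y) = 1 := by
    have h1 := hc4 τ hτ z _ hz
    rw [hτ2 _ (by rw [inv_pow, hcq τ hτ, inv_one]), pow_two] at h1
    rw [map_mul, ← mul_right_cancel₀ (inv_ne_zero hw0) h1, inv_mul_cancel₀ hw0]
  intro σ hσ
  obtain ⟨n, hn⟩ := exists_trace_mul_ne_zero hρ (isUnit_apply ρ (z * y))
  have ht : ρ.character (z * y * s n) ≠ 0 := by rwa [character, map_mul]
  have h1 : τ (ρ.character (z * y * s n)) = ρ.character (z * y * s n) := by
    rw [hc2 τ hτ, map_mul, hτz, hc1 τ hτ, one_mul, one_mul]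
  have h2 : σ (ρ.character (z * y * s n)) = c σ (z * y) * ρ.character (z * y * s n) := by
    rw [hc2 σ hσ, map_mul, hc1 σ hσ, mul_one]
  -- `τ` fixes the nonzero trace `t` and `σ t = c t`, so `τ σ t = σ τ t` gives `c ^ 2 = c`
  have h3 := map_map_character_comm hE ρ (pow_card_eq_one' (x := z * y * s n)) σ τ
  rw [h1, h2, map_mul τ, h1, hτ2 _ (hcq σ hσ _)] at h3
  have h4 := mul_right_cancel₀ ht h3
  have h5 : c σ (z * y) ≠ 0 := fun h => by
    have h6 := hcq σ hσ (z * y)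
    rw [h, zero_pow (Nat.ordProj_pos _ _).ne'] at h6
    exact zero_ne_one h6
  rw [pow_two] at h4
  exact (mul_left_cancel₀ h5 (h4.symm.trans (mul_one _).symm))

end Fixed

/-! ### Construction of the covering group -/

section Abstract

theorem exists_mulEquiv_of_ker_eq {E A B : Type*} [Group E] [Group A] [Group B] {f : E →* A}
    {g : E →* B} (hf : Function.Surjective f) (hg : Function.Surjective g) (h : f.ker = g.ker) :
    ∃ e : A ≃* B, ∀ x, e (f x) = g x := by
  let e := ((QuotientGroup.quotientKerEquivOfSurjective f hf).symm.trans
    (QuotientGroup.quotientMulEquivOfEq h)).trans (QuotientGroup.quotientKerEquivOfSurjective g hg)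
  refine ⟨e, fun x => ?_⟩
  have h1 : (QuotientGroup.quotientKerEquivOfSurjective f hf).symm (f x) = QuotientGroup.mk x :=
    (MulEquiv.symm_apply_eq _).2 rfl
  simp only [e, MulEquiv.trans_apply, h1]
  rfl

/-- A group extension `E → G` in which the normal subgroup `N` lifts to a normal subgroup gives a
common cover of `G` and of the quotient of `E` by the lift of `N`. -/
theorem exists_commonCover {G E : Type u} [Group G] [Group E] {N : Subgroup G} [N.Normal]
    {π : E →* G} (hπ : Function.Surjective π) {s : N →* E} (hs : ∀ n, π (s n) = n)
    (hconj : ∀ x n, ∃ n', x * s n * x⁻¹ = s n') :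
    ∃ (Γ : Type u) (_ : Group Γ) (M : Subgroup Γ) (_ : M.Normal) (C : CommonCover E N M),
      C.π = π ∧ C.s = s := by
  have hnorm : s.range.Normal := ⟨by
    rintro _ ⟨n, rfl⟩ x
    obtain ⟨n', hn'⟩ := hconj x n
    exact ⟨n', hn'.symm⟩⟩
  let q := QuotientGroup.mk' s.range
  have hq : Function.Surjective q := QuotientGroup.mk'_surjective _
  let M := π.ker.map q
  have hM : M.Normal := Subgroup.Normal.map inferInstance q hq
  obtain ⟨τ, hτ⟩ := exists_mulEquiv_of_ker_eq
    (f := (QuotientGroup.mk' N).comp π) (g := (QuotientGroup.mk' M).comp q)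
    ((QuotientGroup.mk'_surjective N).comp hπ) ((QuotientGroup.mk'_surjective M).comp hq) (by
      ext x
      simp only [MonoidHom.mem_ker, MonoidHom.comp_apply, QuotientGroup.mk'_apply,
        QuotientGroup.eq_one_iff]
      constructor
      · intro hx
        refine ⟨x * (s ⟨π x, hx⟩)⁻¹, ?_, ?_⟩
        · rw [SetLike.mem_coe, MonoidHom.mem_ker, map_mul, map_inv, hs, mul_inv_cancel]
        · rw [map_mul, map_inv]
          have : q (s ⟨π x, hx⟩) = 1 := (QuotientGroup.eq_one_iff _).2 ⟨_, rfl⟩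
          rw [this, inv_one, mul_one]
      · rintro ⟨z, hz, hzx⟩
        obtain ⟨n, hn⟩ := QuotientGroup.eq.1 hzx
        have h1 : π x = n := by
          have h2 := congrArg π hn
          rw [hs, map_mul, map_inv, MonoidHom.mem_ker.1 hz, inv_one, one_mul] at h2
          exact h2.symm
        rw [h1]
        exact n.2)
  exact ⟨E ⧸ s.range, inferInstance, M, hM, {
    π := π
    q := q
    s := s
    τ := τ
    π_surj := hπ
    q_surj := hq
    π_s := hs
    q_s := fun n => (QuotientGroup.eq_one_iff _).2 ⟨n, rfl⟩
    exists_s := fun x hx => (QuotientGroup.eq_one_iff _).1 hx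
    τ_mk := hτ
    exists_ker := by
      rintro m ⟨z, hz, rfl⟩
      exact ⟨z, hz, rfl⟩ }, rfl, rfl⟩

end Abstract

section Extension

variable {G : Type u} [Group G] {N : Subgroup G} [N.Normal] {d : ℕ}

/-- The group of pairs `(g, A)` such that conjugation by `A` has the same effect on the
representation `X` of `N` as conjugation by `g`, and the determinant of `A` is an `L`-th root of
unity. -/
def pairGroup (X : Representation ℂ N (Fin d → ℂ)) (L : ℕ) :
    Subgroup (G × (Module.End ℂ (Fin d → ℂ))ˣ) where
  carrier := {x | (∀ n, (x.2 : Module.End ℂ (Fin d → ℂ)) * X n =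
    X (MulAut.conjNormal x.1 n) * x.2) ∧ LinearMap.det (x.2 : Module.End ℂ (Fin d → ℂ)) ^ L = 1}
  one_mem' := ⟨fun n => by simp, by simp⟩
  mul_mem' {x y} hx hy := by
    refine ⟨fun n => ?_, ?_⟩
    · rw [Prod.snd_mul, Units.val_mul, mul_assoc, hy.1, ← mul_assoc, hx.1, mul_assoc,
        Prod.fst_mul, map_mul, MulAut.mul_apply]
    · rw [Prod.snd_mul, Units.val_mul, map_mul, mul_pow, hx.2, hy.2, mul_one]
  inv_mem' {x} hx := by
    refine ⟨fun n => ?_, ?_⟩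
    · rw [Prod.snd_inv, Prod.fst_inv, Units.inv_mul_eq_iff_eq_mul, ← mul_assoc, hx.1,
        map_inv, MulAut.apply_inv_self, mul_assoc, Units.mul_inv, mul_one]
    · have h1 : LinearMap.det (x⁻¹.2 : Module.End ℂ (Fin d → ℂ)) ^ L *
          LinearMap.det (x.2 : Module.End ℂ (Fin d → ℂ)) ^ L = 1 := by
        rw [← mul_pow, ← map_mul, Prod.snd_inv, Units.inv_mul, map_one, one_pow]
      rwa [hx.2, mul_one] at h1

variable {X : Representation ℂ N (Fin d → ℂ)} {L : ℕ}

theorem pairGroup_scalar (hX : X.IsIrreducible) {x : G × (Module.End ℂ (Fin d → ℂ))ˣ}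
    (hx : x ∈ pairGroup X L) (h1 : x.1 = 1) :
    ∃ a : ℂ, (x.2 : Module.End ℂ (Fin d → ℂ)) = a • 1 := by
  refine exists_eq_smul_one_of_commute hX fun n => ?_
  have h2 := hx.1 n
  rw [h1, map_one] at h2
  exact h2.symm

theorem scalar_mem_pairGroup {w : ℂ} (hL : L ≠ 0) (hd : d ≠ 0) (hw : w ^ (d * L) = 1) :
    ∃ A : (Module.End ℂ (Fin d → ℂ))ˣ, (A : Module.End ℂ (Fin d → ℂ)) = w • 1 ∧
      ((1 : G), A) ∈ pairGroup X L := by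
  have hw0 : w ≠ 0 := by
    rintro rfl
    rw [zero_pow (mul_ne_zero hd hL)] at hw
    exact zero_ne_one hw
  refine ⟨Units.mk0 w hw0 • 1, ?_, fun n => ?_, ?_⟩
  · rfl
  · change w • (1 : Module.End ℂ (Fin d → ℂ)) * X n = X (MulAut.conjNormal 1 n) * w • 1
    rw [map_one, smul_one_mul, mul_smul_one]
    rfl
  · change LinearMap.det (w • (1 : Module.End ℂ (Fin d → ℂ))) ^ L = 1
    rw [LinearMap.det_smul, Module.finrank_fin_fun, map_one, mul_one, ← pow_mul, hw]

/-- As the character of `X` is invariant, `X` is equivalent to its conjugate by `g`; an intertwining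
map can be scaled to have determinant `1`. -/
theorem exists_mem_pairGroup [Finite N] (hX : X.IsIrreducible)
    (hinv : ∀ (g : G) (n : N), X.character (MulAut.conjNormal g n) = X.character n) (g : G) :
    ∃ A, (g, A) ∈ pairGroup X L := by
  have := (isIrreducible_iff.1 hX).1
  have hd : d ≠ 0 := by
    rintro rfl
    exact not_nontrivial (Fin 0 → ℂ) this
  let X' : Representation ℂ N (Fin d → ℂ) := X.comp (MulAut.conjNormal g : MulAut N).toMonoidHom
  have hX' : X'.IsIrreducible := (isIrreducible_comp_iff (MulAut.conjNormal g).surjective).2 hX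
  obtain ⟨e⟩ := complexLift.nonempty_equiv_of_gch_eq hX hX' (by
    rw [← reg_one_character, ← reg_one_character]
    exact congrArg (reg 1) (funext fun n => (hinv g n).symm))
  set D := LinearMap.det (e.toLinearEquiv : Module.End ℂ (Fin d → ℂ)) with hD
  have hD0 : D ≠ 0 := (LinearEquiv.isUnit_det' e.toLinearEquiv).ne_zero
  obtain ⟨w, hw⟩ := IsAlgClosed.exists_pow_nat_eq D⁻¹ (Nat.pos_of_ne_zero hd)
  have hw0 : w ≠ 0 := by
    rintro rfl
    rw [zero_pow hd] at hw
    exact inv_ne_zero hD0 hw.symm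
  let A : (Module.End ℂ (Fin d → ℂ))ˣ :=
    ⟨w • (e.toLinearEquiv : Module.End ℂ (Fin d → ℂ)),
      w⁻¹ • (e.toLinearEquiv.symm : Module.End ℂ (Fin d → ℂ)), by
        rw [smul_mul_smul_comm, mul_inv_cancel₀ hw0, one_smul]
        exact LinearEquiv.comp_symm _, by
        rw [smul_mul_smul_comm, inv_mul_cancel₀ hw0, one_smul]
        exact LinearEquiv.symm_comp _⟩
  refine ⟨A, fun n => ?_, ?_⟩
  · change w • (e.toLinearEquiv : Module.End ℂ (Fin d → ℂ)) * X n =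
      X' n * w • (e.toLinearEquiv : Module.End ℂ (Fin d → ℂ))
    rw [smul_mul_assoc, mul_smul_comm]
    exact congrArg (w • ·) (e.isIntertwining' n)
  · change LinearMap.det (w • (e.toLinearEquiv : Module.End ℂ (Fin d → ℂ))) ^ L = 1
    rw [LinearMap.det_smul, Module.finrank_fin_fun, hw, ← hD, inv_mul_cancel₀ hD0, one_pow]

theorem finite_pairGroup [Finite G] (hX : X.IsIrreducible) (hL : L ≠ 0) :
    Finite (pairGroup X L) := by
  have := (isIrreducible_iff.1 hX).1
  have hd : d ≠ 0 := by
    rintro rfl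
    exact not_nontrivial (Fin 0 → ℂ) this
  let f : pairGroup X L →* G := (MonoidHom.fst _ _).comp (pairGroup X L).subtype
  refine (MonoidHom.finite_iff_finite_ker_range f).2 ⟨?_, inferInstance⟩
  have hscal : ∀ x : f.ker, ∃ a : ℂ, (x.1.1.2 : Module.End ℂ (Fin d → ℂ)) = a • 1 := fun x =>
    pairGroup_scalar hX x.1.2 x.2
  choose a ha using hscal
  have hroot : ∀ x, a x ^ (d * L) = 1 := fun x => by
    have h1 := x.1.2.2
    rw [ha, LinearMap.det_smul, Module.finrank_fin_fun, map_one, mul_one, ← pow_mul] at h1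
    exact h1
  let S : Set ℂ := {w | w ^ (d * L) = 1}
  have hS : S.Finite := by
    refine (Polynomial.nthRoots (d * L) (1 : ℂ)).toFinset.finite_toSet.subset fun w hw => ?_
    rw [Finset.mem_coe, Multiset.mem_toFinset,
      Polynomial.mem_nthRoots (Nat.pos_of_ne_zero (mul_ne_zero hd hL))]
    exact hw
  have : Finite S := hS
  refine Finite.of_injective (fun x => (⟨a x, hroot x⟩ : S)) fun x y hxy => ?_
  have h1 : a x = a y := congrArg Subtype.val hxy
  refine Subtype.ext (Subtype.ext (Prod.ext ?_ (Units.ext ?_)))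
  · exact (MonoidHom.mem_ker.1 x.2).trans (MonoidHom.mem_ker.1 y.2).symm
  · rw [ha, ha, h1]

end Extension

/-- Passage from a finite extension of `G` to which the representation of `N` extends to its subgroup
of fixed elements. -/
theorem exists_fixed_covering {G E : Type u} [Group G] [Group E] [Finite E] {N : Subgroup G}
    [Finite N] {p : ℕ} (hp : p.Prime) (hodd : Odd p) {𝔪 : Ideal AlgInt} [𝔪.IsMaximal]
    (h𝔪 : (p : AlgInt) ∈ 𝔪) {d : ℕ} {π : E →* G} {s : N →* E} {ρ : Representation ℂ E (Fin d → ℂ)}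
    (hρ : IsIrreducible (k := ℂ) (ρ.comp s)) (hπ : Function.Surjective π) (hs : ∀ n, π (s n) = n)
    (hconj : ∀ x n, ∃ n', x * s n * x⁻¹ = s n')
    (hker : ∀ z, π z = 1 → ∃ a : ℂ, ρ z = a • 1) (hker' : ∀ z, π z = 1 → ρ z = 1 → z = 1)
    {L : ℕ} (hdet : ∀ y, LinearMap.det (ρ y) ^ L = 1)
    (hscal : ∀ w : ℂ, w ^ (d * L) = 1 → ∃ z, π z = 1 ∧ ρ z = w • 1)
    (hrat : IsPRational p fun n => ρ.character (s n))
    (hibr : IsIBr p 𝔪 (reg p fun n => ρ.character (s n))) :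
    ∃ (F : Type u) (_ : Group F) (_ : Finite F) (π' : F →* G) (s' : N →* F)
      (ρ' : Representation ℂ F (Fin d → ℂ)) (m : ℕ),
      Function.Surjective π' ∧ (∀ n, π' (s' n) = n) ∧ (∀ x n, ∃ n', x * s' n * x⁻¹ = s' n') ∧
      (∀ n, ρ' (s' n) = ρ (s n)) ∧ (∀ z, π' z = 1 → ∃ a : ℂ, ρ' z = a • 1) ∧
      (∀ z, π' z = 1 → ρ' z = 1 → z = 1) ∧ p.Coprime m ∧
      ∀ σ, FixesRoots m σ → ∀ y, σ (ρ'.character y) = ρ'.character y := by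
  obtain ⟨m₀, ζ, hm₀, hζ, hval⟩ := hrat
  have hm₀' : p.Coprime m₀ := hp.coprime_iff_not_dvd.2 hm₀
  have hm : p.Coprime (ordCompl[p] (Nat.card E) * m₀) :=
    (Nat.coprime_ordCompl hp Nat.card_pos.ne').mul_right hm₀'
  have hfix : ∀ σ, FixesRoots (ordCompl[p] (Nat.card E) * m₀) σ →
      ∀ n, σ (ρ.character (s n)) = ρ.character (s n) := fun σ hσ n =>
    map_eq_of_mem_adjoin (hσ ζ (by rw [mul_comm, pow_mul, hζ.pow_eq_one, one_pow])) (hval n)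
  let F := fixedSubgroup (ordCompl[p] (Nat.card E) * m₀) hρ hconj hfix
  have hsF : ∀ n, s n ∈ F := fun n σ hσ n' => by
    rw [← map_mul]
    exact hfix σ hσ _
  refine ⟨F, inferInstance, inferInstance, π.comp F.subtype, s.codRestrict F hsF, ρ.comp F.subtype,
    ordCompl[p] (Nat.card E) * m₀, fun g => ?_, hs, fun x n => ?_, fun _ => rfl,
    fun z => hker z.1, fun z hz hz' => Subtype.ext (hker' z.1 hz hz'), hm, fun σ hσ y => ?_⟩
  · obtain ⟨y, rfl⟩ := hπ g
    obtain ⟨w, hw, hwF⟩ := exists_mul_isFixed hp hodd h𝔪 hibr hρ hconj hdet (Nat.dvd_mul_right _ _)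
      hm hfix y
    obtain ⟨z, hz, hz'⟩ := hscal w hw
    refine ⟨⟨z * y, hwF z hz'⟩, ?_⟩
    change π (z * y) = π y
    rw [map_mul, hz, one_mul]
  · obtain ⟨n', hn'⟩ := hconj x.1 n
    exact ⟨n', Subtype.ext hn'⟩
  · have h1 := y.2 σ hσ 1
    rw [map_one, mul_one] at h1
    exact h1

/-- The covering group on which the character of the extension of `X` takes values in a cyclotomic
field `ℚ(ζ)` with `ζ` of order `m` prime to `p`. -/
theorem exists_covering {G : Type u} [Group G] [Finite G] {N : Subgroup G} [N.Normal] {p : ℕ}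
    (hp : p.Prime) (hodd : Odd p) {𝔪 : Ideal AlgInt} [𝔪.IsMaximal] (h𝔪 : (p : AlgInt) ∈ 𝔪)
    {d : ℕ} {X : Representation ℂ N (Fin d → ℂ)} (hX : X.IsIrreducible)
    (hinv : ∀ (g : G) (n : N), X.character (MulAut.conjNormal g n) = X.character n)
    (hrat : IsPRational p X.character) (hibr : IsIBr p 𝔪 (reg p X.character)) :
    ∃ (E : Type u) (_ : Group E) (_ : Finite E) (π : E →* G) (s : N →* E)
      (ρ : Representation ℂ E (Fin d → ℂ)) (m : ℕ),
      Function.Surjective π ∧ (∀ n, π (s n) = n) ∧ (∀ x n, ∃ n', x * s n * x⁻¹ = s n') ∧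
      ρ.comp s = X ∧ (∀ z, π z = 1 → ∃ a : ℂ, ρ z = a • 1) ∧
      (∀ z, π z = 1 → ρ z = 1 → z = 1) ∧ p.Coprime m ∧
      ∀ σ, FixesRoots m σ → ∀ y, σ (ρ.character y) = ρ.character y := by
  have := (isIrreducible_iff.1 hX).1
  have hd : d ≠ 0 := by
    rintro rfl
    exact not_nontrivial (Fin 0 → ℂ) this
  -- with this exponent for the determinants, `N` itself embeds by `n ↦ (n, X n)`
  have hL : Nat.card N ≠ 0 := Nat.card_pos.ne'
  let E := pairGroup X (Nat.card N)
  have hfin : Finite E := finite_pairGroup hX hL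
  let π : E →* G := (MonoidHom.fst _ _).comp E.subtype
  let ρ : Representation ℂ E (Fin d → ℂ) :=
    (Units.coeHom _).comp ((MonoidHom.snd _ _).comp E.subtype)
  let s : N →* E := (N.subtype.prod X.toHomUnits).codRestrict E fun n => by
    refine ⟨fun n' => ?_, ?_⟩
    · change X n * X n' = X (MulAut.conjNormal n.1 n') * X n
      rw [← map_mul, ← map_mul]
      congr 1
      exact Subtype.ext (by simp)
    · change LinearMap.det (X n) ^ Nat.card N = 1
      rw [← map_pow, ← map_pow, pow_card_eq_one', map_one, map_one]
  have hρs : ρ.comp s = X := rfl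
  have hconj : ∀ x n, ∃ n', x * s n * x⁻¹ = s n' := fun x n =>
    ⟨MulAut.conjNormal x.1.1 n, by
      rw [mul_inv_eq_iff_eq_mul]
      refine Subtype.ext (Prod.ext ?_ (Units.ext (x.2.1 n)))
      change x.1.1 * n = (MulAut.conjNormal x.1.1 n : G) * x.1.1
      simp⟩
  have hdet : ∀ y, LinearMap.det (ρ y) ^ Nat.card N = 1 := fun y => y.2.2
  obtain ⟨F, hF, hF', π', s', ρ', m, h1, h2, h3, h4, h5⟩ := exists_fixed_covering hp hodd h𝔪
    (π := π) (s := s) (ρ := ρ) (L := Nat.card N) hX (fun g => by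
      obtain ⟨A, hA⟩ := exists_mem_pairGroup (L := Nat.card N) hX hinv g
      exact ⟨⟨(g, A), hA⟩, rfl⟩) (fun n => rfl) hconj (fun z hz => pairGroup_scalar hX z.2 hz)
    (fun z hz hz' => Subtype.ext (Prod.ext hz (Units.ext hz'))) hdet (fun w hw => by
      obtain ⟨B, hB, hBE⟩ := scalar_mem_pairGroup (X := X) hL hd hw
      exact ⟨⟨(1, B), hBE⟩, rfl, hB⟩) hrat hibr
  exact ⟨F, hF, hF', π', s', ρ', m, h1, h2, h3, MonoidHom.ext h4, h5⟩

/-! ### Inner products -/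

section Inner

theorem matrix_trace_mul_trace {d : ℕ} {R : Type*} [CommRing R] (C D : Matrix (Fin d) (Fin d) R) :
    C.trace * D.trace =
      ∑ i, ∑ j, (C * Matrix.single i j 1 * (D * Matrix.single j i 1)).trace := by
  rw [Matrix.trace, Matrix.trace, Finset.sum_mul_sum]
  refine Finset.sum_congr rfl fun i _ => Finset.sum_congr rfl fun j _ => ?_
  rw [← mul_assoc, Matrix.trace_mul_comm, ← mul_assoc, ← mul_assoc, Matrix.single_mul_mul_single]
  simp [Matrix.trace_single_mul]

/-- Matrix units, and the product of two traces in terms of them. -/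
theorem exists_matrixUnits (d : ℕ) : ∃ u : Fin d → Fin d → Module.End ℂ (Fin d → ℂ),
    (∀ C D : Module.End ℂ (Fin d → ℂ), LinearMap.trace ℂ _ C * LinearMap.trace ℂ _ D =
      ∑ i, ∑ j, LinearMap.trace ℂ _ (C * u i j * (D * u j i))) ∧
    ∀ i j, LinearMap.trace ℂ _ (u i j) = if i = j then 1 else 0 := by
  refine ⟨fun i j => Matrix.toLinAlgEquiv' (Matrix.single i j 1), fun C D => ?_, fun i j => ?_⟩
  · obtain ⟨C, rfl⟩ := (Matrix.toLinAlgEquiv' : Matrix (Fin d) (Fin d) ℂ ≃ₐ[ℂ] _).surjective C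
    obtain ⟨D, rfl⟩ := (Matrix.toLinAlgEquiv' : Matrix (Fin d) (Fin d) ℂ ≃ₐ[ℂ] _).surjective D
    simp only [← map_mul]
    have h : ∀ A : Matrix (Fin d) (Fin d) ℂ,
      LinearMap.trace ℂ _ (Matrix.toLinAlgEquiv' A) = A.trace := Matrix.trace_toLin'_eq
    simp only [h]
    exact matrix_trace_mul_trace C D
  · refine (Matrix.trace_toLin'_eq _).trans ?_
    split_ifs with h
    · rw [h, Matrix.trace_single_eq_same]
    · rw [Matrix.trace_single_eq_of_ne _ _ _ h]

/-- Schur orthogonality for the coset `x N`. -/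
theorem sum_character_mul_character_inv {E N : Type*} [Group E] [Group N] [Fintype N] {d : ℕ}
    {s : N →* E} {ρ : Representation ℂ E (Fin d → ℂ)}
    (hρ : IsIrreducible (k := ℂ) (ρ.comp s)) (x : E) :
    ∑ n, ρ.character (x * s n) * ρ.character (x * s n)⁻¹ = Nat.card N := by
  have := (isIrreducible_iff.1 hρ).1
  have hd : (d : ℂ) ≠ 0 := by
    rintro h
    rw [Nat.cast_eq_zero] at h
    subst h
    exact not_nontrivial (Fin 0 → ℂ) this
  obtain ⟨u, hu1, hu2⟩ := exists_matrixUnits d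
  -- the average of an endomorphism over `N` is a scalar by Schur's lemma
  have havg : ∀ Y : Module.End ℂ (Fin d → ℂ), ∑ n, ρ (s n) * Y * ρ (s n⁻¹) =
      (Nat.card N * LinearMap.trace ℂ _ Y / d) • (1 : Module.End ℂ (Fin d → ℂ)) := by
    intro Y
    obtain ⟨a, ha⟩ := exists_eq_smul_one_of_commute (f := ∑ n, ρ (s n) * Y * ρ (s n⁻¹)) hρ
      (fun g => by
        rw [Finset.mul_sum, Finset.sum_mul]
        refine Fintype.sum_equiv (Equiv.mulLeft g) _ _ fun n => ?_
        change ρ (s g) * (ρ (s n) * Y * ρ (s n⁻¹)) = ρ (s (g * n)) * Y * ρ (s (g * n)⁻¹) * ρ (s g)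
        rw [mul_assoc (ρ (s (g * n)) * Y), ← map_mul ρ, ← map_mul s, mul_inv_rev,
          inv_mul_cancel_right, map_mul, map_mul]
        simp only [mul_assoc])
    have h1 := congrArg (LinearMap.trace ℂ _) ha
    rw [map_sum, map_smul, LinearMap.trace_one, Module.finrank_fin_fun, smul_eq_mul] at h1
    have h2 : ∀ n, LinearMap.trace ℂ _ (ρ (s n) * Y * ρ (s n⁻¹)) = LinearMap.trace ℂ _ Y := by
      intro n
      rw [LinearMap.trace_mul_comm, ← mul_assoc, ← map_mul, ← map_mul, inv_mul_cancel, map_one,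
        map_one, one_mul]
    simp only [h2, Finset.sum_const, nsmul_eq_mul, Finset.card_univ] at h1
    rw [ha, Nat.card_eq_fintype_card, h1, mul_div_cancel_right₀ _ hd]
  have h1 : ∀ n, ρ.character (x * s n) * ρ.character (x * s n)⁻¹ = ∑ i, ∑ j,
      LinearMap.trace ℂ _ (ρ x * (ρ (s n) * u i j * ρ (s n⁻¹)) * (ρ x⁻¹ * u j i)) := by
    intro n
    rw [character, character, hu1, mul_inv_rev, ← map_inv, map_mul, map_mul]
    simp only [mul_assoc]
  simp only [h1]
  rw [Finset.sum_comm]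
  have h2 : ∀ i, ∑ n, ∑ j, LinearMap.trace ℂ _ (ρ x * (ρ (s n) * u i j * ρ (s n⁻¹)) *
      (ρ x⁻¹ * u j i)) = Nat.card N / d := by
    intro i
    rw [Finset.sum_comm]
    have h3 : ∀ j, ∑ n, LinearMap.trace ℂ _ (ρ x * (ρ (s n) * u i j * ρ (s n⁻¹)) *
      (ρ x⁻¹ * u j i)) = if i = j then (Nat.card N / d : ℂ) else 0 := by
      intro j
      rw [← map_sum, ← Finset.sum_mul, ← Finset.mul_sum, havg, hu2]
      split_ifs with h
      · subst h
        rw [mul_smul_comm, mul_one, smul_mul_assoc, mul_one, ← mul_assoc, ← map_mul, mul_inv_cancel,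
          map_one, one_mul, map_smul, hu2, if_pos rfl, smul_eq_mul]
        ring
      · rw [mul_zero, zero_div, zero_smul, mul_zero, zero_mul, map_zero]
    simp only [h3]
    rw [Finset.sum_ite_eq, if_pos (Finset.mem_univ _)]
  simp only [h2, Finset.sum_const, Finset.card_univ, Fintype.card_fin, nsmul_eq_mul]
  exact mul_div_cancel₀ _ hd

/-- The inner product may be computed after inflation along a surjective homomorphism. -/
theorem charInner_comp {A B : Type*} [Group A] [Group B] [Finite A] [Finite B] {f : A →* B}
    (hf : Function.Surjective f) (χ ψ : B → ℂ) : charInner (χ ∘ f) (ψ ∘ f) = charInner χ ψ := by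
  classical
  have := Fintype.ofFinite A
  have := Fintype.ofFinite B
  have hfib : ∀ b, (Finset.univ.filter fun a => f a = b).card = Nat.card f.ker := fun b => by
    rw [MonoidHom.card_fiber_eq_of_mem_range f (hf b) (hf 1), Nat.card_eq_fintype_card,
      Fintype.card_subtype]
    simp only [MonoidHom.mem_ker]
  have hcard : (Nat.card A : ℂ) = Nat.card B * Nat.card f.ker := by
    rw [← Nat.cast_mul]
    congr 1
    rw [← Nat.card_congr (QuotientGroup.quotientKerEquivOfSurjective f hf).toEquiv]
    exact Subgroup.card_eq_card_quotient_mul_card_subgroup f.ker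
  have hker : (Nat.card f.ker : ℂ) ≠ 0 := Nat.cast_ne_zero.2 Nat.card_pos.ne'
  rw [charInner, charInner, finsum_eq_sum_of_fintype, finsum_eq_sum_of_fintype,
    ← Finset.sum_fiberwise Finset.univ f]
  have h1 : ∀ b, ∑ a ∈ Finset.univ.filter (fun a => f a = b),
      (χ ∘ f) a * starRingEnd ℂ ((ψ ∘ f) a) =
        Nat.card f.ker * (χ b * starRingEnd ℂ (ψ b)) := fun b => by
    rw [← hfib b, ← nsmul_eq_mul, ← Finset.sum_const]
    refine Finset.sum_congr rfl fun a ha => ?_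
    rw [Function.comp_apply, Function.comp_apply, (Finset.mem_filter.1 ha).2]
  simp only [h1]
  rw [← Finset.mul_sum, hcard, mul_inv, mul_assoc, inv_mul_cancel_left₀ hker]

/-- Multiplication by the character of a representation that is irreducible on `N` preserves inner
products of functions that are constant on cosets of `N`. -/
theorem charInner_mul_character {E N : Type*} [Group E] [Group N] [Finite N] [Finite E] {d : ℕ}
    {s : N →* E} {ρ : Representation ℂ E (Fin d → ℂ)}
    (hρ : IsIrreducible (k := ℂ) (ρ.comp s)) {χ ψ : E → ℂ} (hχ : ∀ x n, χ (x * s n) = χ x)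
    (hψ : ∀ x n, ψ (x * s n) = ψ x) :
    charInner (ρ.character * χ) (ρ.character * ψ) = charInner χ ψ := by
  have := Fintype.ofFinite E
  have := Fintype.ofFinite N
  have hE : Nat.card E ≠ 0 := Nat.card_pos.ne'
  have hN : (Nat.card N : ℂ) ≠ 0 := Nat.cast_ne_zero.2 Nat.card_pos.ne'
  rw [charInner, charInner, finsum_eq_sum_of_fintype, finsum_eq_sum_of_fintype]
  congr 1
  refine mul_left_cancel₀ hN ?_
  have h1 : ∀ n, ∑ x, (ρ.character * χ) x * starRingEnd ℂ ((ρ.character * ψ) x) =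
      ∑ x, ρ.character (x * s n) * ρ.character (x * s n)⁻¹ * (χ x * starRingEnd ℂ (ψ x)) := by
    intro n
    refine (Fintype.sum_equiv (Equiv.mulRight (s n)) _ _ fun x => ?_).symm
    change _ = (ρ.character * χ) (x * s n) * starRingEnd ℂ ((ρ.character * ψ) (x * s n))
    rw [Pi.mul_apply, Pi.mul_apply, hχ, hψ, map_mul, conj_character hE ρ pow_card_eq_one']
    ring
  rw [Nat.card_eq_fintype_card, ← nsmul_eq_mul, ← nsmul_eq_mul, ← Finset.card_univ,
    ← Finset.sum_const, Finset.sum_congr rfl fun n _ => h1 n, Finset.sum_comm, Finset.smul_sum]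
  refine Finset.sum_congr rfl fun x _ => ?_
  rw [← Finset.sum_mul, sum_character_mul_character_inv hρ, Nat.card_eq_fintype_card,
    Finset.card_univ, nsmul_eq_mul]

end Inner

/-! ### Rationality -/

/-- If the values of `η` are values of a `p`-rational function up to factors in `ℚ(ζ)`, then `η` is
`p`-rational. -/
theorem IsPRational.of_mul {A B : Type*} {p m : ℕ} (hp : p.Prime) {ζ : ℂ} (hpm : p.Coprime m)
    (hζ : IsPrimitiveRoot ζ m) {χ : A → ℂ} {η : B → ℂ} (hχ : IsPRational p χ)
    (h : ∀ b, ∃ a, ∃ t ∈ IntermediateField.adjoin ℚ {ζ}, η b = t * χ a) : IsPRational p η := by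
  obtain ⟨m', ζ', hm', hζ', hval⟩ := hχ
  have hm0 : m ≠ 0 := by
    rintro rfl
    exact hp.ne_one ((Nat.coprime_zero_right p).1 hpm)
  have hm'0 : m' ≠ 0 := by
    rintro rfl
    exact hm' (dvd_zero p)
  have hω := Complex.isPrimitiveRoot_exp (m * m') (mul_ne_zero hm0 hm'0)
  set ω := Complex.exp (2 * Real.pi * Complex.I / (m * m' : ℕ))
  have hle : ∀ {l : ℕ} {z : ℂ}, l ∣ m * m' → z ^ l = 1 →
      IntermediateField.adjoin ℚ {z} ≤ IntermediateField.adjoin ℚ {ω} := by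
    rintro l z ⟨l', hl⟩ hz
    rw [IntermediateField.adjoin_simple_le_iff]
    have : NeZero (m * m') := ⟨mul_ne_zero hm0 hm'0⟩
    obtain ⟨i, -, rfl⟩ := hω.eq_pow_of_pow_eq_one (ξ := z) (by rw [hl, pow_mul, hz, one_pow])
    exact pow_mem (IntermediateField.mem_adjoin_simple_self ℚ ω) i
  refine ⟨m * m', ω, ?_, hω, fun b => ?_⟩
  · rw [hp.dvd_mul, not_or]
    exact ⟨hp.coprime_iff_not_dvd.1 hpm, hm'⟩
  · obtain ⟨a, t, ht, hb⟩ := h b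
    rw [hb]
    exact mul_mem (hle (Nat.dvd_mul_right _ _) hζ.pow_eq_one ht)
      (hle (Nat.dvd_mul_left _ _) hζ'.pow_eq_one (hval a))

/-! ### The isomorphism of character triples -/

namespace CommonCover

variable {G Γ E : Type*} [Group G] [Group Γ] [Group E] {N : Subgroup G} [N.Normal] {M : Subgroup Γ}
  [M.Normal] (C : CommonCover E N M)

theorem eq_of_q_eq {z z' : E} (hz : C.π z = 1) (hz' : C.π z' = 1) (h : C.q z = C.q z') :
    z = z' := by
  obtain ⟨n, hn⟩ := C.exists_s (z⁻¹ * z') (by rw [map_mul, map_inv, h, inv_mul_cancel])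
  have h1 : (n : G) = 1 := by rw [← C.π_s, hn, map_mul, map_inv, hz, hz', inv_one, one_mul]
  have h2 : n = 1 := Subtype.ext h1
  rw [h2, map_one] at hn
  exact (inv_mul_eq_one.1 hn.symm)

theorem le_center {k V : Type*} [Field k] [AddCommGroup V] [Module k V] {ρ : Representation k E V}
    (hz : ∀ z, C.π z = 1 → ∃ a : k, ρ z = a • 1) (hz' : ∀ z, C.π z = 1 → ρ z = 1 → z = 1) :
    M ≤ Subgroup.center Γ := by
  intro m hm
  obtain ⟨z, hz1, rfl⟩ := C.exists_ker m hm
  refine Subgroup.mem_center_iff.2 fun v => ?_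
  obtain ⟨x, rfl⟩ := C.q_surj v
  obtain ⟨a, ha⟩ := hz z hz1
  have h1 : x * z * x⁻¹ * z⁻¹ = 1 := by
    refine hz' _ (by simp [hz1]) ?_
    have h2 : ρ (x * z * x⁻¹) = ρ z := by
      rw [map_mul, map_mul, ha, mul_smul_comm, mul_one, smul_mul_assoc, ← map_mul,
        mul_inv_cancel, map_one]
    rw [map_mul, h2, ← map_mul, mul_inv_cancel, map_one]
  rw [← map_mul, ← map_mul, mul_inv_eq_one.1 h1 |> mul_inv_eq_iff_eq_mul.1]

/-- The linear character of `M` that is inverse to the scalars by which the kernel of `E → G` acts. -/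
theorem exists_scalarRep {k V : Type*} [Field k] [AddCommGroup V] [Module k V] [Nontrivial V]
    {ρ : Representation k E V} (hz : ∀ z, C.π z = 1 → ∃ a : k, ρ z = a • 1) :
    ∃ Ξ : Representation k M (Fin 1 → k), ∀ (z : E) (a : k) (m : M),
      C.π z = 1 → ρ z = a • 1 → C.q z = m → Ξ m = a⁻¹ • 1 := by
  choose z hz1 hz2 using fun m : M => C.exists_ker m.1 m.2
  choose a ha using fun m => hz (z m) (hz1 m)
  let c : M →* k :=
    { toFun := a
      map_one' := eq_of_smul_one_eq (V := V) (by
        rw [← ha, one_smul, C.eq_of_q_eq (hz1 1) (map_one C.π) (by rw [hz2, map_one]; rfl), map_one])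
      map_mul' := fun m m' => eq_of_smul_one_eq (V := V) (by
        rw [← ha, C.eq_of_q_eq (hz1 (m * m')) (z' := z m * z m')
          (by rw [map_mul, hz1, hz1, one_mul]) (by rw [map_mul, hz2, hz2, hz2]; rfl), map_mul, ha,
          ha, smul_mul_smul_comm, one_mul]) }
  refine ⟨(algebraMap k (Module.End k (Fin 1 → k))).toMonoidHom.comp (invMonoidHom.comp c),
    fun x b m hx hb hm => ?_⟩
  have h1 : x = z m := C.eq_of_q_eq hx (hz1 m) (by rw [hm, hz2])
  have h2 : b = a m := eq_of_smul_one_eq (V := V) (by rw [← hb, h1, ha])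
  rw [h2]
  exact Algebra.algebraMap_eq_smul_one (R := k) (A := Module.End k (Fin 1 → k)) _

/-- There are sections of `E → Γ` preserving `p`-regularity on whose image the character of `ρ` does
not vanish. -/
theorem exists_regular_section [Finite E] {p : ℕ} {𝔪 : Ideal AlgInt} [𝔪.IsMaximal] (hp : p.Prime)
    (h𝔪 : (p : AlgInt) ∈ 𝔪) {d : ℕ} {ρ : Representation ℂ E (Fin d → ℂ)}
    (hρ : IsIrreducible (k := ℂ) (ρ.comp C.s))
    (hibr : IsIBr p 𝔪 (reg p fun n => ρ.character (C.s n))) :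
    ∃ c : Γ → E, ∀ v, C.q (c v) = v ∧ ρ.character (c v) ≠ 0 ∧
      (p.Coprime (orderOf v) → p.Coprime (orderOf (c v))) := by
  have : Finite N := Finite.of_injective C.s fun a b h => Subtype.ext (by rw [← C.π_s a, h, C.π_s])
  refine Classical.axiomOfChoice (r := fun v x => C.q x = v ∧ ρ.character x ≠ 0 ∧
    (p.Coprime (orderOf v) → p.Coprime (orderOf x))) fun v => ?_
  obtain ⟨y, rfl⟩ := C.q_surj v
  -- over a `p`-regular element, take the `p`-regular part of a lift on which `ρ` has nonzero trace
  by_cases hy : p.Coprime (orderOf (C.q y))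
  · obtain ⟨n, hn⟩ := exists_character_regular_ne_zero hp h𝔪 hibr y
    refine ⟨_, ?_, hn, fun _ => coprime_orderOf_pow_regExp (Or.inr hp) Nat.card_pos.ne'
      pow_card_eq_one'⟩
    rw [map_pow, map_mul, C.q_s, mul_one, pow_regExp_eq_self _ hy]
    rw [← map_pow, pow_card_eq_one', map_one]
  · obtain ⟨n, hn⟩ := exists_trace_mul_ne_zero hρ (isUnit_apply ρ y)
    refine ⟨y * C.s n, ?_, ?_, fun h => absurd h hy⟩
    · rw [map_mul, C.q_s, mul_one]
    · rwa [character, map_mul]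

section Main

variable [Finite G] [Finite Γ] [Finite E] {d : ℕ} {ρ : Representation ℂ E (Fin d → ℂ)}

/-- The correspondence preserves inner products. -/
theorem Corresponds.charInner_eq {C : CommonCover E N M} (hρ : IsIrreducible (k := ℂ) (ρ.comp C.s))
    {U : Subgroup G} {hU : N ≤ U} {χ ψ : U → ℂ} {χ' ψ' : corr C.τ U → ℂ}
    (hχ : C.Corresponds complexLift ρ hU (reg 1 χ) (reg 1 χ'))
    (hψ : C.Corresponds complexLift ρ hU (reg 1 ψ) (reg 1 ψ')) :
    charInner χ' ψ' = charInner χ ψ := by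
  let s' : N →* U.comap C.π := C.s.codRestrict _ fun n => by
    rw [Subgroup.mem_comap, C.π_s]
    exact hU n.2
  let ρ' : Representation ℂ (U.comap C.π) (Fin d → ℂ) := ρ.comp (U.comap C.π).subtype
  have h1 : ∀ {χ : U → ℂ} {χ' : corr C.τ U → ℂ},
      C.Corresponds complexLift ρ hU (reg 1 χ) (reg 1 χ') →
        χ ∘ C.πOn U = ρ'.character * (χ' ∘ C.qOn hU) := fun h => funext fun x => by
    have h2 := h ⟨x, Nat.coprime_one_left _⟩
    rw [complexLift_ltr] at h2
    exact h2
  have hq : ∀ (x : U.comap C.π) (n : N), C.qOn hU (x * s' n) = C.qOn hU x := fun x n => by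
    have h2 : C.qOn hU (s' n) = 1 := Subtype.ext (C.q_s n)
    rw [map_mul, h2, mul_one]
  rw [← charInner_comp (C.πOn_surjective U) χ ψ, ← charInner_comp (C.qOn_surjective hU) χ' ψ',
    h1 hχ, h1 hψ]
  exact (charInner_mul_character (s := s') (ρ := ρ') hρ (fun x n => congrArg χ' (hq x n))
    (fun x n => congrArg ψ' (hq x n))).symm

variable {p : ℕ} {𝔪 : Ideal AlgInt} [𝔪.IsMaximal] {hp : p.Prime} {h𝔪 : (p : AlgInt) ∈ 𝔪}

/-- The isomorphism of character triples attached to a common cover, a complex representation of it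
that is irreducible on `N`, and a reduction of this representation modulo `𝔪`. -/
noncomputable def ordModIso (C : CommonCover E N M) {Ξ : Representation ℂ M (Fin 1 → ℂ)}
    {ρ' : Representation (AlgInt ⧸ 𝔪) E (Fin d → AlgInt ⧸ 𝔪)}
    {Ξ' : Representation (AlgInt ⧸ 𝔪) M (Fin 1 → AlgInt ⧸ 𝔪)} {c : Γ → E}
    (hC : C.IsCompatible ρ Ξ) (hC' : C.IsCompatible ρ' Ξ')
    (hS : C.IsTransferSection complexLift ρ c ρ.character)
    (hS' : C.IsTransferSection (modularLift p 𝔪 hp h𝔪) ρ' c ρ.character)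
    {θ : N → ℂ} (hθ : reg 1 θ = complexLift.gch (ρ.comp C.s : Representation ℂ N _))
    (hθ' : reg p θ = (modularLift p 𝔪 hp h𝔪).gch (ρ'.comp C.s : Representation (AlgInt ⧸ 𝔪) N _))
    {ξ : M → ℂ} (hξ : reg 1 ξ = complexLift.gch Ξ)
    (hξ' : reg p ξ = (modularLift p 𝔪 hp h𝔪).gch Ξ') : OrdModIso p 𝔪 θ ξ where
  τ := C.τ
  ord U χ := fun v => C.transfer 1 c ρ.character U (reg 1 χ) ⟨v, Nat.coprime_one_left _⟩
  mod U := C.transfer p c ρ.character U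
  ord_mapsTo U hU χ hχ := by
    rw [← reg_one_mem_GChOver, hθ] at hχ
    rw [← reg_one_mem_GChOver, hξ]
    exact (hS.corresponds_transfer hC hU hχ).2
  ord_add U hU χ hχ ψ hψ := by
    rw [← reg_one_mem_GChOver, hθ] at hχ hψ
    exact reg_one_injective (hS.transfer_add hC hU hχ hψ)
  ord_inner U hU χ hχ ψ hψ := by
    rw [← reg_one_mem_GChOver, hθ] at hχ hψ
    exact Corresponds.charInner_eq hC.irr (hS.corresponds_transfer hC hU hχ).1
      (hS.corresponds_transfer hC hU hψ).1
  ord_bijOn U hU := by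
    obtain ⟨h1, h2, h3⟩ := hS.transfer_bijOn hC hU
    rw [← hθ, ← hξ] at h1 h3
    rw [← hθ] at h2
    refine ⟨fun χ hχ => reg_one_mem_GIrrOver.1 (h1 (reg_one_mem_GIrrOver.2 hχ)),
      fun χ hχ ψ hψ h => reg_one_injective (h2 (reg_one_mem_GIrrOver.2 hχ)
        (reg_one_mem_GIrrOver.2 hψ) (congrArg (reg 1) h)), fun χ' hχ' => ?_⟩
    obtain ⟨η, hη, hη'⟩ := h3 (reg_one_mem_GIrrOver.2 hχ')
    obtain ⟨χ, rfl⟩ := reg_one_surjective η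
    exact ⟨χ, reg_one_mem_GIrrOver.1 hη, reg_one_injective hη'⟩
  ord_res K U hK hU hKU χ hχ := by
    rw [← reg_one_mem_GChOver, hθ] at hχ
    exact reg_one_injective (hS.transfer_res hC hU hK hKU hχ)
  ord_mul U hU χ hχ β _ := by
    rw [← reg_one_mem_GChOver, hθ] at hχ
    exact reg_one_injective (hS.transfer_mul hC hU hχ (reg 1 β))
  mod_mapsTo U hU φ hφ := by
    rw [hθ'] at hφ
    rw [hξ']
    exact (hS'.corresponds_transfer hC' hU hφ).2
  mod_add U hU φ hφ η hη := by
    rw [hθ'] at hφ hη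
    exact hS'.transfer_add hC' hU hφ hη
  mod_bijOn U hU := by
    rw [hθ', hξ']
    exact hS'.transfer_bijOn hC' hU
  mod_res K U hK hU hKU φ hφ := by
    rw [hθ'] at hφ
    exact hS'.transfer_res hC' hU hK hKU hφ
  mod_mul U hU φ hφ β _ := by
    rw [hθ'] at hφ
    exact hS'.transfer_mul hC' hU hφ β
  reg_ord U hU χ _ := by
    funext v
    rw [hS'.transfer_apply hU]
    exact (hS.transfer_apply hU (reg 1 χ) ⟨v.1, Nat.coprime_one_left _⟩).symm

end Main

end CommonCover

namespace CommonCover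

variable {G Γ E : Type*} [Group G] [Group Γ] [Group E] {N : Subgroup G} [N.Normal] {M : Subgroup Γ}
  [M.Normal] {C : CommonCover E N M} {d : ℕ}
  {ρ : Representation ℂ E (Fin d → ℂ)} {p : ℕ}

theorem pow_card_eq_one_of_scalar [NeZero d] {z : E} {a : ℂ} (ha : ρ z = a • 1) :
    a ^ Nat.card E = 1 := by
  have h1 : ρ z ^ Nat.card E = 1 := by rw [← map_pow, pow_card_eq_one', map_one]
  rw [ha, smul_pow, one_pow] at h1
  exact eq_of_smul_one_eq (h1.trans (one_smul ℂ _).symm)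

/-- If the traces of `ρ` are fixed by endomorphisms of `ℂ` that square the `p`-th roots of unity,
the kernel of `E → G` has no elements of order `p`. -/
theorem not_dvd_card [Finite Γ] (hp : p.Prime) (hodd : Odd p) [NeZero d]
    (hz : ∀ z, C.π z = 1 → ∃ a : ℂ, ρ z = a • 1) (hz' : ∀ z, C.π z = 1 → ρ z = 1 → z = 1)
    {m : ℕ} (hpm : p.Coprime m)
    (hfix : ∀ σ, FixesRoots m σ → ∀ y, σ (ρ.character y) = ρ.character y) :
    ¬ p ∣ Nat.card M := by
  intro hdvd
  have := Fact.mk hp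
  obtain ⟨v, hv⟩ := exists_prime_orderOf_dvd_card' p hdvd
  obtain ⟨z, hz1, hzv⟩ := C.exists_ker v.1 v.2
  obtain ⟨a, ha⟩ := hz z hz1
  have hzp : z ^ p = 1 := C.eq_of_q_eq (by rw [map_pow, hz1, one_pow]) (map_one _) (by
    rw [map_pow, hzv, map_one, ← Subgroup.coe_pow, ← hv, pow_orderOf_eq_one, Subgroup.coe_one])
  have hap : a ^ p = 1 := eq_of_smul_one_eq (V := Fin d → ℂ) (by
    rw [one_smul, ← one_pow p, ← smul_pow, ← ha, ← map_pow, hzp, map_one, one_pow])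
  have hm : m ≠ 0 := by
    rintro rfl
    exact hp.ne_one ((Nat.coprime_zero_right p).1 hpm)
  obtain ⟨τ, hτ, hτ2⟩ := exists_fixesRoots_square hm hodd hpm.symm
  have h1 := hfix τ hτ z
  have hchar : ρ.character z = a * d := by
    rw [character, ha, map_smul, LinearMap.trace_one, Module.finrank_fin_fun, smul_eq_mul]
  rw [hchar, map_mul, map_natCast, hτ2 a hap] at h1
  have h2 := mul_right_cancel₀ (Nat.cast_ne_zero.2 (NeZero.ne d)) h1
  have ha0 : a ≠ 0 := by
    rintro rfl
    rw [zero_pow hp.ne_zero] at hap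
    exact zero_ne_one hap
  have ha1 : a = 1 := by
    rw [pow_two] at h2
    exact mul_left_cancel₀ ha0 (h2.trans (mul_one a).symm)
  have hz1' : z = 1 := hz' z hz1 (by rw [ha, ha1, one_smul])
  have hv1 : v = 1 := Subtype.ext (by rw [← hzv, hz1', map_one]; rfl)
  rw [hv1, orderOf_one] at hv
  exact hp.ne_one hv.symm

/-- Characters corresponding to each other are simultaneously `p`-rational. -/
theorem Corresponds.isPRational_iff [Finite E] (hp : p.Prime) {m : ℕ} (hpm : p.Coprime m)
    (hfix : ∀ σ, FixesRoots m σ → ∀ y, σ (ρ.character y) = ρ.character y) {c : Γ → E}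
    (hS : C.IsTransferSection complexLift ρ c ρ.character) {U : Subgroup G} {hU : N ≤ U}
    {χ : U → ℂ} {χ' : corr C.τ U → ℂ}
    (h : C.Corresponds complexLift ρ hU (reg 1 χ) (reg 1 χ')) :
    IsPRational p χ ↔ IsPRational p χ' := by
  have hm : m ≠ 0 := by
    rintro rfl
    exact hp.ne_one ((Nat.coprime_zero_right p).1 hpm)
  have hζ := Complex.isPrimitiveRoot_exp m hm
  have hmem : ∀ y, ρ.character y ∈
      IntermediateField.adjoin ℚ {Complex.exp (2 * Real.pi * Complex.I / m)} := fun y =>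
    mem_adjoin_of_fixed hm hζ (isIntegral_character Nat.card_pos.ne' ρ (pow_card_eq_one' (x := y)))
      fun σ hσ => hfix σ hσ y
  have hrel : ∀ x : U.comap C.π, χ (C.πOn U x) = ρ.character x.1 * χ' (C.qOn hU x) := fun x => by
    have h2 := h ⟨x, Nat.coprime_one_left _⟩
    rw [complexLift_ltr] at h2
    exact h2
  constructor
  · refine fun hχ => hχ.of_mul hp hpm hζ fun v => ?_
    let x : U.comap C.π := ⟨c v.1, hS.π_mem hU v⟩
    refine ⟨C.πOn U x, (ρ.character x.1)⁻¹, inv_mem (hmem _), ?_⟩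
    have h1 : C.qOn hU x = v := Subtype.ext (hS.q_section v.1)
    rw [hrel, h1, inv_mul_cancel_left₀ (hS.ne_zero v.1)]
  · refine fun hχ => hχ.of_mul hp hpm hζ fun w => ?_
    obtain ⟨x, rfl⟩ := C.πOn_surjective U w
    exact ⟨C.qOn hU x, ρ.character x.1, hmem _, hrel x⟩

end CommonCover

end OrdMod

open OrdMod in
theorem theorem4p5 (p : ℕ) (hp : p.Prime) (hodd : Odd p)
    (𝔪 : Ideal AlgInt) [𝔪.IsMaximal] (h𝔪 : (p : AlgInt) ∈ 𝔪)
    (G : Type u) [Group G] [Finite G] (N : Subgroup G) [N.Normal] (θ : N → ℂ)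
    (hθ : IsCharTriple N θ) (hrat : IsPRational p θ) (hθ0 : IsIBr p 𝔪 (reg p θ)) :
    ∃ (Γ : Type u) (_ : Group Γ) (_ : Finite Γ) (M : Subgroup Γ) (_ : M.Normal) (ξ : M → ℂ)
      (iso : OrdModIso p 𝔪 θ ξ),
      IsOrdModTriple p 𝔪 M ξ ∧
      M ≤ Subgroup.center Γ ∧ ¬ p ∣ Nat.card M ∧
      ∀ (U : Subgroup G) (hU : N ≤ U), ∀ χ ∈ IrrOver hU θ,
        (IsPRational p χ ↔ IsPRational p (iso.ord U χ)) := by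
  obtain ⟨⟨d, X, hX, rfl⟩, hinv⟩ := hθ
  have hnt := (isIrreducible_iff.1 hX).1
  have hd : NeZero d := ⟨by
    rintro rfl
    exact not_nontrivial (Fin 0 → ℂ) hnt⟩
  obtain ⟨E, _, _, π, s, ρ, m, hπ, hs, hconj, rfl, hz, hz', hpm, hfix⟩ :=
    exists_covering hp hodd h𝔪 hX hinv hrat hθ0
  obtain ⟨Γ, _, M, _, C, rfl, rfl⟩ := exists_commonCover hπ hs hconj
  have hΓ : Finite Γ := Finite.of_surjective C.q C.q_surj
  have hcent := C.le_center hz hz'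
  obtain ⟨Ξ, hΞ⟩ := C.exists_scalarRep hz
  obtain ⟨ρ', hρ', hρs⟩ := exists_reduction hp h𝔪 ρ
  obtain ⟨Ξ', hΞ', hΞs⟩ := exists_reduction hp h𝔪 Ξ
  have hθ' : reg p (Representation.character (ρ.comp C.s : Representation ℂ N (Fin d → ℂ))) =
      (modularLift p 𝔪 hp h𝔪).gch (ρ'.comp C.s : Representation (AlgInt ⧸ 𝔪) N _) :=
    funext fun n => (congrFun hρ' (PReg.map C.s n)).symm
  have hirr' : Representation.IsIrreducible (k := AlgInt ⧸ 𝔪) (ρ'.comp C.s) :=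
    (modularLift p 𝔪 hp h𝔪).isIrreducible_of_isGIrr (by rw [← hθ']; exact hθ0)
  -- the scalars by which the kernel of `E → G` acts are roots of unity
  have hint : ∀ z, C.π z = 1 → ∃ a b : AlgInt, a * b = 1 ∧ ρ z = (a : ℂ) • 1 := fun z h => by
    obtain ⟨a, ha⟩ := hz z h
    have h1 := CommonCover.pow_card_eq_one_of_scalar ha
    have h2 : IsIntegral ℤ a := IsIntegral.of_pow Nat.card_pos (by rw [h1]; exact isIntegral_one)
    refine ⟨⟨a, h2⟩, ⟨a, h2⟩ ^ (Nat.card E - 1), ?_, ha⟩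
    rw [← pow_succ', Nat.sub_add_cancel Nat.card_pos]
    exact Subtype.ext h1
  have hC : C.IsCompatible ρ Ξ := ⟨hX, hz, hΞ, hcent⟩
  have hC' : C.IsCompatible ρ' Ξ' := by
    refine ⟨hirr', fun z h => ?_, fun z a' v h h1 h2 => ?_, hcent⟩
    · obtain ⟨a, -, -, ha⟩ := hint z h
      exact ⟨_, hρs z a ha⟩
    · obtain ⟨a, b, hab, ha⟩ := hint z h
      have hnt' := (isIrreducible_iff.1 hirr').1
      have h3 : a' = Ideal.Quotient.mk 𝔪 a :=
        eq_of_smul_one_eq (h1.symm.trans (hρs z a ha))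
      have h4 : a'⁻¹ = Ideal.Quotient.mk 𝔪 b :=
        inv_eq_of_mul_eq_one_right (by rw [h3, ← map_mul, hab, map_one])
      rw [h4]
      refine hΞs v b ?_
      rw [hΞ z a v h ha h2, inv_eq_of_mul_eq_one_right (congrArg Subtype.val hab)]
  obtain ⟨c, hc⟩ := C.exists_regular_section hp h𝔪 hX hθ0
  have hS : C.IsTransferSection complexLift ρ c ρ.character :=
    ⟨fun v => (hc v).1, fun v => (hc v).2.1, fun _ _ => Nat.coprime_one_left _,
      fun _ _ => complexLift_ltr _⟩
  have hS' : C.IsTransferSection (modularLift p 𝔪 hp h𝔪) ρ' c ρ.character :=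
    ⟨fun v => (hc v).1, fun v => (hc v).2.1, fun v => (hc v).2.2,
      fun x hx => congrFun hρ' ⟨x, hx⟩⟩
  have hθ1 : reg 1 (Representation.character (ρ.comp C.s : Representation ℂ N (Fin d → ℂ))) =
      complexLift.gch (ρ.comp C.s : Representation ℂ N (Fin d → ℂ)) := reg_one_character _
  refine ⟨Γ, inferInstance, hΓ, M, inferInstance, Ξ.character,
    C.ordModIso hC hC' hS hS' hθ1 hθ' (reg_one_character Ξ) hΞ'.symm,
    ⟨⟨⟨1, Ξ, CommonCover.isGIrr_rep_fin_one Ξ, rfl⟩, fun v n => ?_⟩,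
      1, Ξ', CommonCover.isGIrr_rep_fin_one Ξ', hΞ'.symm⟩,
    hcent, CommonCover.not_dvd_card hp hodd hz hz' hpm hfix, fun U hU χ hχ => ?_⟩
  · congr 1
    refine Subtype.ext ?_
    rw [MulAut.conjNormal_apply, Subgroup.mem_center_iff.1 (hcent n.2) v, mul_inv_cancel_right]
  · rw [← reg_one_mem_GIrrOver, hθ1] at hχ
    obtain ⟨η', -, -, h⟩ := C.exists_corresponds complexLift hC.irr hC.scalar hC.eq_inv hU hχ
    have h1 := hS.transfer_eq hU h
    rw [← h1] at h
    exact h.isPRational_iff hp hpm hfix hS
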